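/- All graphs are finite, simple and undirected. A \emph{homeomorphically irreducible spanning tree} (HIST) of a graph $G$ is a spanning tree of $G$ in which no vertex has degree $2$. A \emph{module} of $G=(V,E)$ is a set $M\subseteq V$ such that every vertex outside $M$ is adjacent to all vertices of $M$ or to none of them; a nonempty module is \emph{strong} if every other module is disjoint from it, contains it, or is contained in it. The nodes of the modular decomposition tree of $G$ are its strong modules; the children of a node $M$ are the inclusion-maximal strong modules properly contained in $M$, and the quotient graph of $M$ has the children of $M$ as vertices, two distinct children being adjacent if there is an edge of $G$ between them. A node is \emph{parallel} if its quotient graph has no edges, \emph{series} if its quotient graph is complete, and \emph{prime} otherwise. The \emph{modular-width} of $G$ is the maximum number of children of a prime node ($0$ if there is no prime node). \textbf{Theorem.} There are a deterministic algorithm (a random access machine program under the logarithmic cost measure) and a polynomial $q$ with nonnegative integer coefficients such that, for every $n\ge 0$ and every $n$-vertex graph $G$, given only as its adjacency matrix, the algorithm decides whether $G$ has a HIST in time at most $4^{k}\cdot q(n)$, where $k$ is the modular-width of $G$; that is, the existence of a HIST can be determined in $O^*(4^k)$ time. -/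

import Mathlib

/-! ## Homeomorphically irreducible spanning trees -/

/-- `T` is a homeomorphically irreducible spanning tree (HIST) of `G`: a spanning tree of `G`
without vertices of degree two. -/
def IsHIST {V : Type*} (G T : SimpleGraph V) : Prop :=
  T ≤ G ∧ T.IsTree ∧ ∀ v, (T.neighborSet v).ncard ≠ 2

/-- `G` has a HIST. -/
def HasHIST {V : Type*} (G : SimpleGraph V) : Prop :=
  ∃ T : SimpleGraph V, IsHIST G T

/-! ## Modular decomposition and modular-width -/

/-- A module: every vertex outside `M` is adjacent to all vertices of `M` or to none of them. -/
def IsGraphModule {V : Type*} (G : SimpleGraph V) (M : Set V) : Prop :=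
  ∀ w, w ∉ M → (∀ u ∈ M, G.Adj w u) ∨ (∀ u ∈ M, ¬ G.Adj w u)

/-- The nodes of the modular decomposition tree are the strong modules, i.e. the nonempty modules
that do not overlap any other module. -/
def IsStrongModule {V : Type*} (G : SimpleGraph V) (M : Set V) : Prop :=
  M.Nonempty ∧ IsGraphModule G M ∧
    ∀ N, IsGraphModule G N → Disjoint M N ∨ M ⊆ N ∨ N ⊆ M

/-- The children of a node `M` of the modular decomposition tree: the inclusion-maximal strong
modules that are properly contained in `M`. -/
def mdChildren {V : Type*} (G : SimpleGraph V) (M : Set V) : Set (Set V) :=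
  {C | Maximal (fun D => IsStrongModule G D ∧ D ⊂ M) C}

/-- The quotient graph of a node `M`: its vertices are the children of `M`, and two distinct
children are adjacent if there is an edge of `G` between them. -/
def mdQuotient {V : Type*} (G : SimpleGraph V) (M : Set V) : SimpleGraph (mdChildren G M) where
  Adj C D := C ≠ D ∧ ∃ u ∈ C.1, ∃ v ∈ D.1, G.Adj u v
  symm := ⟨fun _ _ ⟨h, u, hu, v, hv, huv⟩ => ⟨h.symm, v, hv, u, hu, huv.symm⟩⟩
  loopless := ⟨fun _ h => h.1 rfl⟩

/-- A node is prime if it is neither parallel (its quotient graph is edgeless) nor series (its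
quotient graph is complete). -/
def IsPrimeNode {V : Type*} (G : SimpleGraph V) (M : Set V) : Prop :=
  IsStrongModule G M ∧ mdQuotient G M ≠ ⊥ ∧ mdQuotient G M ≠ ⊤

/-- The sizes (numbers of children) of the prime nodes of the modular decomposition tree. -/
def primeNodeSizes {V : Type*} (G : SimpleGraph V) : Set ℕ :=
  {m | ∃ M, IsPrimeNode G M ∧ m = (mdChildren G M).ncard}

/-- The modular-width: the maximum size of a prime node of the modular decomposition tree
(`0` if there is no prime node). -/
noncomputable def modularWidth {V : Type*} (G : SimpleGraph V) : ℕ :=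
  sSup (primeNodeSizes G)

/-- For finite graphs the supremum in `modularWidth` is over a bounded set. -/
theorem primeNodeSizes_bddAbove {V : Type*} [Finite V] (G : SimpleGraph V) :
    BddAbove (primeNodeSizes G) := by
  refine ⟨Nat.card (Set V), ?_⟩
  rintro m ⟨M, -, rfl⟩
  exact Set.ncard_le_card _

/-! ## Random access machine programs with logarithmic cost

The memory consists of banks (arrays) of natural numbers; a program text mentions finitely many
banks, and the cells of a bank are accessed through computed addresses.  The cost of every
operation grows with the bit lengths of the numbers and of the addresses involved. -/

namespace RAM

/-- A memory: the content of cell `i` of bank `a` is `m a i`. -/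
abbrev Memory : Type := ℕ → ℕ → ℕ

/-- The binary operations. -/
inductive Op : Type
  | add | sub | mul | div | mod | eq | lt

/-- Values of the operations: truncated subtraction, integer division (by zero giving zero),
remainder, and comparisons with value `1` (true) or `0` (false). -/
def Op.apply : Op → ℕ → ℕ → ℕ
  | .add, x, y => x + y
  | .sub, x, y => x - y
  | .mul, x, y => x * y
  | .div, x, y => x / y
  | .mod, x, y => x % y
  | .eq, x, y => if x = y then 1 else 0
  | .lt, x, y => if x < y then 1 else 0

/-- Expressions: constants, memory reads (bank `a`, at the address given by an expression), and
operations. -/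
inductive Expr : Type
  | lit (c : ℕ)
  | read (a : ℕ) (i : Expr)
  | op (o : Op) (e f : Expr)

/-- The value of an expression. -/
def Expr.val (m : Memory) : Expr → ℕ
  | .lit c => c
  | .read a i => m a (i.val m)
  | .op o e f => o.apply (e.val m) (f.val m)

/-- The cost of evaluating an expression.  `Nat.size` is the number of binary digits; an operation
on operands `x` and `y` is charged `(1 + size x) * (1 + size y)`. -/
def Expr.cost (m : Memory) : Expr → ℕ
  | .lit c => 1 + Nat.size c
  | .read a i => i.cost m + 1 + Nat.size (i.val m) + Nat.size (m a (i.val m))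
  | .op _ e f => e.cost m + f.cost m + (1 + Nat.size (e.val m)) * (1 + Nat.size (f.val m))

/-- Programs. `write a i e` stores the value of `e` in the cell of bank `a` whose address is the
value of `i`; the tests of `ite` and `loop` (a while loop) are true if their value is nonzero. -/
inductive Prog : Type
  | skip
  | write (a : ℕ) (i e : Expr)
  | seq (p q : Prog)
  | ite (e : Expr) (p q : Prog)
  | loop (e : Expr) (p : Prog)

/-- The memory after storing `x` in cell `i` of bank `a`. -/
def Memory.set (m : Memory) (a i x : ℕ) : Memory :=
  fun b j => if b = a ∧ j = i then x else m b j

/-- `Exec p m m' t`: started in memory `m`, the program `p` halts in memory `m'` after a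
computation of total cost `t`. -/
inductive Exec : Prog → Memory → Memory → ℕ → Prop
  | skip (m : Memory) : Exec .skip m m 1
  | write (m : Memory) (a : ℕ) (i e : Expr) :
      Exec (.write a i e) m (m.set a (i.val m) (e.val m))
        (i.cost m + e.cost m + 1 + Nat.size (i.val m) + Nat.size (e.val m))
  | seq {p q : Prog} {m m₁ m₂ : Memory} {t₁ t₂ : ℕ} :
      Exec p m m₁ t₁ → Exec q m₁ m₂ t₂ → Exec (.seq p q) m m₂ (t₁ + t₂)
  | ite_true {e : Expr} {p q : Prog} {m m₁ : Memory} {t : ℕ} :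
      e.val m ≠ 0 → Exec p m m₁ t → Exec (.ite e p q) m m₁ (e.cost m + 1 + t)
  | ite_false {e : Expr} {p q : Prog} {m m₁ : Memory} {t : ℕ} :
      e.val m = 0 → Exec q m m₁ t → Exec (.ite e p q) m m₁ (e.cost m + 1 + t)
  | loop_true {e : Expr} {p : Prog} {m m₁ m₂ : Memory} {t₁ t₂ : ℕ} :
      e.val m ≠ 0 → Exec p m m₁ t₁ → Exec (.loop e p) m₁ m₂ t₂ →
        Exec (.loop e p) m m₂ (e.cost m + 1 + t₁ + t₂)
  | loop_false {e : Expr} {p : Prog} {m : Memory} :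
      e.val m = 0 → Exec (.loop e p) m m (e.cost m + 1)

/-- Programs are deterministic: the final memory and the running time are unique. -/
theorem Exec.deterministic {p : Prog} {m m₁ m₂ : Memory} {t₁ t₂ : ℕ}
    (h₁ : Exec p m m₁ t₁) (h₂ : Exec p m m₂ t₂) : m₁ = m₂ ∧ t₁ = t₂ := by
  induction h₁ generalizing m₂ t₂ with
  | skip => cases h₂; exact ⟨rfl, rfl⟩
  | write => cases h₂; exact ⟨rfl, rfl⟩
  | seq _ _ ih₁ ih₂ =>
    cases h₂ with
    | seq h h' =>
      obtain ⟨rfl, rfl⟩ := ih₁ h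
      obtain ⟨rfl, rfl⟩ := ih₂ h'
      exact ⟨rfl, rfl⟩
  | ite_true he _ ih =>
    cases h₂ with
    | ite_true _ h => obtain ⟨rfl, rfl⟩ := ih h; exact ⟨rfl, rfl⟩
    | ite_false he' _ => exact absurd he' he
  | ite_false he _ ih =>
    cases h₂ with
    | ite_true he' _ => exact absurd he he'
    | ite_false _ h => obtain ⟨rfl, rfl⟩ := ih h; exact ⟨rfl, rfl⟩
  | loop_true he _ _ ih₁ ih₂ =>
    cases h₂ with
    | loop_true _ h h' =>
      obtain ⟨rfl, rfl⟩ := ih₁ h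
      obtain ⟨rfl, rfl⟩ := ih₂ h'
      exact ⟨rfl, rfl⟩
    | loop_false he' => exact absurd he' he
  | loop_false he =>
    cases h₂ with
    | loop_true he' _ _ => exact absurd he he'
    | loop_false _ => exact ⟨rfl, rfl⟩

open Classical in
/-- The initial memory on input a graph `G` with vertex set `{0, …, n - 1}`: cell `0` of bank `0`
holds `n`, cell `u * n + v` of bank `1` holds the entry `(u, v)` of the adjacency matrix, and all
other cells hold `0`. -/
noncomputable def graphInput {n : ℕ} (G : SimpleGraph (Fin n)) : Memory := fun a i =>
  if a = 0 ∧ i = 0 then n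
  else if a = 1 ∧ ∃ u v : Fin n, i = u.val * n + v.val ∧ G.Adj u v then 1
  else 0

open Classical in
/-- On input `G`, the program `p` halts after a computation of cost at most `t` and answers, in
cell `0` of bank `0`, the question whether `P` holds: `1` for yes and `0` for no. -/
def DecidesWithin {n : ℕ} (p : Prog) (G : SimpleGraph (Fin n)) (P : Prop) (t : ℕ) : Prop :=
  ∃ (m : Memory) (s : ℕ), Exec p (graphInput G) m s ∧ s ≤ t ∧ m 0 0 = if P then 1 else 0

end RAM

/-!
Let two vertices be *similar* if some module other than the whole vertex set contains both.

*A HIST with few possible inner vertices.* Suppose that `G` and its complement are connected. Then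
overlapping proper modules have a proper union, so that similarity is an equivalence relation whose
classes are proper modules (`isGraphModule_sim`), and the whole graph is a prime node of the
modular decomposition tree with at least as many children as there are classes
(`card_le_modularWidth`). A HIST with as few inner vertices as possible has at most one inner
vertex in each proper module (`exists_isHIST_module_inner_unique`): if `q`, `y` are inner vertices
in a module and `w` is an inner vertex outside it that is a tree neighbour of `q`, then `y` can be
turned into a leaf by moving its tree neighbours to `q` or `w`, whose degrees only grow. A
permutation of the vertices inside each class then moves the inner vertices to fixed
representatives, provided that these have the largest possible degree within their classes
(`exists_isHIST_inner_mem`). If the complement of `G` is disconnected, then `G` is a join, and if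
it has a HIST, it has one that is a star or a double star
(`accept_pair_of_not_preconnected_compl`). Altogether, `G` has a HIST if and only if it has one
whose inner vertices are among some two vertices or among the representatives, of which there are
at most `modularWidth G + 2` (`hasHIST_iff_accept`, `card_reps_le`).

*Dynamic programming.*  Fix a set `R` of candidates for the inner vertices.  A HIST whose inner
vertices belong to `R` arises by growing a tree on `R` from an edge and then attaching the other
vertices, one after the other, as leaves.  Such a construction only needs to remember the degrees
of the vertices in `R`, where degrees larger than three need not be distinguished; a degree vector
is a number with `R.card` digits in base four.  The degree `0` also records that a vertex has not
been reached yet, and the end result is good if and only if all digits are odd (`accept_iff`).  The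
reachable numbers satisfy the recurrences `stageCode_zero_iff` and `stageCode_succ_iff`, which
express them by smaller numbers or earlier stages.

*The program.*  The program is a sequence of loops that each fill one table, from the first to the
last cell, with the values of an expression that may refer to the earlier cells and tables
(`fill_run`), often in the form of partial sums (`fillSum_run`), which serve to evaluate existential
quantifiers.  Similarity of vertices is computed through transitive closures (`sim_iff_fw`).  Every
table has at most `tabSize G`, that is `(n + 1) ^ 4 * 16 * 4 ^ (reps G).card`, cells, and every
step is an evaluation of a fixed expression on numbers with `O(n)` bits.
-/

namespace RAM

/-! ### Cost of expressions and of table fills -/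

/-- A syntactic weight: the bit length of the value and the cost of an expression are bounded in
terms of its weight and the bit length of the memory contents. -/
def Expr.weight : Expr → ℕ
  | .lit c => Nat.size c + 1
  | .read _ i => i.weight + 1
  | .op _ e f => e.weight + f.weight

/-- All memory cells hold numbers with at most `b` bits. -/
def MemBdd (b : ℕ) (m : Memory) : Prop := ∀ a i, m a i < 2 ^ b

theorem Expr.one_le_weight (e : Expr) : 1 ≤ e.weight := by
  induction e <;> simp only [Expr.weight] <;> omega

theorem Expr.val_lt {b : ℕ} (hb : 1 ≤ b) {m : Memory} (hm : MemBdd b m) (e : Expr) :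
    e.val m < 2 ^ (e.weight * b) := by
  induction e with
  | lit c =>
    refine lt_of_lt_of_le (Nat.lt_size_self c) (Nat.pow_le_pow_right (by norm_num) ?_)
    simp only [Expr.weight]; nlinarith
  | read a i _ =>
    refine lt_of_lt_of_le (hm _ _) (Nat.pow_le_pow_right (by norm_num) ?_)
    simp only [Expr.weight]; nlinarith
  | op o e f he hf =>
    have h1 : 2 ≤ 2 ^ (e.weight * b) :=
      Nat.le_self_pow (by have := e.one_le_weight; positivity) 2
    have h2 : 2 ≤ 2 ^ (f.weight * b) :=
      Nat.le_self_pow (by have := f.one_le_weight; positivity) 2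
    simp only [Expr.weight, Expr.val, add_mul, pow_add]
    generalize e.val m = x at *
    generalize f.val m = y at *
    generalize 2 ^ (e.weight * b) = X at *
    generalize 2 ^ (f.weight * b) = Y at *
    have hX : X ≤ X * Y := Nat.le_mul_of_pos_right _ (by omega)
    have hY : Y ≤ X * Y := Nat.le_mul_of_pos_left _ (by omega)
    cases o <;> simp only [Op.apply]
    · nlinarith
    · omega
    · exact Nat.mul_lt_mul'' he hf
    · have := Nat.div_le_self x y; omega
    · have := Nat.mod_le x y; omega
    · split <;> omega
    · split <;> omega

theorem Expr.size_val_le {b : ℕ} (hb : 1 ≤ b) {m : Memory} (hm : MemBdd b m) (e : Expr) :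
    Nat.size (e.val m) ≤ e.weight * b :=
  Nat.size_le.2 (e.val_lt hb hm)

theorem Expr.cost_le {b : ℕ} (hb : 1 ≤ b) {m : Memory} (hm : MemBdd b m) (e : Expr) :
    e.cost m ≤ e.weight * (1 + e.weight * b) ^ 2 := by
  induction e with
  | lit c =>
    simp only [Expr.weight, Expr.cost]
    nlinarith [Nat.zero_le ((c.size + 1) * b), Nat.zero_le (c.size * ((c.size + 1) * b))]
  | read a i hi =>
    have h1 := i.size_val_le hb hm
    have h2 : Nat.size (m a (i.val m)) ≤ b := Nat.size_le.2 (hm _ _)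
    simp only [Expr.weight, Expr.cost]
    generalize i.weight = w at *
    have h3 : w * (1 + w * b) ^ 2 ≤ w * (1 + (w + 1) * b) ^ 2 := by gcongr; omega
    nlinarith [Nat.zero_le (w * b)]
  | op o e f he hf =>
    have h1 := e.size_val_le hb hm
    have h2 := f.size_val_le hb hm
    have h3 := e.one_le_weight
    have h4 := f.one_le_weight
    have h5 := Nat.mul_le_mul (Nat.add_le_add_left h1 1) (Nat.add_le_add_left h2 1)
    simp only [Expr.weight, Expr.cost]
    refine le_trans (Nat.add_le_add (Nat.add_le_add he hf) h5) ?_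
    obtain ⟨x, hx⟩ : ∃ x, x = e.weight * b := ⟨_, rfl⟩
    obtain ⟨y, hy⟩ : ∃ y, y = f.weight * b := ⟨_, rfl⟩
    have hx1 : 1 ≤ x := hx ▸ Nat.mul_pos h3 hb
    have hy1 : 1 ≤ y := hy ▸ Nat.mul_pos h4 hb
    rw [show (e.weight + f.weight) * b = x + y by rw [hx, hy]; ring, ← hx, ← hy]
    have a1 : y * (2 + 2 * x + y) ≤ e.weight * (y * (2 + 2 * x + y)) :=
      Nat.le_mul_of_pos_left _ h3
    have a2 : x * (2 + 2 * y + x) ≤ f.weight * (x * (2 + 2 * y + x)) :=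
      Nat.le_mul_of_pos_left _ h4
    nlinarith

/-- `p` leads from `m` to `m'` at cost at most `T`. -/
def Run (p : Prog) (m m' : Memory) (T : ℕ) : Prop := ∃ t ≤ T, Exec p m m' t

theorem Run.seq {p q : Prog} {m m₁ m₂ : Memory} {T₁ T₂ : ℕ} (h₁ : Run p m m₁ T₁)
    (h₂ : Run q m₁ m₂ T₂) : Run (.seq p q) m m₂ (T₁ + T₂) := by
  obtain ⟨t₁, l₁, e₁⟩ := h₁
  obtain ⟨t₂, l₂, e₂⟩ := h₂
  exact ⟨t₁ + t₂, Nat.add_le_add l₁ l₂, e₁.seq e₂⟩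

/-- The bound used for the cost of a bounded number of operations on `b`-bit numbers. -/
def unitCost (M b : ℕ) : ℕ := M * (1 + M * b) ^ 2

theorem unitCost_mono {M M' : ℕ} (h : M ≤ M') (b : ℕ) : unitCost M b ≤ unitCost M' b := by
  unfold unitCost; gcongr

theorem unitCost_add (M M' b : ℕ) : unitCost M b + unitCost M' b ≤ unitCost (M + M') b := by
  unfold unitCost
  have h1 : M * (1 + M * b) ^ 2 ≤ M * (1 + (M + M') * b) ^ 2 := by gcongr; omega
  have h2 : M' * (1 + M' * b) ^ 2 ≤ M' * (1 + (M + M') * b) ^ 2 := by gcongr; omega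
  rw [add_mul]
  exact Nat.add_le_add h1 h2

theorem Run.write {b : ℕ} (hb : 1 ≤ b) {m : Memory} (hm : MemBdd b m) (a : ℕ) (i e : Expr) :
    Run (.write a i e) m (m.set a (i.val m) (e.val m))
      (unitCost (2 * i.weight + 2 * e.weight) b) := by
  refine ⟨_, ?_, Exec.write m a i e⟩
  have h1 := i.cost_le hb hm
  have h2 := e.cost_le hb hm
  have h3 := i.size_val_le hb hm
  have h4 := e.size_val_le hb hm
  have h5 := i.one_le_weight
  have key : ∀ w, 1 ≤ w → w * b + 1 ≤ w * (1 + w * b) ^ 2 := by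
    intro w hw
    have : 1 + w * b ≤ (1 + w * b) ^ 2 := by nlinarith [Nat.zero_le (w * b)]
    nlinarith [Nat.zero_le (w * b)]
  have h6 := key _ h5
  have h7 := key _ e.one_le_weight
  have h8 := unitCost_add i.weight i.weight b
  have h9 := unitCost_add e.weight e.weight b
  have h10 := unitCost_add (i.weight + i.weight) (e.weight + e.weight) b
  have h11 : 2 * i.weight + 2 * e.weight = i.weight + i.weight + (e.weight + e.weight) := by ring
  rw [h11]
  simp only [unitCost] at *
  omega

theorem MemBdd.set {b : ℕ} {m : Memory} (hm : MemBdd b m) (a i : ℕ) {x : ℕ} (hx : x < 2 ^ b) :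
    MemBdd b (m.set a i x) := by
  intro c j
  unfold Memory.set
  split
  · exact hx
  · exact hm c j

/-- The bank that holds the loop counter. -/
abbrev ctr : ℕ := 2

/-- The loop counter. -/
abbrev Expr.I : Expr := .read ctr (.lit 0)

/-- The loop storing in the cells `0, …, N - 1` of bank `a` the successive values of `e`, which
may depend on the loop counter and on the cells already filled. -/
def fill (a : ℕ) (N e : Expr) : Prog :=
  .seq (.write ctr (.lit 0) (.lit 0))
    (.loop (.op .lt .I N)
      (.seq (.write a .I e) (.write ctr (.lit 0) (.op .add .I (.lit 1)))))

/-- The memories `m` and `m'` agree, except for bank `a` and the loop counter. -/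
def SameOff (a : ℕ) (m m' : Memory) : Prop := ∀ a', a' ≠ a → a' ≠ ctr → m' a' = m a'

/-- To verify a loop `fill a N e` it suffices to name the table `f` it is to compute and to check
the recurrence: `e` evaluates to `f i` if the cells below `i` hold the right values. -/
theorem fill_run (a : ℕ) (ha : a ≠ ctr) (N e : Expr) :
    ∃ M, ∀ (b : ℕ) (m : Memory) (Nv : ℕ) (f : ℕ → ℕ), 1 ≤ b → MemBdd b m → Nv < 2 ^ b →
      (∀ i < Nv, f i < 2 ^ b) →
      (∀ m', SameOff a m m' → N.val m' = Nv) →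
      (∀ i < Nv, ∀ m', m' ctr 0 = i → (∀ j < i, m' a j = f j) → SameOff a m m' →
        e.val m' = f i) →
      ∃ m', Run (fill a N e) m m' ((Nv + 1) * unitCost M b) ∧ MemBdd b m' ∧
        (∀ j < Nv, m' a j = f j) ∧ SameOff a m m' := by
  obtain ⟨M₁, hM₁⟩ : ∃ M, M = (Expr.op .lt .I N).weight + 1 := ⟨_, rfl⟩
  obtain ⟨M₂, hM₂⟩ : ∃ M, M = 2 * Expr.I.weight + 2 * e.weight := ⟨_, rfl⟩
  obtain ⟨M₃, hM₃⟩ : ∃ M, M = 2 * (Expr.lit 0).weight + 2 * (Expr.op .add .I (.lit 1)).weight :=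
    ⟨_, rfl⟩
  obtain ⟨M₀, hM₀⟩ : ∃ M, M = 2 * (Expr.lit 0).weight + 2 * (Expr.lit 0).weight := ⟨_, rfl⟩
  refine ⟨M₀ + (M₁ + M₂ + M₃), fun b m Nv f hb hm hN hf hNv he => ?_⟩
  have test : ∀ m', MemBdd b m' → (Expr.op .lt .I N).cost m' + 1 ≤ unitCost M₁ b := by
    intro m' hm'
    have h1 := (Expr.op .lt .I N).cost_le hb hm'
    have h2 : unitCost 1 b ≥ 1 := by unfold unitCost; nlinarith [Nat.zero_le b]
    have h3 := unitCost_add (Expr.op .lt .I N).weight 1 b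
    rw [← hM₁] at h3
    unfold unitCost at *
    omega
  -- The remaining `k` rounds of the loop, starting with the counter at `i`.
  have main : ∀ k i m₁, k + i = Nv → MemBdd b m₁ → m₁ ctr 0 = i → (∀ j < i, m₁ a j = f j) →
      SameOff a m m₁ → ∃ m', Run (.loop (.op .lt .I N)
        (.seq (.write a .I e) (.write ctr (.lit 0) (.op .add .I (.lit 1))))) m₁ m'
        (k * unitCost (M₁ + M₂ + M₃) b + unitCost M₁ b) ∧ MemBdd b m' ∧
        (∀ j < Nv, m' a j = f j) ∧ SameOff a m m' := by
    intro k
    induction k with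
    | zero =>
      intro i m₁ hi hb₁ hc hj hs
      refine ⟨m₁, ⟨_, ?_, Exec.loop_false ?_⟩, hb₁, ?_, hs⟩
      · have := test m₁ hb₁
        omega
      · simp only [Expr.val, Op.apply, hNv m₁ hs, hc]
        rw [if_neg (by omega)]
      · intro j hj'
        exact hj j (by omega)
    | succ k ih =>
      intro i m₁ hi hb₁ hc hj hs
      have hval := he i (by omega) m₁ hc hj hs
      have hI : ∀ m' : Memory, Expr.I.val m' = m' ctr 0 := fun _ => rfl
      have r1 := Run.write hb hb₁ a .I e
      rw [hI, hc, hval, ← hM₂] at r1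
      have hb₂ := hb₁.set a i (hf i (by omega))
      have r2 := Run.write hb hb₂ ctr (.lit 0) (.op .add .I (.lit 1))
      have hc2 : (m₁.set a i (f i)) ctr 0 = i := by
        simp [Memory.set, Ne.symm ha, hc]
      have hv2 : (Expr.op .add .I (.lit 1)).val (m₁.set a i (f i)) = i + 1 := by
        simp only [Expr.val, Op.apply, hc2]
      rw [hv2, ← hM₃] at r2
      have hb₃ := hb₂.set ctr 0 (x := i + 1) (by omega)
      obtain ⟨m', hr, hb', hj', hs'⟩ := ih (i + 1) ((m₁.set a i (f i)).set ctr 0 (i + 1))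
        (by omega) hb₃ (by simp [Memory.set])
        (by
          intro j hj'
          simp only [Memory.set, ha, false_and, if_false, true_and]
          split
          · next h => rw [h]
          · exact hj j (by omega))
        (by
          intro c hca hcc
          funext j
          simp only [Memory.set, hca, hcc, false_and, if_false]
          rw [hs c hca hcc])
      obtain ⟨t₁, l₁, e₁⟩ := r1.seq r2
      obtain ⟨t₂, l₂, e₂⟩ := hr
      refine ⟨m', ⟨_, ?_, Exec.loop_true ?_ e₁ e₂⟩, hb', hj', hs'⟩
      · have t3 := test m₁ hb₁
        have t4 := unitCost_add M₁ M₂ b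
        have t5 := unitCost_add (M₁ + M₂) M₃ b
        rw [add_mul]
        omega
      · simp only [Expr.val, Op.apply, hNv m₁ hs, hc]
        rw [if_pos (by omega)]
        exact one_ne_zero
  have r0 := Run.write hb hm ctr (.lit 0) (.lit 0)
  rw [← hM₀] at r0
  obtain ⟨m', hr, hb', hj', hs'⟩ := main Nv 0 (m.set ctr 0 0) rfl
    (hm.set ctr 0 (by positivity)) (by simp [Memory.set]) (by simp)
    (by
      intro c hca hcc
      funext j
      simp only [Memory.set, hcc, false_and, if_false])
  refine ⟨m', ?_, hb', hj', hs'⟩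
  obtain ⟨t, l, ex⟩ := r0.seq hr
  refine ⟨t, l.trans ?_, ex⟩
  have t1 := unitCost_add M₀ (M₁ + M₂ + M₃) b
  have t2 : unitCost M₁ b ≤ unitCost (M₁ + M₂ + M₃) b := unitCost_mono (by omega) b
  have t3 : Nv * unitCost (M₁ + M₂ + M₃) b ≤ Nv * unitCost (M₀ + (M₁ + M₂ + M₃)) b :=
    Nat.mul_le_mul_left _ (unitCost_mono (by omega) b)
  rw [add_mul, one_mul]
  omega

/-- Tables of partial sums: cell `i * L + j`, for `j < L`, of bank `a` receives the sum of the first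
`j` values of the expression `g` belonging to the row `i`. -/
def fillSum (a : ℕ) (L N g : Expr) : Prog :=
  fill a N (.op .mul (.op .lt (.lit 0) (.op .mod .I L))
    (.op .add (.read a (.op .sub .I (.lit 1))) g))

theorem mul_add_mod_eq {L j : ℕ} (hj : j < L) {i : ℕ} : (i * L + j) % L = j := by
  rw [Nat.add_comm, Nat.add_mul_mod_self_right, Nat.mod_eq_of_lt hj]

theorem mul_add_div_eq {L j : ℕ} (hj : j < L) {i : ℕ} : (i * L + j) / L = i := by
  rw [Nat.add_comm, Nat.add_mul_div_right _ _ (by omega), Nat.div_eq_of_lt hj, zero_add]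

/-- The table computed by `fillSum`. -/
def rowSum (L : ℕ) (g : ℕ → ℕ → ℕ) (x : ℕ) : ℕ := ∑ j ∈ Finset.range (x % L), g (x / L) j

theorem rowSum_eq {L : ℕ} (g : ℕ → ℕ → ℕ) (i : ℕ) {j : ℕ} (hj : j < L) :
    rowSum L g (i * L + j) = ∑ k ∈ Finset.range j, g i k := by
  unfold rowSum
  rw [mul_add_mod_eq hj, mul_add_div_eq hj]

theorem fillSum_run (a : ℕ) (ha : a ≠ ctr) (L N g : Expr) :
    ∃ M, ∀ (b : ℕ) (m : Memory) (Lv Nv : ℕ) (f : ℕ → ℕ → ℕ), 1 ≤ b → MemBdd b m →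
      Nv < 2 ^ b → Lv < 2 ^ b → 0 < Lv →
      (∀ i j, f i j ≤ 1) →
      (∀ m', SameOff a m m' → N.val m' = Nv) →
      (∀ m', SameOff a m m' → L.val m' = Lv) →
      (∀ i j, j + 1 < Lv → i * Lv + (j + 1) < Nv → ∀ m', m' ctr 0 = i * Lv + (j + 1) →
        (∀ k < i * Lv + (j + 1), m' a k = rowSum Lv f k) → SameOff a m m' →
        g.val m' = f i j) →
      ∃ m', Run (fillSum a L N g) m m' ((Nv + 1) * unitCost M b) ∧ MemBdd b m' ∧
        (∀ j < Nv, m' a j = rowSum Lv f j) ∧ SameOff a m m' := by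
  obtain ⟨M, hM⟩ := fill_run a ha N (.op .mul (.op .lt (.lit 0) (.op .mod .I L))
    (.op .add (.read a (.op .sub .I (.lit 1))) g))
  refine ⟨M, fun b m Lv Nv f hb hm hN hL hL0 hf hNv hLv hg => ?_⟩
  refine hM b m Nv (rowSum Lv f) hb hm hN (fun i _ => ?_) hNv (fun i hi m' hc hj hs => ?_)
  · refine lt_of_le_of_lt ?_ hL
    unfold rowSum
    refine (Finset.sum_le_card_nsmul _ _ 1 (fun j _ => hf _ j)).trans ?_
    simpa using (Nat.mod_lt i hL0).le
  · obtain ⟨q, r, hr, rfl⟩ : ∃ q r, r < Lv ∧ i = q * Lv + r :=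
      ⟨i / Lv, i % Lv, Nat.mod_lt _ hL0, (Nat.div_add_mod' i Lv).symm⟩
    rw [rowSum_eq f q hr]
    have hmod : (q * Lv + r) % Lv = r := mul_add_mod_eq hr
    simp only [Expr.val, Op.apply, hc, hLv m' hs, hmod]
    cases r with
    | zero => simp
    | succ r =>
      rw [hg q r hr hi m' hc hj hs, hj _ (by omega)]
      have : q * Lv + (r + 1) - 1 = q * Lv + r := by omega
      rw [this, rowSum_eq f q (by omega), Finset.sum_range_succ]
      simp

end RAM

namespace HIST

open SimpleGraph

variable {V : Type*}

/-! ### Trees: degrees, leaves and surgery -/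

/-- The degree of `v` in `T`. -/
noncomputable def dg (T : SimpleGraph V) (v : V) : ℕ := (T.neighborSet v).ncard

/-- A set that contains a vertex and is closed under adjacency contains all vertices. -/
theorem mem_of_closed {T : SimpleGraph V} (hT : T.Preconnected) {S : Set V} {a : V} (ha : a ∈ S)
    (hS : ∀ x ∈ S, ∀ y, T.Adj x y → y ∈ S) (b : V) : b ∈ S := by
  obtain ⟨p⟩ := hT a b
  induction p with
  | nil => exact ha
  | cons h _ ih => exact ih (hS _ ha _ h)

theorem exists_adj_compl_of_preconnected {T : SimpleGraph V} (hT : T.Preconnected) {S : Set V}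
    (h1 : S.Nonempty) (h2 : S ≠ Set.univ) : ∃ x ∈ S, ∃ y ∉ S, T.Adj x y := by
  by_contra! h
  obtain ⟨a, ha⟩ := h1
  exact h2 (Set.eq_univ_of_forall
    (mem_of_closed hT ha fun x hx y hxy => by_contra fun hy => h x hx y hy hxy))

theorem dg_sup_edge [Finite V] {T : SimpleGraph V} {a b : V} (hab : a ≠ b) (h : ¬ T.Adj a b)
    (v : V) [Decidable (v = a ∨ v = b)] :
    dg (T ⊔ edge a b) v = dg T v + if v = a ∨ v = b then 1 else 0 := by
  unfold dg
  by_cases h1 : v = a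
  · subst h1
    have : (T ⊔ edge v b).neighborSet v = insert b (T.neighborSet v) := by
      ext x
      simp only [mem_neighborSet, sup_adj, edge_adj, Set.mem_insert_iff]
      grind
    rw [this, Set.ncard_insert_of_notMem (by simpa using h)]
    simp
  · by_cases h2 : v = b
    · subst h2
      have : (T ⊔ edge a v).neighborSet v = insert a (T.neighborSet v) := by
        ext x
        simp only [mem_neighborSet, sup_adj, edge_adj, Set.mem_insert_iff]
        grind
      rw [this, Set.ncard_insert_of_notMem (by simpa using fun h' => h h'.symm)]
      simp
    · have : (T ⊔ edge a b).neighborSet v = T.neighborSet v := by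
        ext x
        simp only [mem_neighborSet, sup_adj, edge_adj]
        grind
      rw [this]
      simp [h1, h2]

theorem one_le_dg [Finite V] {T : SimpleGraph V} {x y : V} (h : T.Adj x y) : 1 ≤ dg T x :=
  (Set.ncard_pos (Set.toFinite _)).2 ⟨y, h⟩

theorem exists_adj_of_dg_ne_zero {T : SimpleGraph V} {x : V} (h : dg T x ≠ 0) : ∃ y, T.Adj x y :=
  Set.nonempty_of_ncard_ne_zero h

theorem eq_of_dg_eq_one {T : SimpleGraph V} {x y z : V} (h : dg T x = 1) (hy : T.Adj x y)
    (hz : T.Adj x z) : y = z := by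
  obtain ⟨a, ha⟩ := Set.ncard_eq_one.1 h
  have h1 : y ∈ T.neighborSet x := hy
  have h2 : z ∈ T.neighborSet x := hz
  rw [ha] at h1 h2
  exact h1.trans h2.symm

theorem dg_ne_zero [Finite V] [Nontrivial V] {T : SimpleGraph V} (hT : T.Preconnected) (x : V) :
    dg T x ≠ 0 := by
  obtain ⟨a, rfl, b, -, h⟩ := exists_adj_compl_of_preconnected hT (Set.singleton_nonempty x)
    (by
      obtain ⟨y, hy⟩ := exists_ne x
      intro h
      exact hy (h.symm ▸ Set.mem_univ y : y ∈ ({x} : Set V)))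
  exact Nat.one_le_iff_ne_zero.1 (one_le_dg h)

/-- The first step `y'` on the path from `y` to `q`. -/
theorem exists_adj_toward {T : SimpleGraph V} (hT : T.Preconnected) {y q : V} (h : q ≠ y) :
    ∃ y', T.Adj y y' ∧ (T.deleteIncidenceSet y).Reachable y' q := by
  have := mem_of_closed hT (S := {q | q = y ∨ ∃ y', T.Adj y y' ∧
    (T.deleteIncidenceSet y).Reachable y' q}) (a := y) (Or.inl rfl) ?_ q
  · exact this.resolve_left h
  · rintro a (rfl | ⟨y', h1, h2⟩) b hab
    · exact Or.inr ⟨b, hab, Reachable.refl _⟩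
    · by_cases hb : b = y
      · exact Or.inl hb
      · by_cases ha : a = y
        · exact Or.inr ⟨b, ha ▸ hab, Reachable.refl _⟩
        · exact Or.inr ⟨y', h1, h2.trans (Adj.reachable (by
            rw [deleteIncidenceSet_adj]; exact ⟨hab, ha, hb⟩))⟩

/-- If, in a tree, a set contains all vertices that are not leaves, then the tree edges inside it
connect it. -/
theorem exists_adj_of_leaves_compl {T : SimpleGraph V} (hT : T.Preconnected) {R W : Set V}
    (hR : ∀ v ∉ R, dg T v = 1) (hWR : W ⊆ R) (hW : W.Nonempty) (hne : W ≠ R) :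
    ∃ x ∈ W, ∃ y ∈ R, y ∉ W ∧ T.Adj x y := by
  by_contra! h
  obtain ⟨a, ha⟩ := hW
  obtain ⟨r, hr, hrW⟩ := Set.exists_of_ssubset (hWR.ssubset_of_ne hne)
  have := mem_of_closed hT (S := {v | v ∈ W ∨ (v ∉ R ∧ ∃ w ∈ W, T.Adj v w)}) (a := a)
    (Or.inl ha) ?_ r
  · rcases this with h | h
    · exact hrW h
    · exact h.1 hr
  · rintro x (hx | ⟨hx, w, hw, hxw⟩) y hxy
    · by_cases hy : y ∈ R
      · by_cases hyW : y ∈ W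
        · exact Or.inl hyW
        · exact absurd hxy (h x hx y hy hyW)
      · exact Or.inr ⟨hy, x, hx, hxy.symm⟩
    · rw [eq_of_dg_eq_one (hR x hx) hxy hxw]
      exact Or.inl hw

/-- A connected spanning subgraph of a forest is the whole forest. -/
theorem eq_of_le_of_preconnected_of_isAcyclic {H T : SimpleGraph V} (hH : H.Preconnected)
    (hT : T.IsAcyclic)
    (h : H ≤ T) : H = T := by
  refine le_antisymm h fun a b hab => ?_
  by_contra hn
  refine isAcyclic_iff_forall_adj_isBridge.1 hT hab ((hH a b).mono ?_)
  intro c d hcd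
  rw [deleteEdges_adj]
  refine ⟨h hcd, fun he => hn ?_⟩
  rw [Set.mem_singleton_iff, Sym2.eq_iff] at he
  rcases he with ⟨rfl, rfl⟩ | ⟨rfl, rfl⟩
  · exact hcd
  · exact hcd.symm

/-- Moving the end `y` of the tree edge `yz` to a vertex `t` on the same side of that edge. -/
theorem isTree_move {T : SimpleGraph V} (hT : T.IsTree) {y y' z t : V} (hyz : T.Adj y z)
    (hyy' : T.Adj y y') (hz : z ≠ y') (hty : t ≠ y) (hr : (T.deleteIncidenceSet y).Reachable y' t) :
    ¬ T.Adj t z ∧ t ≠ z ∧ (T.deleteEdges {s(y, z)} ⊔ edge t z).IsTree := by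
  have hbr := isAcyclic_iff_forall_adj_isBridge.1 hT.isAcyclic hyz
  rw [isBridge_iff] at hbr
  set D := T.deleteEdges {s(y, z)} with hD
  have hle : T.deleteIncidenceSet y ≤ D := by
    intro a b hab
    rw [deleteIncidenceSet_adj] at hab
    rw [hD, deleteEdges_adj]
    refine ⟨hab.1, fun he => ?_⟩
    rw [Set.mem_singleton_iff, Sym2.eq_iff] at he
    rcases he with ⟨rfl, -⟩ | ⟨-, rfl⟩
    · exact hab.2.1 rfl
    · exact hab.2.2 rfl
  have hyt : D.Reachable y t := by
    refine Reachable.trans (Adj.reachable ?_) (hr.mono hle)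
    rw [hD, deleteEdges_adj]
    refine ⟨hyy', fun he => ?_⟩
    rw [Set.mem_singleton_iff, Sym2.eq_iff] at he
    rcases he with ⟨-, h⟩ | ⟨h, -⟩
    · exact hz h.symm
    · exact hyz.ne h
  have htz : t ≠ z := fun h => hbr (h ▸ hyt)
  have hntz : ¬ D.Reachable t z := fun h => hbr (hyt.trans h)
  refine ⟨fun h => hntz (Adj.reachable ?_), htz, ⟨?_, ?_⟩⟩
  · rw [hD, deleteEdges_adj]
    refine ⟨h, fun he => ?_⟩
    rw [Set.mem_singleton_iff, Sym2.eq_iff] at he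
    rcases he with ⟨h, -⟩ | ⟨h, -⟩
    · exact hty h
    · exact htz h
  · have hnew : (D ⊔ edge t z).Reachable y z :=
      (hyt.mono le_sup_left).trans (Adj.reachable (by
        rw [sup_adj, edge_adj]; exact Or.inr ⟨Or.inl ⟨rfl, rfl⟩, htz⟩))
    have := hT.connected.nonempty
    refine ⟨fun a b => ?_⟩
    refine mem_of_closed hT.connected.preconnected (S := {b | (D ⊔ edge t z).Reachable a b})
      (Reachable.refl _) (fun x hx w hxw => Reachable.trans hx ?_) b
    by_cases he : s(x, w) = s(y, z)
    · rw [Sym2.eq_iff] at he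
      rcases he with ⟨rfl, rfl⟩ | ⟨rfl, rfl⟩
      · exact hnew
      · exact hnew.symm
    · exact Adj.reachable (Or.inl (by rw [hD, deleteEdges_adj]; exact ⟨hxw, he⟩))
  · exact (isAcyclic_add_edge_iff_of_not_reachable _ _ hntz).2
      (hT.isAcyclic.anti (deleteEdges_le _))

theorem deleteEdges_sup_edge {T : SimpleGraph V} {y z : V} (h : T.Adj y z) :
    T.deleteEdges {s(y, z)} ⊔ edge y z = T := by
  ext a b
  simp only [sup_adj, deleteEdges_adj, Set.mem_singleton_iff, edge_adj, Sym2.eq_iff]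
  have := h.ne
  have := h.symm
  grind

/-- Turning the vertex `y` into a leaf attached to `y'`: all other edges at `y` are moved to
vertices of degree at least three on the side of `y'`. -/
theorem exists_isHIST_leaf [Finite V] {G : SimpleGraph V} {y y' : V} (T : SimpleGraph V)
    (hTG : T ≤ G) (hT : T.IsTree) (h2 : ∀ v, v ≠ y → dg T v ≠ 2) (hyy' : T.Adj y y')
    (ht : ∀ z, T.Adj y z → z ≠ y' →
      ∃ t, t ≠ y ∧ 3 ≤ dg T t ∧ G.Adj t z ∧ (T.deleteIncidenceSet y).Reachable y' t) :
    ∃ T', IsHIST G T' ∧ dg T' y = 1 ∧ ∀ v, dg T v = 1 → dg T' v = 1 := by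
  classical
  obtain ⟨k, hk⟩ : ∃ k, k = dg T y := ⟨_, rfl⟩
  induction k using Nat.strong_induction_on generalizing T with
  | _ k ih =>
  by_cases h1 : dg T y = 1
  · refine ⟨T, ⟨hTG, hT, fun v hv => ?_⟩, h1, fun v hv => hv⟩
    by_cases hvy : v = y
    · rw [hvy] at hv
      change dg T y = 2 at hv
      omega
    · exact h2 v hvy hv
  obtain ⟨z, hyz, hz⟩ : ∃ z, T.Adj y z ∧ z ≠ y' := by
    by_contra! hall
    apply h1
    refine Set.ncard_eq_one.2 ⟨y', ?_⟩
    ext x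
    exact ⟨fun hx => hall x hx, fun hx => by rw [Set.mem_singleton_iff] at hx; rw [hx]; exact hyy'⟩
  obtain ⟨t, hty, h3, hGtz, hr⟩ := ht z hyz hz
  obtain ⟨hntz, htz, htree⟩ := isTree_move hT hyz hyy' hz hty hr
  set D := T.deleteEdges {s(y, z)} with hD
  have hDadj : ∀ a b, D.Adj a b ↔ T.Adj a b ∧ s(a, b) ≠ s(y, z) := fun a b => by
    rw [hD, deleteEdges_adj, Set.mem_singleton_iff]
  have d1 : ∀ v, dg T v = dg D v + if v = y ∨ v = z then 1 else 0 := by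
    intro v
    conv_lhs => rw [← deleteEdges_sup_edge hyz]
    exact dg_sup_edge hyz.ne (by rw [← hD, hDadj]; simp) v
  have d2 : ∀ v, dg (D ⊔ edge t z) v = dg D v + if v = t ∨ v = z then 1 else 0 :=
    fun v => dg_sup_edge htz (fun h => hntz ((hDadj _ _).1 h).1) v
  have hdy : dg (D ⊔ edge t z) y + 1 = dg T y := by
    rw [d1, d2, if_pos (Or.inl rfl), if_neg]
    rintro (h | h)
    · exact hty h.symm
    · exact hyz.ne h
  have hdt : dg (D ⊔ edge t z) t = dg T t + 1 := by
    rw [d1, d2, if_pos (Or.inl rfl), if_neg]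
    rintro (h | h)
    · exact hty h
    · exact htz h
  have hdv : ∀ v, v ≠ y → v ≠ t → dg (D ⊔ edge t z) v = dg T v := by
    intro v hv1 hv2
    rw [d1, d2]
    simp [hv1, hv2]
  have hmono : T.deleteIncidenceSet y ≤ (D ⊔ edge t z).deleteIncidenceSet y := by
    intro a b hab
    rw [deleteIncidenceSet_adj] at hab ⊢
    refine ⟨Or.inl ((hDadj _ _).2 ⟨hab.1, fun he => ?_⟩), hab.2⟩
    rw [Sym2.eq_iff] at he
    rcases he with ⟨h, -⟩ | ⟨-, h⟩
    · exact hab.2.1 h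
    · exact hab.2.2 h
  have hyadj : ∀ x, (D ⊔ edge t z).Adj y x → T.Adj y x := by
    intro x hx
    rcases hx with hx | hx
    · exact ((hDadj _ _).1 hx).1
    · rw [edge_adj] at hx
      rcases hx.1 with ⟨h, -⟩ | ⟨h, -⟩
      · exact absurd h.symm hty
      · exact absurd h hyz.ne
  obtain ⟨T', hT', hy1, hl⟩ := ih (dg (D ⊔ edge t z) y) (by omega) (D ⊔ edge t z)
    (by
      rintro a b (hab | hab)
      · exact hTG ((hDadj _ _).1 hab).1
      · rw [edge_adj] at hab
        rcases hab.1 with ⟨rfl, rfl⟩ | ⟨rfl, rfl⟩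
        · exact hGtz
        · exact hGtz.symm)
    htree
    (by
      intro v hv
      by_cases hvt : v = t
      · rw [hvt, hdt]; omega
      · rw [hdv v hv hvt]; exact h2 v hv)
    (Or.inl ((hDadj _ _).2 ⟨hyy', fun he => by
      rw [Sym2.eq_iff] at he
      rcases he with ⟨-, h⟩ | ⟨h, -⟩
      · exact hz h.symm
      · exact hyz.ne h⟩))
    (by
      intro w hyw hw
      obtain ⟨s, hs1, hs2, hs3, hs4⟩ := ht w (hyadj w hyw) hw
      refine ⟨s, hs1, ?_, hs3, hs4.mono hmono⟩
      by_cases hst : s = t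
      · rw [hst, hdt]; omega
      · rw [hdv s hs1 hst]; exact hs2)
    rfl
  refine ⟨T', hT', hy1, fun v hv => ?_⟩
  by_cases hvy : v = y
  · rw [hvy]; exact hy1
  · apply hl
    have hvt : v ≠ t := by
      rintro rfl
      omega
    rw [hdv v hvy hvt, hv]

/-- In a graph with connected complement, a HIST with as few inner vertices as possible has at most
one inner vertex in each module.  Otherwise there are adjacent inner vertices `q` in the module and
`w` outside it, and a second inner vertex `y` of the module can be turned into a leaf by moving its
neighbours outside the module to `q` and its neighbours inside the module to `w`. -/
theorem exists_isHIST_module_inner_unique [Finite V] [Nontrivial V] {G : SimpleGraph V}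
    (hG : Gᶜ.Preconnected) (h : HasHIST G) :
    ∃ T, IsHIST G T ∧ ∀ M, IsGraphModule G M → M ≠ Set.univ →
      ∀ x ∈ M, ∀ y ∈ M, dg T x ≠ 1 → dg T y ≠ 1 → x = y := by
  obtain ⟨T, hT, hmin⟩ : ∃ T, IsHIST G T ∧ ∀ T', IsHIST G T' →
      {v | dg T v ≠ 1}.ncard ≤ {v | dg T' v ≠ 1}.ncard := by
    obtain ⟨T, hT, hm⟩ := WellFounded.has_min (InvImage.wf
      (fun T : SimpleGraph V => {v | dg T v ≠ 1}.ncard) wellFounded_lt) {T | IsHIST G T} h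
    exact ⟨T, hT, fun T' h' => not_lt.1 (hm T' h')⟩
  refine ⟨T, hT, fun M hM hMu x hx y hy hdx hdy => by_contra fun hxy => ?_⟩
  obtain ⟨hTG, hTree, h2⟩ := hT
  have hpre := hTree.connected.preconnected
  have hge : ∀ v, dg T v ≠ 1 → 3 ≤ dg T v := by
    intro v hv
    have := dg_ne_zero hpre v
    have : dg T v ≠ 2 := h2 v
    omega
  have houter : ∀ u ∈ M, ∀ v ∈ M, ∀ w ∉ M, G.Adj u w → G.Adj v w := by
    intro u hu v hv w hw huw
    rcases hM w hw with h | h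
    · exact (h v hv).symm
    · exact absurd huw.symm (h u hu)
  -- If all inner vertices were in `M`, a vertex outside `M` that is not adjacent to some vertex of
  -- `M` would be a leaf; its tree neighbour could not be in the module `M`, nor be another leaf.
  have hcross : ∃ q ∈ M, ∃ w ∉ M, dg T q ≠ 1 ∧ dg T w ≠ 1 ∧ T.Adj q w := by
    by_cases hall : {v | dg T v ≠ 1} ⊆ M
    · exfalso
      obtain ⟨a, ha, b, hb, hab⟩ := exists_adj_compl_of_preconnected hG ⟨x, hx⟩ hMu
      have hb1 : dg T b = 1 := by
        by_contra hb1
        exact hb (hall hb1)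
      obtain ⟨c, hc⟩ := exists_adj_of_dg_ne_zero (x := b) (T := T) (by omega)
      by_cases hcM : c ∈ M
      · exact hab.2 (houter c hcM a ha b hb (hTG hc.symm))
      · have hc1 : dg T c = 1 := by
          by_contra hc1
          exact hcM (hall hc1)
        have := mem_of_closed hpre (S := {b, c}) (a := b) (by simp) (by
          rintro u (rfl | rfl) v huv
          · rw [eq_of_dg_eq_one hb1 huv hc]; simp
          · rw [eq_of_dg_eq_one hc1 huv hc.symm]; simp) x
        rcases this with rfl | rfl
        · exact hb hx
        · exact hcM hx
    · obtain ⟨q, hq, w, hw, hwn, hqw⟩ := exists_adj_of_leaves_compl hpre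
        (R := {v | dg T v ≠ 1}) (W := {v | dg T v ≠ 1} ∩ M)
        (fun v hv => by simpa using hv) Set.inter_subset_left ⟨x, hdx, hx⟩
        (fun h => hall (by rw [← h]; exact Set.inter_subset_right))
      exact ⟨q, hq.2, w, fun hwM => hwn ⟨hw, hwM⟩, hq.1, hw, hqw⟩
  obtain ⟨q, hq, w, hw, hdq, hdw, hqw⟩ := hcross
  -- One of `x` and `y` is different from `q`.
  obtain ⟨p, hp, hdp, hpq⟩ : ∃ p ∈ M, dg T p ≠ 1 ∧ q ≠ p := by
    by_cases hqx : q = x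
    · exact ⟨y, hy, hdy, fun h => hxy (hqx.symm.trans h)⟩
    · exact ⟨x, hx, hdx, hqx⟩
  obtain ⟨p', hpp', hr⟩ := exists_adj_toward hpre hpq
  have hwp : w ≠ p := fun h => hw (h ▸ hp)
  obtain ⟨T', hT', hp1, hl⟩ := exists_isHIST_leaf T hTG hTree (fun v _ => h2 v) hpp' (by
    intro z hpz hz
    by_cases hzM : z ∈ M
    · refine ⟨w, hwp, hge w hdw, (houter q hq z hzM w hw (hTG hqw)).symm,
        hr.trans (Adj.reachable ?_)⟩
      rw [deleteIncidenceSet_adj]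
      exact ⟨hqw, hpq, hwp⟩
    · exact ⟨q, hpq, hge q hdq, houter p hp q hq z hzM (hTG hpz), hr⟩)
  -- The leaves of `T` and the vertex `p` are leaves of `T'`.
  have hlt : {v | dg T' v ≠ 1}.ncard < {v | dg T v ≠ 1}.ncard := by
    refine Set.ncard_lt_ncard ⟨fun v hv hv1 => hv (hl v hv1), fun hsub => ?_⟩
    exact hsub hdp hp1
  exact absurd (hmin T' hT') (not_le.2 hlt)

/-! ### Proper modules and the modular-width -/

/-- Two vertices are similar if they lie in a common module that is not the whole graph. -/
def Sim (G : SimpleGraph V) (u v : V) : Prop :=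
  ∃ M, IsGraphModule G M ∧ M ≠ Set.univ ∧ u ∈ M ∧ v ∈ M

theorem Sim.symm {G : SimpleGraph V} {u v : V} (h : Sim G u v) : Sim G v u := by
  obtain ⟨M, h1, h2, h3, h4⟩ := h
  exact ⟨M, h1, h2, h4, h3⟩

theorem isGraphModule_singleton (G : SimpleGraph V) (v : V) : IsGraphModule G {v} := by
  intro w _
  by_cases h : G.Adj w v
  · exact Or.inl (by simpa using h)
  · exact Or.inr (by simpa using h)

theorem singleton_ne_univ [Nontrivial V] (v : V) : ({v} : Set V) ≠ Set.univ := by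
  obtain ⟨y, hy⟩ := exists_ne v
  intro h
  exact hy (h.symm ▸ Set.mem_univ y : y ∈ ({v} : Set V))

theorem Sim.refl [Nontrivial V] (G : SimpleGraph V) (v : V) : Sim G v v :=
  ⟨{v}, isGraphModule_singleton G v, singleton_ne_univ v, rfl, rfl⟩

theorem _root_.IsGraphModule.adj {G : SimpleGraph V} {M : Set V} (hM : IsGraphModule G M)
    {u v w : V}
    (hu : u ∈ M) (hv : v ∈ M) (hw : w ∉ M) (h : G.Adj w u) : G.Adj w v := by
  rcases hM w hw with h1 | h1
  · exact h1 v hv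
  · exact absurd h (h1 u hu)

theorem isGraphModule_of_adj {G : SimpleGraph V} {M : Set V}
    (h : ∀ w ∉ M, ∀ u ∈ M, ∀ v ∈ M, G.Adj w u → G.Adj w v) : IsGraphModule G M := by
  intro w hw
  by_cases hu : ∃ u ∈ M, G.Adj w u
  · obtain ⟨u, hu, hwu⟩ := hu
    exact Or.inl fun v hv => h w hw u hu v hv hwu
  · exact Or.inr fun v hv hwv => hu ⟨v, hv, hwv⟩

theorem _root_.IsGraphModule.union {G : SimpleGraph V} {M N : Set V} (hM : IsGraphModule G M)
    (hN : IsGraphModule G N) {a : V} (haM : a ∈ M) (haN : a ∈ N) : IsGraphModule G (M ∪ N) := by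
  refine isGraphModule_of_adj fun w hw u hu v hv h => ?_
  simp only [Set.mem_union, not_or] at hw
  have h1 : G.Adj w a := hu.elim (fun hu => hM.adj hu haM hw.1 h) (fun hu => hN.adj hu haN hw.2 h)
  exact hv.elim (fun hv => hM.adj haM hv hw.1 h1) (fun hv => hN.adj haN hv hw.2 h1)

/-- In a connected graph with connected complement, overlapping proper modules do not cover the
graph: otherwise the pairs between `N` and its complement would be all adjacent or all
nonadjacent. -/
theorem _root_.IsGraphModule.union_ne_univ {G : SimpleGraph V} (hG : G.Preconnected)
    (hGc : Gᶜ.Preconnected) {M N : Set V} (hM : IsGraphModule G M) (hN : IsGraphModule G N)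
    (hMu : M ≠ Set.univ) (hNu : N ≠ Set.univ) {a : V} (haN : a ∈ N) :
    M ∪ N ≠ Set.univ := by
  intro hun
  obtain ⟨x, hx⟩ := (Set.ne_univ_iff_exists_notMem _).1 hMu
  have hMN : ∀ v, v ∈ M ∨ v ∈ N := fun v => (hun.symm ▸ Set.mem_univ v : v ∈ M ∪ N)
  have hxN : x ∈ N := (hMN x).resolve_left hx
  obtain ⟨p, hp, q, hq, hpq⟩ := exists_adj_compl_of_preconnected hG ⟨a, haN⟩ hNu
  obtain ⟨r, hr, s, hs, hrs⟩ := exists_adj_compl_of_preconnected hGc ⟨a, haN⟩ hNu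
  have hqM := (hMN q).resolve_right hq
  have hsM := (hMN s).resolve_right hs
  exact hrs.2 (hN.adj hxN hr hs (hM.adj hqM hsM hx (hN.adj hp hxN hq hpq.symm).symm).symm).symm

/-- In a connected graph with connected complement, each class of similar vertices is a proper
module. -/
theorem isGraphModule_sim [Finite V] [Nontrivial V] {G : SimpleGraph V} (hG : G.Preconnected)
    (hGc : Gᶜ.Preconnected) (v : V) :
    IsGraphModule G {w | Sim G v w} ∧ {w | Sim G v w} ≠ Set.univ := by
  obtain ⟨M, ⟨h1, h2, h3⟩, hmax⟩ := (Set.toFinite {M : Set V | IsGraphModule G M ∧ M ≠ Set.univ ∧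
    v ∈ M}).exists_maximal ⟨{v}, isGraphModule_singleton G v, singleton_ne_univ v, rfl⟩
  have : {w | Sim G v w} = M := by
    refine Set.Subset.antisymm ?_ fun w hw => ⟨M, h1, h2, h3, hw⟩
    rintro w ⟨N, hN, hNu, hv, hw⟩
    exact hmax ⟨h1.union hN h3 hv, h1.union_ne_univ hG hGc hN h2 hNu hv, Or.inl h3⟩
      Set.subset_union_left (Or.inr hw)
  rw [this]
  exact ⟨h1, h2⟩

theorem Sim.trans [Finite V] [Nontrivial V] {G : SimpleGraph V} (hG : G.Preconnected)
    (hGc : Gᶜ.Preconnected) {u v w : V} (h1 : Sim G u v) (h2 : Sim G v w) : Sim G u w := by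
  obtain ⟨h3, h4⟩ := isGraphModule_sim hG hGc v
  exact ⟨_, h3, h4, h1.symm, h2⟩

theorem maximal_of_mem_mdChildren {G : SimpleGraph V} {M C : Set V} (h : C ∈ mdChildren G M) :
    Maximal (fun D => IsStrongModule G D ∧ D ⊂ M) C := h

theorem exists_mem_mdChildren [Finite V] [Nontrivial V] (G : SimpleGraph V) (v : V) :
    ∃ C ∈ mdChildren G Set.univ, v ∈ C := by
  have hs : IsStrongModule G {v} := by
    refine ⟨Set.singleton_nonempty v, isGraphModule_singleton G v, fun N _ => ?_⟩
    by_cases h : v ∈ N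
    · exact Or.inr (Or.inl (Set.singleton_subset_iff.2 h))
    · exact Or.inl (Set.disjoint_singleton_left.2 h)
  obtain ⟨C, hle, hC⟩ := (Set.toFinite
    {D : Set V | IsStrongModule G D ∧ D ⊂ Set.univ}).exists_le_maximal (a := {v})
      ⟨hs, Set.ssubset_univ_iff.2 (singleton_ne_univ v)⟩
  exact ⟨C, hC, hle rfl⟩

/-- The quotient graph of the root is neither edgeless, because `G` is connected, nor complete,
because the complement of `G` is connected. -/
theorem isPrimeNode_univ [Finite V] [Nontrivial V] {G : SimpleGraph V} (hG : G.Preconnected)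
    (hGc : Gᶜ.Preconnected) : IsPrimeNode G Set.univ := by
  have v : V := Classical.arbitrary V
  obtain ⟨C, hC, hv⟩ := exists_mem_mdChildren G v
  have hC' := maximal_of_mem_mdChildren hC
  have hCu : C ≠ Set.univ := Set.ssubset_univ_iff.1 hC'.prop.2
  refine ⟨⟨Set.univ_nonempty, fun w hw => absurd (Set.mem_univ w) hw,
    fun N _ => Or.inr (Or.inr (Set.subset_univ N))⟩, fun h => ?_, fun h => ?_⟩
  · obtain ⟨x, hx, y, hy, hxy⟩ := exists_adj_compl_of_preconnected hG ⟨v, hv⟩ hCu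
    obtain ⟨D, hD, hyD⟩ := exists_mem_mdChildren G y
    have : (mdQuotient G Set.univ).Adj ⟨C, hC⟩ ⟨D, hD⟩ :=
      ⟨fun h => hy ((Subtype.mk.inj h) ▸ hyD), x, hx, y, hyD, hxy⟩
    rw [h] at this
    exact this
  · obtain ⟨x, hx, y, hy, hxy⟩ := exists_adj_compl_of_preconnected hGc ⟨v, hv⟩ hCu
    obtain ⟨D, hD, hyD⟩ := exists_mem_mdChildren G y
    have hD' := maximal_of_mem_mdChildren hD
    have hne : C ≠ D := fun h => hy (h ▸ hyD)
    have hadj : (mdQuotient G Set.univ).Adj ⟨C, hC⟩ ⟨D, hD⟩ := by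
      rw [h]
      exact fun h => hne (Subtype.mk.inj h)
    obtain ⟨-, a, ha, b, hb, hab⟩ := hadj
    have hdis : Disjoint C D := by
      rcases hC'.prop.1.2.2 D hD'.prop.1.2.1 with h | h | h
      · exact h
      · exact absurd (Set.Subset.antisymm h (hC'.2 hD'.prop h)) hne
      · exact absurd (Set.Subset.antisymm (hD'.2 hC'.prop h) h) hne
    have h1 : G.Adj b x := hC'.prop.1.2.1.adj ha hx (Set.disjoint_right.1 hdis hb) hab.symm
    exact hxy.2 (hD'.prop.1.2.1.adj hb hyD (Set.disjoint_left.1 hdis hx) h1.symm)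

/-- Dissimilar vertices lie in different children of the root, which is a prime node. -/
theorem card_le_modularWidth [Finite V] [Nontrivial V] {G : SimpleGraph V} (hG : G.Preconnected)
    (hGc : Gᶜ.Preconnected) (R : Finset V) (hR : ∀ u ∈ R, ∀ v ∈ R, Sim G u v → u = v) :
    R.card ≤ modularWidth G := by
  refine le_trans ?_ (le_csSup (primeNodeSizes_bddAbove G)
    ⟨Set.univ, isPrimeNode_univ hG hGc, rfl⟩)
  choose f hf hmem using exists_mem_mdChildren G
  have hf' := fun v => maximal_of_mem_mdChildren (hf v)
  rw [← Set.ncard_coe_finset R]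
  refine Set.ncard_le_ncard_of_injOn f (fun v _ => hf v) (fun u hu v hv huv => ?_) (Set.toFinite _)
  refine hR u hu v hv ⟨f u, (hf' u).prop.1.2.1, Set.ssubset_univ_iff.1 (hf' u).prop.2, hmem u, ?_⟩
  rw [huv]
  exact hmem v

/-- A component of a disconnected graph is not the whole graph, and no edge leaves it. -/
theorem exists_no_adj_of_not_preconnected {G : SimpleGraph V} (h : ¬ G.Preconnected) :
    ∃ S : Set V, S.Nonempty ∧ S ≠ Set.univ ∧ ∀ x ∈ S, ∀ y ∉ S, ¬ G.Adj x y := by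
  simp only [Preconnected, not_forall] at h
  obtain ⟨a, b, hab⟩ := h
  refine ⟨{x | G.Reachable a x}, ⟨a, Reachable.refl _⟩, fun h => ?_, fun x hx y hy hxy => ?_⟩
  · exact hab (h.symm ▸ Set.mem_univ b : b ∈ {x | G.Reachable a x})
  · exact hy (Reachable.trans hx hxy.reachable)

/-- If the vertices are partitioned into two modules, there are at most two pairwise dissimilar
vertices. -/
theorem card_le_two_of_isGraphModule {G : SimpleGraph V} {S : Set V} (h1 : S.Nonempty)
    (h2 : S ≠ Set.univ) (hS : IsGraphModule G S) (hS' : IsGraphModule G Sᶜ) (R : Finset V)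
    (hR : ∀ u ∈ R, ∀ v ∈ R, Sim G u v → u = v) : R.card ≤ 2 := by
  by_contra! hc
  obtain ⟨a, b, c, ha, hb, hc, hab, hac, hbc⟩ := Finset.two_lt_card_iff.1 hc
  have k1 : ∀ u ∈ R, ∀ v ∈ R, u ≠ v → u ∈ S → v ∉ S := fun u hu v hv huv huS hvS =>
    huv (hR u hu v hv ⟨S, hS, h2, huS, hvS⟩)
  have k2 : ∀ u ∈ R, ∀ v ∈ R, u ≠ v → u ∉ S → v ∈ S := fun u hu v hv huv huS => by
    by_contra hvS
    refine huv (hR u hu v hv ⟨Sᶜ, hS', fun h => ?_, huS, hvS⟩)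
    obtain ⟨x, hx⟩ := h1
    exact (h.symm ▸ Set.mem_univ x : x ∈ Sᶜ) hx
  by_cases haS : a ∈ S
  · exact k1 a ha c hc hac haS (k2 b hb c hc hbc (k1 a ha b hb hab haS))
  · exact k1 b hb c hc hbc (k2 a ha b hb hab haS) (k2 a ha c hc hac haS)

theorem card_le_two [Nontrivial V] {G : SimpleGraph V}
    (h : ¬ (G.Preconnected ∧ Gᶜ.Preconnected)) (R : Finset V)
    (hR : ∀ u ∈ R, ∀ v ∈ R, Sim G u v → u = v) : R.card ≤ 2 := by
  by_cases hG : G.Preconnected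
  · obtain ⟨S, h1, h2, h3⟩ := exists_no_adj_of_not_preconnected fun hGc => h ⟨hG, hGc⟩
    have h3' : ∀ x ∈ S, ∀ y ∉ S, G.Adj x y := by
      intro x hx y hy
      by_contra hn
      exact h3 x hx y hy ⟨fun he => hy (he ▸ hx), hn⟩
    exact card_le_two_of_isGraphModule h1 h2 (fun w hw => Or.inl fun u hu => (h3' u hu w hw).symm)
      (fun w hw => Or.inl fun u hu => h3' w (not_not.1 hw) u hu) R hR
  · obtain ⟨S, h1, h2, h3⟩ := exists_no_adj_of_not_preconnected hG
    exact card_le_two_of_isGraphModule h1 h2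
      (fun w hw => Or.inr fun u hu huw => h3 u hu w hw huw.symm)
      (fun w hw => Or.inr fun u hu => h3 w (not_not.1 hw) u hu) R hR

/-! ### Moving the inner vertices to representatives -/

/-- The leaves `Z` at `x` and the vertex `x` itself can be moved inside the class `C` to the
neighbours `N` of `r` and to `r`. -/
theorem exists_perm_of_ncard_le [Finite V] {C : Set V} {x r : V} (hx : x ∈ C) (hr : r ∈ C)
    {N : Set V} (hNC : N ⊆ C) (hrN : r ∉ N) (Z : Finset V) (hZC : ↑Z ⊆ C) (hxZ : x ∉ Z)
    (hcard : Z.card ≤ N.ncard) :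
    ∃ σ : Equiv.Perm V, (∀ v ∈ C, σ v ∈ C) ∧ σ x = r ∧ ∀ z ∈ Z, σ z ∈ N := by
  classical
  have hswap : ∀ a ∈ C, ∀ b ∈ C, ∀ v ∈ C, Equiv.swap a b v ∈ C := by
    intro a ha b hb v hv
    rw [Equiv.swap_apply_def]
    split_ifs <;> assumption
  induction Z using Finset.induction_on with
  | empty => exact ⟨Equiv.swap x r, hswap x hx r hr, Equiv.swap_apply_left x r, by simp⟩
  | insert z Z hz ih =>
    rw [Finset.card_insert_of_notMem hz] at hcard
    rw [Finset.coe_insert, Set.insert_subset_iff] at hZC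
    rw [Finset.mem_insert, not_or] at hxZ
    obtain ⟨σ, h1, h2, h3⟩ := ih hZC.2 hxZ.2 (by omega)
    obtain ⟨m, hm, hmZ⟩ : ∃ m ∈ N, m ∉ (Z.image σ : Set V) := by
      by_contra! hall
      have := Set.ncard_le_ncard (s := N) (t := (Z.image σ : Set V)) hall (Set.toFinite _)
      rw [Set.ncard_coe_finset] at this
      have := Finset.card_image_le (s := Z) (f := σ)
      omega
    refine ⟨Equiv.swap (σ z) m * σ, fun v hv => hswap _ (h1 z hZC.1) m (hNC hm) _ (h1 v hv), ?_, ?_⟩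
    · rw [Equiv.Perm.mul_apply, h2, Equiv.swap_apply_of_ne_of_ne]
      · rw [← h2]
        exact fun h => hxZ.1 (σ.injective h)
      · exact fun h => hrN (h ▸ hm)
    · intro w hw
      rw [Equiv.Perm.mul_apply]
      rcases Finset.mem_insert.1 hw with rfl | hw
      · rw [Equiv.swap_apply_left]
        exact hm
      · rw [Equiv.swap_apply_of_ne_of_ne]
        · exact h3 w hw
        · exact fun h => hz (σ.injective h ▸ hw)
        · exact fun h => hmZ (by
            rw [Finset.coe_image]
            exact ⟨w, hw, h⟩)

/-- The number of neighbours of `v` that are similar to it. -/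
noncomputable def simDeg (G : SimpleGraph V) (v : V) : ℕ := {w | Sim G v w ∧ G.Adj v w}.ncard

theorem dg_map [Finite V] (T : SimpleGraph V) (σ : V ≃ V) (v : V) :
    dg (T.map σ.toEmbedding) (σ v) = dg T v := by
  unfold dg
  rw [← Set.ncard_image_of_injective (T.neighborSet v) σ.injective]
  congr 1
  ext x
  rw [mem_neighborSet, map_adj, Set.mem_image]
  constructor
  · rintro ⟨a, b, hab, ha, rfl⟩
    exact ⟨b, σ.injective ha ▸ hab, rfl⟩
  · rintro ⟨b, hb, rfl⟩
    exact ⟨v, b, hb, rfl, rfl⟩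

/-- If a connected graph with connected complement has a HIST, then it has one whose inner vertices
are prescribed representatives of the classes of similar vertices.  In each class the representative
must have as many neighbours in its class as possible: it takes over the role of the only inner
vertex, including the leaves in the class attached to that vertex. -/
theorem exists_isHIST_inner_mem [Finite V] [Nontrivial V] {G : SimpleGraph V}
    (hG : G.Preconnected) (hGc : Gᶜ.Preconnected) (h : HasHIST G) (R : Set V)
    (hR : ∀ v, ∃ r ∈ R, Sim G v r ∧ ∀ u, Sim G v u → simDeg G u ≤ simDeg G r) :
    ∃ T, IsHIST G T ∧ ∀ v ∉ R, dg T v = 1 := by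
  classical
  obtain ⟨T, ⟨hTG, hTree, h2⟩, huniq⟩ := exists_isHIST_module_inner_unique hGc h
  have hpre := hTree.connected.preconnected
  let s : Setoid V := ⟨Sim G, Sim.refl G, Sim.symm, Sim.trans hG hGc⟩
  have huniq' : ∀ x y, Sim G x y → dg T x ≠ 1 → dg T y ≠ 1 → x = y := by
    intro x y hxy hx hy
    obtain ⟨h3, h4⟩ := isGraphModule_sim hG hGc x
    exact huniq _ h3 h4 x (Sim.refl G x) y hxy hx hy
  -- In each class, `σ` moves the inner vertex to the representative and its leaves in the class to
  -- neighbours of the representative, which are numerous enough.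
  have hclass : ∀ c : Quotient s, ∃ σ : Equiv.Perm V, (∀ v, ⟦v⟧ = c → ⟦σ v⟧ = c) ∧
      ∀ x, ⟦x⟧ = c → dg T x ≠ 1 → σ x ∈ R ∧ ∀ z, T.Adj x z → ⟦z⟧ = c → G.Adj (σ x) (σ z) := by
    intro c
    by_cases hx : ∃ x, ⟦x⟧ = c ∧ dg T x ≠ 1
    · obtain ⟨x, rfl, hx⟩ := hx
      obtain ⟨r, hr, hxr, hmax⟩ := hR x
      obtain ⟨σ, h3, h4, h5⟩ := exists_perm_of_ncard_le (C := {w | Sim G x w}) (Sim.refl G x) hxr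
        (N := {w | Sim G r w ∧ G.Adj r w}) (fun w hw => Sim.trans hG hGc hxr hw.1)
        (fun hw => hw.2.ne rfl) (Set.toFinite {w | Sim G x w ∧ T.Adj x w}).toFinset
        (fun w hw => by
          rw [Set.Finite.coe_toFinset] at hw
          exact hw.1)
        (fun hw => by
          rw [Set.Finite.mem_toFinset] at hw
          exact hw.2.ne rfl)
        (by
          rw [← Set.ncard_eq_toFinset_card]
          refine le_trans ?_ (hmax x (Sim.refl G x))
          exact Set.ncard_le_ncard (fun w hw => ⟨hw.1, hTG hw.2⟩) (Set.toFinite _))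
      refine ⟨σ, fun v hv => ?_, fun y hy hdy => ?_⟩
      · exact Quotient.sound (Sim.symm (h3 v (Sim.symm (Quotient.exact hv))))
      · obtain rfl : x = y := huniq' x y (Sim.symm (Quotient.exact hy)) hx hdy
        refine ⟨h4 ▸ hr, fun z hz hzc => ?_⟩
        rw [h4]
        refine (h5 z ?_).2
        rw [Set.Finite.mem_toFinset]
        exact ⟨Sim.symm (Quotient.exact hzc), hz⟩
    · exact ⟨1, fun v hv => hv, fun x hxc hdx => absurd ⟨x, hxc, hdx⟩ hx⟩
  choose τ hτ1 hτ2 using hclass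
  have hcl : ∀ v, (⟦τ ⟦v⟧ v⟧ : Quotient s) = ⟦v⟧ := fun v => hτ1 _ v rfl
  have hinj : Function.Injective fun v => τ ⟦v⟧ v := by
    intro u v huv
    have huv' : τ ⟦u⟧ u = τ ⟦v⟧ v := huv
    have : (⟦u⟧ : Quotient s) = ⟦v⟧ := by rw [← hcl u, ← hcl v, huv']
    rw [this] at huv'
    exact (τ _).injective huv'
  let σ : V ≃ V := Equiv.ofBijective _ (Finite.injective_iff_bijective.1 hinj)
  have hσ : ∀ v, σ v = τ ⟦v⟧ v := fun v => rfl
  have hsim : ∀ v, Sim G v (σ v) := fun v => Sim.symm (Quotient.exact (hcl v))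
  refine ⟨T.map σ.toEmbedding, ⟨?_, (Iso.map σ T).isTree_iff.1 hTree, fun v => ?_⟩, fun v hv => ?_⟩
  · rw [map_le_iff_le_comap]
    intro a b hab
    rw [comap_adj]
    change G.Adj (σ a) (σ b)
    -- Edges between different classes are preserved since the classes are modules; edges inside a
    -- class join an inner vertex to a leaf.
    by_cases hs : Sim G a b
    · have hcab : (⟦a⟧ : Quotient s) = ⟦b⟧ := Quotient.sound hs
      by_cases ha : dg T a = 1
      · by_cases hb : dg T b = 1
        · exfalso
          obtain ⟨h3, h4⟩ := isGraphModule_sim hG hGc a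
          refine h4 (Set.eq_univ_of_forall fun v => ?_)
          have := mem_of_closed hpre (S := {a, b}) (a := a) (by simp) (by
            rintro u (rfl | rfl) v huv
            · rw [eq_of_dg_eq_one ha huv hab]; simp
            · rw [eq_of_dg_eq_one hb huv hab.symm]; simp) v
          rcases this with rfl | rfl
          · exact Sim.refl G v
          · exact hs
        · have := (hτ2 ⟦b⟧ b rfl hb).2 a hab.symm hcab
          rw [hσ, hσ, hcab]
          exact this.symm
      · have := (hτ2 ⟦a⟧ a rfl ha).2 b hab hcab.symm
        rw [hσ, hσ, ← hcab]
        exact this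
    · obtain ⟨h3, -⟩ := isGraphModule_sim hG hGc a
      obtain ⟨h5, -⟩ := isGraphModule_sim hG hGc b
      have h1 : G.Adj b (σ a) := h3.adj (Sim.refl G a) (hsim a) hs (hTG hab).symm
      exact h5.adj (Sim.refl G b) (hsim b)
        (fun h => hs ((h.trans hG hGc (hsim a).symm).symm)) h1.symm
  · obtain ⟨u, rfl⟩ := σ.surjective v
    have : dg (T.map σ.toEmbedding) (σ u) ≠ 2 := by
      rw [dg_map]
      exact h2 u
    exact this
  · obtain ⟨u, rfl⟩ := σ.surjective v
    rw [dg_map]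
    by_contra hu
    exact hv (hτ2 ⟦u⟧ u rfl hu).1

end HIST

namespace HIST

open SimpleGraph

/-! ### Growing a tree on a given set of inner vertices -/

/-- `H` is a tree on the vertex set `W`, with edges in `G`. -/
structure IsTreeOn {V : Type*} (G : SimpleGraph V) (W : Finset V) (H : SimpleGraph V) : Prop where
  le : H ≤ G
  mem : ∀ a b, H.Adj a b → a ∈ W
  reachable : ∀ a ∈ W, ∀ b ∈ W, H.Reachable a b
  isAcyclic : H.IsAcyclic
  nonempty : W.Nonempty

namespace IsTreeOn

variable {V : Type*} {G H : SimpleGraph V} {W : Finset V}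

theorem edge [DecidableEq V] {x y : V} (h : G.Adj x y) : IsTreeOn G {x, y} (edge x y) where
  le := (edge_le_iff _).2 (Or.inr h)
  mem a b hab := by
    rw [edge_adj] at hab
    rcases hab.1 with ⟨rfl, -⟩ | ⟨rfl, -⟩ <;> simp
  reachable := by
    have hxy : (SimpleGraph.edge x y).Reachable x y :=
      Adj.reachable (by rw [edge_adj]; exact ⟨Or.inl ⟨rfl, rfl⟩, h.ne⟩)
    intro a ha b hb
    simp only [Finset.mem_insert, Finset.mem_singleton] at ha hb
    rcases ha with rfl | rfl <;> rcases hb with rfl | rfl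
    · exact Reachable.refl _
    · exact hxy
    · exact hxy.symm
    · exact Reachable.refl _
  isAcyclic := by
    have : (⊥ ⊔ SimpleGraph.edge x y).IsAcyclic :=
      (isAcyclic_add_edge_iff_of_not_reachable x y
        (by rw [reachable_bot]; exact h.ne)).2 isAcyclic_bot
    rwa [bot_sup_eq] at this
  nonempty := ⟨x, by simp⟩

theorem not_adj (h : IsTreeOn G W H) {x y : V} (hy : y ∉ W) : ¬ H.Adj x y :=
  fun hxy => hy (h.mem y x hxy.symm)

theorem dg_eq_zero (h : IsTreeOn G W H) {y : V} (hy : y ∉ W) : dg H y = 0 := by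
  by_contra hn
  obtain ⟨x, hx⟩ := exists_adj_of_dg_ne_zero hn
  exact hy (h.mem _ _ hx)

theorem mem_of_dg_ne_zero (h : IsTreeOn G W H) {y : V} (hy : dg H y ≠ 0) : y ∈ W := by
  by_contra hn
  exact hy (h.dg_eq_zero hn)

theorem insert [DecidableEq V] (h : IsTreeOn G W H) {x y : V} (hx : x ∈ W) (hy : y ∉ W)
    (hxy : G.Adj x y) : IsTreeOn G (insert y W) (H ⊔ SimpleGraph.edge x y) where
  le := sup_le h.le ((edge_le_iff _).2 (Or.inr hxy))
  mem a b hab := by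
    rcases hab with hab | hab
    · exact Finset.mem_insert_of_mem (h.mem a b hab)
    · rw [edge_adj] at hab
      rcases hab.1 with ⟨rfl, -⟩ | ⟨rfl, -⟩
      · exact Finset.mem_insert_of_mem hx
      · exact Finset.mem_insert_self _ _
  reachable := by
    have hxy' : (H ⊔ SimpleGraph.edge x y).Reachable x y :=
      Adj.reachable (Or.inr (by rw [edge_adj]; exact ⟨Or.inl ⟨rfl, rfl⟩, hxy.ne⟩))
    have hto : ∀ a ∈ Insert.insert y W, (H ⊔ SimpleGraph.edge x y).Reachable a x := by
      intro a ha
      rcases Finset.mem_insert.1 ha with rfl | ha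
      · exact hxy'.symm
      · exact (h.reachable a ha x hx).mono le_sup_left
    exact fun a ha b hb => (hto a ha).trans (hto b hb).symm
  isAcyclic := by
    refine (isAcyclic_add_edge_iff_of_not_reachable x y fun hr => hxy.ne ?_).2 h.isAcyclic
    obtain ⟨p⟩ := hr.symm
    cases p with
    | nil => rfl
    | cons h' _ => exact absurd (h.mem _ _ h') hy
  nonempty := ⟨y, Finset.mem_insert_self _ _⟩

theorem dg_insert [Finite V] (h : IsTreeOn G W H) {x y : V} (hx : x ∈ W) (hy : y ∉ W) (v : V)
    [Decidable (v = x ∨ v = y)] :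
    dg (H ⊔ SimpleGraph.edge x y) v = dg H v + if v = x ∨ v = y then 1 else 0 :=
  dg_sup_edge (ne_of_mem_of_not_mem hx hy) (h.not_adj hy) v

end IsTreeOn

theorem dg_edge {V : Type*} [Finite V] {x y : V} (h : x ≠ y) (v : V)
    [Decidable (v = x ∨ v = y)] :
    dg (edge x y) v = if v = x ∨ v = y then 1 else 0 := by
  have := dg_sup_edge (T := (⊥ : SimpleGraph V)) h (by simp) v
  rw [bot_sup_eq] at this
  rw [this]
  simp [dg, neighborSet]

variable {n : ℕ}

/-- The trees in `G` that can be built as follows.  In stage `0` a tree whose vertices belong to `R`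
is grown from an edge; in stage `v + 1` the vertex `v` is attached to a vertex of the tree that
belongs to `R`, unless `v` itself belongs to `R`. -/
inductive Stage (G : SimpleGraph (Fin n)) (R : Finset (Fin n)) :
    ℕ → Finset (Fin n) → SimpleGraph (Fin n) → Prop
  | pair {x y : Fin n} : x ∈ R → y ∈ R → G.Adj x y → Stage G R 0 {x, y} (edge x y)
  | grow {W : Finset (Fin n)} {H : SimpleGraph (Fin n)} {x y : Fin n} : Stage G R 0 W H → x ∈ W →
      y ∈ R → y ∉ W → G.Adj x y → Stage G R 0 (insert y W) (H ⊔ edge x y)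
  | skip {W : Finset (Fin n)} {H : SimpleGraph (Fin n)} {v : Fin n} : Stage G R v W H → v ∈ R →
      Stage G R (v + 1) W H
  | leaf {W : Finset (Fin n)} {H : SimpleGraph (Fin n)} {v x : Fin n} : Stage G R v W H → v ∉ R →
      x ∈ R → x ∈ W → G.Adj x v → Stage G R (v + 1) (insert v W) (H ⊔ edge x v)

/-- The invariants of the construction: the result is a tree, it contains the vertices outside `R`
that have been treated so far, these are leaves, and no vertex of the tree is isolated. -/
theorem Stage.inv {G : SimpleGraph (Fin n)} {R W : Finset (Fin n)} {i : ℕ}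
    {H : SimpleGraph (Fin n)} (h : Stage G R i W H) :
    IsTreeOn G W H ∧ (∀ v ∉ R, v ∈ W ↔ v.val < i) ∧ (∀ v ∈ W, v ∉ R → dg H v = 1) ∧
      ∀ v ∈ W, dg H v ≠ 0 := by
  induction h with
  | @pair x y hx hy hxy =>
    refine ⟨IsTreeOn.edge hxy, fun v hv => ?_, fun v hv hvR => ?_, fun v hv => ?_⟩
    · simp only [Finset.mem_insert, Finset.mem_singleton, Nat.not_lt_zero, iff_false]
      rintro (rfl | rfl)
      · exact hv hx
      · exact hv hy
    · simp only [Finset.mem_insert, Finset.mem_singleton] at hv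
      rcases hv with rfl | rfl
      · exact absurd hx hvR
      · exact absurd hy hvR
    · simp only [Finset.mem_insert, Finset.mem_singleton] at hv
      rw [dg_edge hxy.ne, if_pos hv]
      exact one_ne_zero
  | @grow W H x y h hx hy hyW hxy ih =>
    obtain ⟨h1, h2, h3, h4⟩ := ih
    refine ⟨h1.insert hx hyW hxy, fun v hv => ?_, fun v hv hvR => ?_, fun v hv => ?_⟩
    · rw [← h2 v hv, Finset.mem_insert]
      exact ⟨fun h => h.resolve_left fun he => hv (he ▸ hy), Or.inr⟩
    · exfalso
      rcases Finset.mem_insert.1 hv with rfl | hv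
      · exact hvR hy
      · exact absurd ((h2 v hvR).1 hv) (Nat.not_lt_zero _)
    · rw [h1.dg_insert hx hyW]
      rcases Finset.mem_insert.1 hv with rfl | hv
      · simp
      · have := h4 v hv
        omega
  | @skip W H v h hv ih =>
    obtain ⟨h1, h2, h3, h4⟩ := ih
    refine ⟨h1, fun u hu => ?_, h3, h4⟩
    rw [h2 u hu, Nat.lt_succ_iff_lt_or_eq]
    exact ⟨Or.inl, fun h => h.resolve_right fun he => hu (Fin.ext he ▸ hv)⟩
  | @leaf W H v x h hv hxR hx hxv ih =>
    obtain ⟨h1, h2, h3, h4⟩ := ih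
    have hvW : v ∉ W := fun h => absurd ((h2 v hv).1 h) (lt_irrefl _)
    refine ⟨h1.insert hx hvW hxv, fun u hu => ?_, fun u hu huR => ?_, fun u hu => ?_⟩
    · rw [Finset.mem_insert, h2 u hu, Nat.lt_succ_iff_lt_or_eq, Fin.ext_iff, or_comm]
    · have hux : u ≠ x := fun he => huR (he ▸ hxR)
      rw [h1.dg_insert hx hvW]
      rcases Finset.mem_insert.1 hu with rfl | hu
      · rw [h1.dg_eq_zero hvW]; simp
      · have huv : u ≠ v := fun he => hvW (he ▸ hu)
        simp [hux, huv, h3 u hu huR]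
    · rw [h1.dg_insert hx hvW]
      rcases Finset.mem_insert.1 hu with rfl | hu
      · simp
      · have := h4 u hu
        omega

/-- The construction can be completed to a tree that contains `R` and in which no vertex of `R` has
degree two. -/
def Accept (G : SimpleGraph (Fin n)) (R : Finset (Fin n)) : Prop :=
  ∃ W H, Stage G R n W H ∧ ∀ x ∈ R, dg H x ≠ 0 ∧ dg H x ≠ 2

theorem Accept.hasHIST {G : SimpleGraph (Fin n)} {R : Finset (Fin n)} (h : Accept G R) :
    HasHIST G := by
  obtain ⟨W, H, hS, hd⟩ := h
  obtain ⟨h1, h2, h3, h4⟩ := hS.inv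
  have hW : ∀ v, v ∈ W := by
    intro v
    by_cases hv : v ∈ R
    · exact h1.mem_of_dg_ne_zero (hd v hv).1
    · exact (h2 v hv).2 v.2
  obtain ⟨w, -⟩ := h1.nonempty
  refine ⟨H, h1.le, ⟨?_, h1.isAcyclic⟩, fun v => ?_⟩
  · have : Nonempty (Fin n) := ⟨w⟩
    exact ⟨fun a b => h1.reachable a (hW a) b (hW b)⟩
  · change dg H v ≠ 2
    by_cases hv : v ∈ R
    · exact (hd v hv).2
    · rw [h3 v (hW v) hv]
      norm_num

/-- Stage zero can reproduce the part inside `R` of a given tree. -/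
theorem exists_stage_zero {G T : SimpleGraph (Fin n)} {R : Finset (Fin n)} (hTG : T ≤ G)
    (hT : T.Preconnected) (hR : ∀ v ∉ R, dg T v = 1) (hc : 2 ≤ R.card) :
    ∃ H ≤ T, Stage G R 0 R H := by
  have hR' : ∀ v ∉ (R : Set (Fin n)), dg T v = 1 := fun v hv => hR v (by simpa using hv)
  have main : ∀ k W H, k + W.card = R.card → W ⊆ R → H ≤ T → Stage G R 0 W H →
      ∃ H ≤ T, Stage G R 0 R H := by
    intro k
    induction k with
    | zero =>
      intro W H hk hW hH hS
      rw [Finset.eq_of_subset_of_card_le hW (by omega)] at hS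
      exact ⟨H, hH, hS⟩
    | succ k ih =>
      intro W H hk hW hH hS
      obtain ⟨x, hx, y, hy, hyW, hxy⟩ := exists_adj_of_leaves_compl hT hR' (W := W)
        (by simpa using hW) (by simpa using hS.inv.1.nonempty)
        (fun h => by rw [Finset.coe_inj] at h; rw [h] at hk; omega)
      rw [Finset.mem_coe] at hx hy hyW
      refine ih (insert y W) (H ⊔ edge x y) ?_ (Finset.insert_subset hy hW)
        (sup_le hH ((edge_le_iff _).2 (Or.inr hxy))) (hS.grow hx hy hyW (hTG hxy))
      rw [Finset.card_insert_of_notMem hyW]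
      omega
  obtain ⟨a, ha, b, hb, hab⟩ := Finset.one_lt_card.1 hc
  obtain ⟨x, hx, y, hy, hyW, hxy⟩ := exists_adj_of_leaves_compl hT hR' (W := {a})
    (by simpa using ha) (by simp) (fun h => by
      have : b ∈ ({a} : Set (Fin n)) := h ▸ hb
      exact hab this.symm)
  rw [Set.mem_singleton_iff] at hx
  subst hx
  refine main (R.card - 2) {x, y} (edge x y) ?_ ?_ ((edge_le_iff _).2 (Or.inr hxy))
    (Stage.pair ha hy (hTG hxy))
  · rw [Finset.card_pair hxy.ne]
    omega
  · intro v hv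
    simp only [Finset.mem_insert, Finset.mem_singleton] at hv
    rcases hv with rfl | rfl
    · exact ha
    · exact hy

/-- The vertices outside `R` can be attached to prescribed vertices `par v` of `R`. -/
theorem exists_stage_leaves {G H : SimpleGraph (Fin n)} {R : Finset (Fin n)} (h : Stage G R 0 R H)
    (par : Fin n → Fin n) (hpar : ∀ v ∉ R, par v ∈ R ∧ G.Adj (par v) v) (i : ℕ) (hi : i ≤ n) :
    ∃ W H', Stage G R i W H' ∧ R ⊆ W ∧
      (∀ T, H ≤ T → (∀ v ∉ R, T.Adj (par v) v) → H' ≤ T) ∧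
      ∀ x ∈ R, dg H' x = dg H x +
        (Finset.univ.filter fun v => v ∉ R ∧ v.val < i ∧ par v = x).card := by
  induction i with
  | zero => exact ⟨R, H, h, le_rfl, fun T h _ => h, by simp⟩
  | succ i ih =>
    obtain ⟨W, H', hS, hRW, hT, hd⟩ := ih (by omega)
    obtain ⟨v, hv⟩ : ∃ v : Fin n, v.val = i := ⟨⟨i, hi⟩, rfl⟩
    rw [← hv] at hS ⊢
    by_cases hvR : v ∈ R
    · refine ⟨W, H', hS.skip hvR, hRW, hT, fun x hx => ?_⟩
      rw [hd x hx]
      congr 2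
      ext u
      simp only [Finset.mem_filter, Finset.mem_univ, true_and]
      have : u ∉ R → u.val ≠ v.val := fun hu he => hu (Fin.ext he ▸ hvR)
      grind
    · obtain ⟨hp, hpv⟩ := hpar v hvR
      obtain ⟨h1, h2, -, -⟩ := hS.inv
      have hvW : v ∉ W := fun h => absurd ((h2 v hvR).1 h) (lt_irrefl _)
      refine ⟨insert v W, H' ⊔ edge (par v) v, hS.leaf hvR hp (hRW hp) hpv,
        hRW.trans (Finset.subset_insert _ _),
        fun T hT1 hT2 => sup_le (hT T hT1 hT2) ((edge_le_iff _).2 (Or.inr (hT2 v hvR))),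
        fun x hx => ?_⟩
      have hxv : x ≠ v := fun he => hvR (he ▸ hx)
      rw [h1.dg_insert (hRW hp) hvW, hd x hx, add_assoc]
      congr 1
      by_cases hpx : x = par v
      · rw [if_pos (Or.inl hpx)]
        have : (Finset.univ.filter fun u => u ∉ R ∧ u.val < v.val + 1 ∧ par u = x) =
            insert v (Finset.univ.filter fun u => u ∉ R ∧ u.val < i ∧ par u = x) := by
          ext u
          simp only [Finset.mem_filter, Finset.mem_univ, true_and, Finset.mem_insert, Fin.ext_iff]
          by_cases huv : u = v
          · subst huv
            simp [hvR, hpx]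
          · have : u.val ≠ v.val := fun he => huv (Fin.ext he)
            grind
        rw [this, Finset.card_insert_of_notMem (by simp [hv])]
      · rw [if_neg (by simp [hpx, hxv]), add_zero]
        congr 1
        ext u
        simp only [Finset.mem_filter, Finset.mem_univ, true_and]
        by_cases huv : u = v
        · subst huv
          simp [Ne.symm hpx]
        · have : u.val ≠ v.val := fun he => huv (Fin.ext he)
          grind

/-- A HIST is found as soon as `R` contains all its inner vertices. -/
theorem accept_of_isHIST {G T : SimpleGraph (Fin n)} {R : Finset (Fin n)} (hT : IsHIST G T)
    (hR : ∀ v ∉ R, dg T v = 1) (hc : 2 ≤ R.card) : Accept G R := by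
  obtain ⟨hTG, hTree, h2⟩ := hT
  have hpre := hTree.connected.preconnected
  obtain ⟨a, ha, b, hb, hab⟩ := Finset.one_lt_card.1 hc
  have : Nontrivial (Fin n) := ⟨a, b, hab⟩
  obtain ⟨H, hHT, hS⟩ := exists_stage_zero hTG hpre hR hc
  choose par hpar using fun v => exists_adj_of_dg_ne_zero (dg_ne_zero hpre v)
  have hparR : ∀ v ∉ R, par v ∈ R := by
    intro v hv
    by_contra hp
    have := mem_of_closed hpre (S := {v, par v}) (a := v) (by simp) (by
      rintro u (rfl | rfl) w huw
      · rw [eq_of_dg_eq_one (hR u hv) huw (hpar u)]; simp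
      · rw [eq_of_dg_eq_one (hR _ hp) huw (hpar v).symm]; simp) a
    rcases this with rfl | rfl
    · exact hv ha
    · exact hp ha
  obtain ⟨W, H', hS', hRW, hle, -⟩ := exists_stage_leaves hS par
    (fun v hv => ⟨hparR v hv, hTG (hpar v).symm⟩) n le_rfl
  obtain ⟨h1, h3, -, -⟩ := hS'.inv
  have hW : ∀ v, v ∈ W := fun v => by
    by_cases hv : v ∈ R
    · exact hRW hv
    · exact (h3 v hv).2 v.2
  have heq : H' = T := eq_of_le_of_preconnected_of_isAcyclic
    (fun a b => h1.reachable a (hW a) b (hW b)) hTree.isAcyclic (hle T hHT fun v _ => (hpar v).symm)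
  rw [heq] at hS'
  exact ⟨W, T, hS', fun x _ => ⟨dg_ne_zero hpre x, h2 x⟩⟩

/-! ### Graphs with disconnected complement -/

/-- The double star with centres `x` and `y`: the vertices of `A` are attached to `x`, the other
vertices to `y`. -/
theorem accept_doubleStar {G : SimpleGraph (Fin n)} {x y : Fin n} (hxy : G.Adj x y)
    (A : Finset (Fin n)) (hxA : x ∉ A) (hyA : y ∉ A) (hA : ∀ v ∈ A, G.Adj x v)
    (hA' : ∀ v ∉ A, v ≠ x → v ≠ y → G.Adj y v) (h1 : A.card ≠ 1) (h2 : A.card + 3 ≠ n) :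
    Accept G {x, y} := by
  have hne := hxy.ne
  obtain ⟨W, H', hS, -, -, hd⟩ := exists_stage_leaves (R := {x, y})
    (Stage.pair (by simp) (by simp) hxy) (fun v => if v ∈ A then x else y) (fun v hv => by
      simp only [Finset.mem_insert, Finset.mem_singleton, not_or] at hv
      by_cases hvA : v ∈ A
      · simp [hvA, hA v hvA]
      · simp [hvA, hA' v hvA hv.1 hv.2]) n le_rfl
  refine ⟨W, H', hS, fun z hz => ?_⟩
  rw [hd z hz, dg_edge hne, if_pos (by simpa using hz)]
  suffices h : (Finset.univ.filter fun v => v ∉ ({x, y} : Finset (Fin n)) ∧ v.val < n ∧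
      (if v ∈ A then x else y) = z).card ≠ 1 by omega
  have hx : (Finset.univ.filter fun v => v ∉ ({x, y} : Finset (Fin n)) ∧ v.val < n ∧
      (if v ∈ A then x else y) = x) = A := by
    ext v
    simp only [Finset.mem_filter, Finset.mem_univ, true_and, Finset.mem_insert,
      Finset.mem_singleton, v.2]
    grind
  have hy : (Finset.univ.filter fun v => v ∉ ({x, y} : Finset (Fin n)) ∧ v.val < n ∧
      (if v ∈ A then x else y) = y) = (insert x (insert y A))ᶜ := by
    ext v
    simp only [Finset.mem_filter, Finset.mem_univ, true_and, Finset.mem_insert,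
      Finset.mem_singleton, v.2, Finset.mem_compl]
    grind
  simp only [Finset.mem_insert, Finset.mem_singleton] at hz
  rcases hz with rfl | rfl
  · rw [hx]
    exact h1
  · rw [hy, Finset.card_compl, Finset.card_insert_of_notMem (by simp [hne, hxA]),
      Finset.card_insert_of_notMem hyA, Fintype.card_fin]
    omega

/-- A HIST without vertices of degree at least four has only odd degrees, and thus an even number
of vertices. -/
theorem _root_.IsHIST.exists_four_le_dg {G T : SimpleGraph (Fin n)} (hT : IsHIST G T) (hn : 2 ≤ n)
    (hodd : n % 2 = 1) : ∃ v, 4 ≤ dg T v := by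
  classical
  by_contra! hlt
  have : Nontrivial (Fin n) := Fin.nontrivial_iff_two_le.2 hn
  have hdeg : ∀ v, T.degree v = dg T v := fun v => by
    rw [dg, Set.ncard_eq_toFinset_card', ← card_neighborFinset_eq_degree]
    rfl
  have hev := T.even_card_odd_degree_vertices
  rw [Finset.filter_true_of_mem, Finset.card_univ, Fintype.card_fin] at hev
  · rw [Nat.even_iff] at hev
    omega
  · intro v _
    rw [hdeg, Nat.odd_iff]
    have h1 := dg_ne_zero hT.2.1.connected.preconnected v
    have h2 : dg T v ≠ 2 := hT.2.2 v
    have h3 := hlt v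
    omega

theorem dg_lt (T : SimpleGraph (Fin n)) (v : Fin n) : dg T v < n := by
  have h : dg T v < (Set.univ : Set (Fin n)).ncard :=
    Set.ncard_lt_ncard (Set.ssubset_univ_iff.2 fun h =>
      T.loopless.irrefl v (h.symm ▸ Set.mem_univ v : v ∈ T.neighborSet v))
  rwa [Set.ncard_univ, Nat.card_eq_fintype_card, Fintype.card_fin] at h

theorem adj_of_dg_add_one {T : SimpleGraph (Fin n)} {v : Fin n} (h : dg T v + 1 = n) {w : Fin n}
    (hw : w ≠ v) : T.Adj v w := by
  by_contra hn
  have h1 : (insert w (insert v (T.neighborSet v))).ncard = dg T v + 2 := by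
    rw [Set.ncard_insert_of_notMem, Set.ncard_insert_of_notMem]
    · rfl
    · exact T.loopless.irrefl v
    · rintro (h | h)
      · exact hw h
      · exact hn h
  have h2 := Set.ncard_le_ncard (Set.subset_univ (insert w (insert v (T.neighborSet v))))
  rw [Set.ncard_univ, Nat.card_eq_fintype_card, Fintype.card_fin] at h2
  omega

/-- The case of a graph without dominating vertex that is the join of two vertices `u`, `u'` and the
remaining graph.  An edge `pq` of the remaining graph leads to a double star with centres `p` and
`u`; without such an edge, all vertices except `u` and `u'` are leaves of every HIST, so that it
cannot be connected. -/
theorem accept_of_join_pair {G : SimpleGraph (Fin n)} (h : HasHIST G)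
    (hdom : ∀ x, ∃ v, v ≠ x ∧ ¬ G.Adj x v) {u u' : Fin n} (huu : u ≠ u')
    (hu : ∀ v, v ≠ u → v ≠ u' → G.Adj u v ∧ G.Adj u' v) : ∃ x y, Accept G {x, y} := by
  obtain ⟨T, hT⟩ := h
  have hpre := hT.2.1.connected.preconnected
  have hnt : Nontrivial (Fin n) := ⟨u, u', huu⟩
  have hnadj : ¬ G.Adj u u' := by
    intro hadj
    obtain ⟨v, hv, hv'⟩ := hdom u
    by_cases hvu : v = u'
    · exact hv' (hvu ▸ hadj)
    · exact hv' (hu v hv hvu).1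
  by_cases hpq : ∃ p q, p ≠ u ∧ p ≠ u' ∧ q ≠ u ∧ q ≠ u' ∧ G.Adj p q
  · obtain ⟨p, q, hp1, hp2, hq1, hq2, hpq⟩ := hpq
    have hup := (hu p hp1 hp2).1
    have hup' := (hu p hp1 hp2).2
    have hcard : ({u, u', p, q} : Finset (Fin n)).card = 4 := by
      rw [Finset.card_insert_of_notMem, Finset.card_insert_of_notMem, Finset.card_pair hpq.ne]
      · simp [hp2.symm, hq2.symm]
      · simp [hp1.symm, hq1.symm, huu]
    have h4 : 4 ≤ n := by
      rw [← hcard]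
      simpa using Finset.card_le_univ ({u, u', p, q} : Finset (Fin n))
    have hn4 : n ≠ 4 := by
      intro hn
      have hun : ({u, u', p, q} : Finset (Fin n)) = Finset.univ :=
        Finset.eq_univ_of_card _ (by rw [hcard, Fintype.card_fin, hn])
      obtain ⟨v, hv, hv'⟩ := hdom p
      have : v ∈ ({u, u', p, q} : Finset (Fin n)) := hun ▸ Finset.mem_univ v
      simp only [Finset.mem_insert, Finset.mem_singleton] at this
      rcases this with rfl | rfl | rfl | rfl
      · exact hv' hup.symm
      · exact hv' hup'.symm
      · exact hv rfl
      · exact hv' hpq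
    -- For `n = 5`, a HIST is a star, whose centre would be a dominating vertex.
    have hn5 : n ≠ 5 := by
      intro hn
      obtain ⟨v, hv⟩ := hT.exists_four_le_dg (by omega) (by omega)
      have := dg_lt T v
      obtain ⟨w, hw, hw'⟩ := hdom v
      exact hw' (hT.1 (adj_of_dg_add_one (by omega) hw))
    refine ⟨p, u, accept_doubleStar hup.symm {u', q} ?_ ?_ ?_ ?_ ?_ ?_⟩
    · simp [hp2, hpq.ne]
    · simp [huu, hq1.symm]
    · simp [hup'.symm, hpq]
    · intro v hv hvp hvu
      simp only [Finset.mem_insert, Finset.mem_singleton, not_or] at hv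
      exact (hu v hvu hv.1).1
    · rw [Finset.card_pair hq2.symm]
      norm_num
    · rw [Finset.card_pair hq2.symm]
      omega
  · exfalso
    push Not at hpq
    have hd : ∀ b, b ≠ u → b ≠ u' → dg T b = 1 := by
      intro b hb hb'
      have h1 := dg_ne_zero hpre b
      have h2 : dg T b ≠ 2 := hT.2.2 b
      have h3 : dg T b ≤ ({u, u'} : Set (Fin n)).ncard := Set.ncard_le_ncard (fun c hc => by
        by_contra hcn
        simp only [Set.mem_insert_iff, Set.mem_singleton_iff, not_or] at hcn
        exact hpq b c hb hb' hcn.1 hcn.2 (hT.1 hc))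
      rw [Set.ncard_pair huu] at h3
      omega
    have := mem_of_closed hpre (S := {b | b = u ∨ T.Adj u b}) (a := u) (Or.inl rfl) (by
      rintro x (rfl | hx) y hxy
      · exact Or.inr hxy
      · have hxu' : x ≠ u' := fun he => hnadj (hT.1 (he ▸ hx))
        exact Or.inl (eq_of_dg_eq_one (hd x hx.ne.symm hxu') hxy hx.symm)) u'
    rcases this with h | h
    · exact huu h.symm
    · exact hnadj (hT.1 h)

/-- A graph that has a HIST and a disconnected complement has a HIST with at most two inner
vertices: a star if there is a dominating vertex, and otherwise a double star. -/
theorem accept_pair_of_not_preconnected_compl {G : SimpleGraph (Fin n)} (hn : 2 ≤ n)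
    (h : HasHIST G) (hGc : ¬ Gᶜ.Preconnected) : ∃ x y, Accept G {x, y} := by
  classical
  have hnt : Nontrivial (Fin n) := Fin.nontrivial_iff_two_le.2 hn
  by_cases hdom : ∃ x, ∀ v, v ≠ x → G.Adj x v
  · obtain ⟨x, hx⟩ := hdom
    obtain ⟨y, hy⟩ := exists_ne x
    have hc : (Finset.univ \ {x, y} : Finset (Fin n)).card = n - 2 := by
      rw [Finset.card_sdiff_of_subset (Finset.subset_univ _), Finset.card_pair hy.symm,
        Finset.card_univ, Fintype.card_fin]
    refine ⟨x, y, accept_doubleStar (hx y hy) (Finset.univ \ {x, y}) (by simp) (by simp)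
      ?_ ?_ ?_ ?_⟩
    · intro v hv
      simp only [Finset.mem_sdiff, Finset.mem_univ, true_and, Finset.mem_insert,
        Finset.mem_singleton, not_or] at hv
      exact hx v hv.1
    · intro v hv h1 h2
      simp [h1, h2] at hv
    · rw [hc]
      intro h3
      obtain ⟨T, hT⟩ := h
      obtain ⟨v, hv⟩ := hT.exists_four_le_dg hn (by omega)
      have := dg_lt T v
      omega
    · rw [hc]
      omega
  · push Not at hdom
    obtain ⟨S, hS1, hS2, hS3⟩ := exists_no_adj_of_not_preconnected hGc
    obtain ⟨A, rfl⟩ : ∃ A : Finset (Fin n), (A : Set (Fin n)) = S :=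
      ⟨S.toFinite.toFinset, S.toFinite.coe_toFinset⟩
    have hj : ∀ x ∈ A, ∀ y ∉ A, G.Adj x y := by
      intro x hx y hy
      by_contra hn
      exact hS3 x hx y hy ⟨fun he => hy (he ▸ hx), hn⟩
    -- Both sides of the join may be assumed to have at least three elements; then each centre of
    -- the double star is given all leaves of the other side.
    have key : ∀ B : Finset (Fin n), (∀ x ∈ B, ∀ y ∉ B, G.Adj x y) → B.Nonempty →
        3 ≤ B.card ∨ ∃ x y, Accept G {x, y} := by
      intro B hB hB1
      by_contra! hcon
      have hpos := hB1.card_pos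
      obtain h1 | h2 : B.card = 1 ∨ B.card = 2 := by omega
      · obtain ⟨x, rfl⟩ := Finset.card_eq_one.1 h1
        obtain ⟨v, hv, hv'⟩ := hdom x
        exact hv' (hB x (by simp) v (by simpa using hv))
      · obtain ⟨u, u', huu, rfl⟩ := Finset.card_eq_two.1 h2
        obtain ⟨x, y, hxy⟩ := accept_of_join_pair h hdom huu fun v hv hv' =>
          ⟨hB u (by simp) v (by simp [hv, hv']), hB u' (by simp) v (by simp [hv, hv'])⟩
        exact hcon.2 x y hxy
    have hAc : Aᶜ.Nonempty := by
      obtain ⟨y, hy⟩ := (Set.ne_univ_iff_exists_notMem _).1 hS2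
      exact ⟨y, by simpa using hy⟩
    have hA : A.Nonempty := by simpa using hS1
    rcases key A hj hA with h3 | h3
    · rcases key Aᶜ (fun x hx y hy => (hj y (by simpa using hy) x (by simpa using hx)).symm) hAc
        with h4 | h4
      · obtain ⟨x, hx⟩ := hA
        obtain ⟨y, hy⟩ := hAc
        have hsum := Finset.card_add_card_compl A
        rw [Fintype.card_fin] at hsum
        have hc := Finset.card_erase_of_mem hy
        refine ⟨x, y, accept_doubleStar (hj x hx y (by simpa using hy)) (Aᶜ.erase y)
          (by simp [hx]) (by simp) (fun v hv => ?_) (fun v hv h5 h6 => ?_) (by omega) (by omega)⟩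
        · exact hj x hx v (by simpa using Finset.mem_of_mem_erase hv)
        · have hvA : v ∈ A := by
            by_contra hvA
            exact hv (Finset.mem_erase.2 ⟨h6, by simpa using hvA⟩)
          exact (hj v hvA y (by simpa using hy)).symm
      · exact h4
    · exact h3

end HIST

namespace HIST

open SimpleGraph

variable {n : ℕ}

/-! ### The representatives of the classes of similar vertices -/

/-- A linear order on the vertices that refines the order by `simDeg`. -/
noncomputable def key (G : SimpleGraph (Fin n)) (v : Fin n) : ℕ := simDeg G v * n + v

open Classical in
/-- The vertices that have the largest key among the vertices similar to them. -/
noncomputable def reps (G : SimpleGraph (Fin n)) : Finset (Fin n) :=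
  Finset.univ.filter fun v => ∀ u, Sim G v u → key G u ≤ key G v

theorem mem_reps {G : SimpleGraph (Fin n)} {v : Fin n} :
    v ∈ reps G ↔ ∀ u, Sim G v u → key G u ≤ key G v := by
  simp [reps]

theorem key_injective (G : SimpleGraph (Fin n)) : Function.Injective (key G) := by
  intro u v h
  have h' := congrArg (· % n) h
  simp only [key, RAM.mul_add_mod_eq u.2, RAM.mul_add_mod_eq v.2] at h'
  exact Fin.ext h'

theorem simDeg_le_of_key_le {G : SimpleGraph (Fin n)} {u v : Fin n} (h : key G u ≤ key G v) :
    simDeg G u ≤ simDeg G v := by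
  unfold key at h
  have := v.2
  by_contra! hlt
  have : (simDeg G v + 1) * n ≤ simDeg G u * n := Nat.mul_le_mul_right _ hlt
  rw [add_mul] at this
  omega

theorem eq_of_mem_reps_of_sim {G : SimpleGraph (Fin n)} (u : Fin n) (hu : u ∈ reps G) (v : Fin n)
    (hv : v ∈ reps G) (h : Sim G u v) : u = v :=
  key_injective G (le_antisymm (mem_reps.1 hv u h.symm) (mem_reps.1 hu v h))

theorem card_reps_le {G : SimpleGraph (Fin n)} (hn : 2 ≤ n) :
    (reps G).card ≤ modularWidth G + 2 := by
  have : Nontrivial (Fin n) := Fin.nontrivial_iff_two_le.2 hn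
  by_cases h : G.Preconnected ∧ Gᶜ.Preconnected
  · exact (card_le_modularWidth h.1 h.2 _ eq_of_mem_reps_of_sim).trans (Nat.le_add_right _ _)
  · exact (card_le_two h _ eq_of_mem_reps_of_sim).trans (Nat.le_add_left _ _)

/-- A graph has a HIST if and only if it has one whose inner vertices are among two vertices or
among the representatives. -/
theorem hasHIST_iff_accept {G : SimpleGraph (Fin n)} (hn : 2 ≤ n) :
    HasHIST G ↔ (∃ x y, Accept G {x, y}) ∨ Accept G (reps G) := by
  have hnt : Nontrivial (Fin n) := Fin.nontrivial_iff_two_le.2 hn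
  refine ⟨fun h => ?_, ?_⟩
  · by_cases hGc : Gᶜ.Preconnected
    · right
      have hG : G.Preconnected := by
        obtain ⟨T, hTG, hT, -⟩ := h
        exact hT.connected.preconnected.mono hTG
      have hR : ∀ v, ∃ r ∈ reps G, Sim G v r ∧ ∀ u, Sim G v u → simDeg G u ≤ simDeg G r := by
        intro v
        obtain ⟨r, hr, hmax⟩ := Set.exists_max_image {u | Sim G v u} (key G) (Set.toFinite _)
          ⟨v, Sim.refl G v⟩
        exact ⟨r, mem_reps.2 fun u hu => hmax u (Sim.trans hG hGc hr hu), hr,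
          fun u hu => simDeg_le_of_key_le (hmax u hu)⟩
      obtain ⟨T, hT, hleaf⟩ := exists_isHIST_inner_mem hG hGc h (reps G) hR
      refine accept_of_isHIST hT hleaf ?_
      obtain ⟨v⟩ := hT.2.1.connected.nonempty
      obtain ⟨w, hw⟩ := (Set.ne_univ_iff_exists_notMem _).1 (isGraphModule_sim hG hGc v).2
      obtain ⟨r, hr, hvr, -⟩ := hR v
      obtain ⟨s, hs, hws, -⟩ := hR w
      exact Finset.one_lt_card.2 ⟨r, hr, s, hs, fun he =>
        hw (Sim.trans hG hGc hvr (Sim.symm (he ▸ hws)))⟩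
    · exact Or.inl (accept_pair_of_not_preconnected_compl hn h hGc)
  · rintro (⟨x, y, h⟩ | h)
    · exact h.hasHIST
    · exact h.hasHIST

/-! ### Degree vectors as numbers in base four -/

/-- The number of elements of `R` below `j`: the position of the digit of `j`. -/
def rk (R : Finset (Fin n)) (j : ℕ) : ℕ := (R.filter fun v => v.val < j).card

/-- The number with the base four digits `d v`, for `v ∈ R`. -/
def code (R : Finset (Fin n)) (d : Fin n → ℕ) : ℕ := ∑ v ∈ R, d v * 4 ^ rk R v

/-- The digit of `x` in the number `c`. -/
def dig (R : Finset (Fin n)) (x : Fin n) (c : ℕ) : ℕ := c / 4 ^ rk R x % 4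

theorem rk_succ_of_mem {R : Finset (Fin n)} {v : Fin n} (hv : v ∈ R) :
    (R.filter fun u => u.val < v.val + 1) = insert v (R.filter fun u => u.val < v.val) ∧
      rk R (v + 1) = rk R v + 1 := by
  have : (R.filter fun u => u.val < v.val + 1) = insert v (R.filter fun u => u.val < v.val) := by
    ext u
    simp only [Finset.mem_filter, Finset.mem_insert, Nat.lt_succ_iff_lt_or_eq]
    grind
  refine ⟨this, ?_⟩
  unfold rk
  rw [this, Finset.card_insert_of_notMem (by simp)]

theorem rk_mono (R : Finset (Fin n)) {i j : ℕ} (h : i ≤ j) : rk R i ≤ rk R j :=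
  Finset.card_le_card fun v hv => by
    rw [Finset.mem_filter] at hv ⊢
    exact ⟨hv.1, lt_of_lt_of_le hv.2 h⟩

theorem rk_self (R : Finset (Fin n)) : rk R n = R.card := by
  unfold rk
  rw [Finset.filter_true_of_mem fun v _ => v.2]

/-- The digits below the position of `j` contribute less than the value of that position. -/
theorem prefix_lt (R : Finset (Fin n)) {d : Fin n → ℕ} (hd : ∀ v, d v ≤ 3) (j : ℕ) :
    ∑ v ∈ R.filter (fun v => v.val < j), d v * 4 ^ rk R v < 4 ^ rk R j := by
  induction j with
  | zero => simp
  | succ j ih =>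
    by_cases h : ∃ v ∈ R, v.val = j
    · obtain ⟨v, hv, rfl⟩ := h
      rw [(rk_succ_of_mem hv).1, (rk_succ_of_mem hv).2, Finset.sum_insert (by simp), pow_succ]
      have := Nat.mul_le_mul_right (4 ^ rk R v) (hd v)
      omega
    · have : (R.filter fun u => u.val < j + 1) = R.filter fun u => u.val < j := by
        ext u
        simp only [Finset.mem_filter, Nat.lt_succ_iff_lt_or_eq]
        grind
      rw [this]
      exact ih.trans_le (Nat.pow_le_pow_right (by norm_num) (rk_mono R (Nat.le_succ j)))

theorem code_lt (R : Finset (Fin n)) {d : Fin n → ℕ} (hd : ∀ v, d v ≤ 3) :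
    code R d < 4 ^ R.card := by
  have := prefix_lt R hd n
  rwa [Finset.filter_true_of_mem fun v _ => v.2, rk_self] at this

theorem dig_code {R : Finset (Fin n)} {d : Fin n → ℕ} (hd : ∀ v, d v ≤ 3) {x : Fin n}
    (hx : x ∈ R) : dig R x (code R d) = d x := by
  have h1 : code R d = ∑ v ∈ R.filter (fun v => v.val < x.val + 1), d v * 4 ^ rk R v +
      ∑ v ∈ R.filter (fun v => ¬ v.val < x.val + 1), d v * 4 ^ rk R v :=
    (Finset.sum_filter_add_sum_filter_not _ _ _).symm
  obtain ⟨s, hs⟩ : 4 ^ (rk R x + 1) ∣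
      ∑ v ∈ R.filter (fun v => ¬ v.val < x.val + 1), d v * 4 ^ rk R v := by
    refine Finset.dvd_sum fun v hv => Dvd.dvd.mul_left (pow_dvd_pow 4 ?_) _
    rw [← (rk_succ_of_mem hx).2]
    exact rk_mono R (not_lt.1 (Finset.mem_filter.1 hv).2)
  have h2 := prefix_lt R hd x
  rw [h1, hs, (rk_succ_of_mem hx).1, Finset.sum_insert (by simp), dig]
  generalize ∑ v ∈ R.filter (fun v => v.val < x.val), d v * 4 ^ rk R v = p at *
  have h3 : d x * 4 ^ rk R x + p + 4 ^ (rk R x + 1) * s =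
      (d x + 4 * s) * 4 ^ rk R x + p := by ring
  rw [h3, RAM.mul_add_div_eq h2]
  have := hd x
  omega

theorem code_add_single {R : Finset (Fin n)} {d d' : Fin n → ℕ} {x : Fin n} (hx : x ∈ R) {a : ℕ}
    (h : ∀ v, d' v = d v + if v = x then a else 0) : code R d' = code R d + a * 4 ^ rk R x := by
  unfold code
  rw [Finset.sum_congr rfl fun v _ => by rw [h v, add_mul], Finset.sum_add_distrib]
  congr 1
  simp [ite_mul, hx]

/-- The degrees in `H`, those larger than three being replaced by three. -/
noncomputable def cappedDeg (H : SimpleGraph (Fin n)) (v : Fin n) : ℕ := min 3 (dg H v)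

theorem cappedDeg_le (H : SimpleGraph (Fin n)) (v : Fin n) : cappedDeg H v ≤ 3 := min_le_left _ _

theorem IsTreeOn.cappedDeg_insert {G H : SimpleGraph (Fin n)} {W : Finset (Fin n)}
    (h : IsTreeOn G W H) {x y : Fin n} (hx : x ∈ W) (hy : y ∉ W) (v : Fin n) :
    cappedDeg (H ⊔ SimpleGraph.edge x y) v =
      cappedDeg H v + (if v = x then (if cappedDeg H x < 3 then 1 else 0) else 0) +
        if v = y then 1 else 0 := by
  have hne := ne_of_mem_of_not_mem hx hy
  have h0 := h.dg_eq_zero hy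
  unfold cappedDeg
  rw [h.dg_insert hx hy]
  grind

theorem IsTreeOn.code_insert {G H : SimpleGraph (Fin n)} {R W : Finset (Fin n)}
    (h : IsTreeOn G W H) {x y : Fin n} (hx : x ∈ W) (hxR : x ∈ R) (hy : y ∉ W) :
    code R (cappedDeg (H ⊔ SimpleGraph.edge x y)) = code R (cappedDeg H) +
      (if cappedDeg H x < 3 then 4 ^ rk R x else 0) + if y ∈ R then 4 ^ rk R y else 0 := by
  have h1 : code R (cappedDeg (H ⊔ SimpleGraph.edge x y)) =
      code R (fun v => cappedDeg H v +
          (if v = x then (if cappedDeg H x < 3 then 1 else 0) else 0)) +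
        if y ∈ R then 4 ^ rk R y else 0 := by
    by_cases hyR : y ∈ R
    · rw [code_add_single hyR (h.cappedDeg_insert hx hy), if_pos hyR, one_mul]
    · rw [if_neg hyR, add_zero]
      refine Finset.sum_congr rfl fun v hv => ?_
      rw [h.cappedDeg_insert hx hy, if_neg (fun he : v = y => hyR (he ▸ hv)), add_zero]
  rw [h1, code_add_single hxR fun v => rfl]
  split <;> simp

/-- The number `c` encodes the degrees in `R` of a tree of stage `i`. -/
def StageCode (G : SimpleGraph (Fin n)) (R : Finset (Fin n)) (i c : ℕ) : Prop :=
  ∃ W H, Stage G R i W H ∧ code R (cappedDeg H) = c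

theorem StageCode.lt {G : SimpleGraph (Fin n)} {R : Finset (Fin n)} {i c : ℕ}
    (h : StageCode G R i c) : c < 4 ^ R.card := by
  obtain ⟨W, H, -, rfl⟩ := h
  exact code_lt R (cappedDeg_le H)

theorem code_edge {R : Finset (Fin n)} {x y : Fin n} (hx : x ∈ R) (hy : y ∈ R) (hxy : x ≠ y) :
    code R (cappedDeg (edge x y)) = 4 ^ rk R x + 4 ^ rk R y := by
  have h : ∀ v, cappedDeg (edge x y) v =
      (0 + if v = x then 1 else 0) + if v = y then 1 else 0 := by
    intro v
    unfold cappedDeg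
    rw [dg_edge hxy]
    grind
  rw [code_add_single hy h, code_add_single hx fun v => rfl]
  simp [code]

/-- The recurrence for the codes of the trees inside `R`. -/
theorem stageCode_zero_iff {G : SimpleGraph (Fin n)} {R : Finset (Fin n)} {c : ℕ} :
    StageCode G R 0 c ↔ ∃ x ∈ R, ∃ y ∈ R, G.Adj x y ∧ (c = 4 ^ rk R x + 4 ^ rk R y ∨
      (∃ c', c = c' + (4 ^ rk R x + 4 ^ rk R y) ∧ StageCode G R 0 c' ∧ dig R y c' = 0 ∧
        0 < dig R x c' ∧ dig R x c' < 3) ∨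
      ∃ c', c = c' + 4 ^ rk R y ∧ StageCode G R 0 c' ∧ dig R y c' = 0 ∧ dig R x c' = 3) := by
  constructor
  · rintro ⟨W, H, hS, rfl⟩
    cases hS with
    | @pair x y hx hy hxy =>
      exact ⟨x, hx, y, hy, hxy, Or.inl (code_edge hx hy hxy.ne)⟩
    | @grow W H x y hS hx hy hyW hxy =>
      obtain ⟨h1, h2, h3, h4⟩ := hS.inv
      have hxR : x ∈ R := by
        by_contra hxR
        exact absurd ((h2 x hxR).1 hx) (Nat.not_lt_zero _)
      have hdy : dig R y (code R (cappedDeg H)) = 0 := by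
        rw [dig_code (cappedDeg_le H) hy, cappedDeg, h1.dg_eq_zero hyW]
        rfl
      have hdx := dig_code (cappedDeg_le H) hxR
      have hpos : 0 < cappedDeg H x := by
        have := h4 x hx
        unfold cappedDeg
        omega
      refine ⟨x, hxR, y, hy, hxy, Or.inr ?_⟩
      rw [h1.code_insert hx hxR hyW, if_pos hy]
      by_cases hlt : cappedDeg H x < 3
      · exact Or.inl ⟨_, by rw [if_pos hlt, add_assoc], ⟨W, H, hS, rfl⟩, hdy, hdx ▸ hpos, hdx ▸ hlt⟩
      · refine Or.inr ⟨_, by rw [if_neg hlt, add_zero], ⟨W, H, hS, rfl⟩, hdy, ?_⟩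
        have := cappedDeg_le H x
        omega
  · have aux : ∀ x ∈ R, ∀ y ∈ R, G.Adj x y → ∀ c', StageCode G R 0 c' → dig R y c' = 0 →
        0 < dig R x c' → StageCode G R 0
          (c' + (if dig R x c' < 3 then 4 ^ rk R x else 0) + 4 ^ rk R y) := by
      rintro x hx y hy hxy c' ⟨W, H, hS, rfl⟩ h1 h2
      obtain ⟨h3, -, -, h4⟩ := hS.inv
      rw [dig_code (cappedDeg_le H) hy] at h1
      rw [dig_code (cappedDeg_le H) hx] at h2 ⊢
      have hyW : y ∉ W := by
        intro hyW
        have := h4 y hyW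
        unfold cappedDeg at h1
        omega
      have hxW : x ∈ W := h3.mem_of_dg_ne_zero (by
        intro h0
        rw [cappedDeg, h0] at h2
        exact absurd h2 (lt_irrefl 0))
      refine ⟨_, _, hS.grow hxW hy hyW hxy, ?_⟩
      rw [h3.code_insert hxW hx hyW, if_pos hy]
    rintro ⟨x, hx, y, hy, hxy, rfl | ⟨c', rfl, h1, h2, h3, h4⟩ | ⟨c', rfl, h1, h2, h3⟩⟩
    · exact ⟨_, _, Stage.pair hx hy hxy, code_edge hx hy hxy.ne⟩
    · have := aux x hx y hy hxy c' h1 h2 h3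
      rwa [if_pos h4, add_assoc] at this
    · have := aux x hx y hy hxy c' h1 h2 (by omega)
      rwa [h3, if_neg (lt_irrefl 3), add_zero] at this

/-- The recurrence for the codes when the vertices outside `R` are attached. -/
theorem stageCode_succ_iff {G : SimpleGraph (Fin n)} {R : Finset (Fin n)} {v : Fin n} {c : ℕ} :
    StageCode G R (v + 1) c ↔ (v ∈ R ∧ StageCode G R v c) ∨ (v ∉ R ∧ ∃ x ∈ R, G.Adj x v ∧
      ((∃ c', c = c' + 4 ^ rk R x ∧ StageCode G R v c' ∧ 0 < dig R x c' ∧ dig R x c' < 3) ∨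
        (StageCode G R v c ∧ dig R x c = 3))) := by
  constructor
  · rintro ⟨W, H, hS, rfl⟩
    generalize hi : v.val + 1 = i at hS
    cases hS with
    | pair => omega
    | grow => omega
    | @skip W H u hS hu =>
      obtain rfl : v = u := Fin.ext (by omega)
      exact Or.inl ⟨hu, W, H, hS, rfl⟩
    | @leaf W H u x hS hu hxR hx hxu =>
      obtain rfl : v = u := Fin.ext (by omega)
      obtain ⟨h1, h2, h3, h4⟩ := hS.inv
      have hvW : v ∉ W := fun h => absurd ((h2 v hu).1 h) (lt_irrefl _)
      have hdx := dig_code (cappedDeg_le H) hxR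
      have hpos : 0 < cappedDeg H x := by
        have := h4 x hx
        unfold cappedDeg
        omega
      refine Or.inr ⟨hu, x, hxR, hxu, ?_⟩
      rw [h1.code_insert hx hxR hvW, if_neg hu, add_zero]
      by_cases hlt : cappedDeg H x < 3
      · exact Or.inl ⟨_, by rw [if_pos hlt], ⟨W, H, hS, rfl⟩, hdx ▸ hpos, hdx ▸ hlt⟩
      · right
        rw [if_neg hlt, add_zero]
        refine ⟨⟨W, H, hS, rfl⟩, ?_⟩
        have := cappedDeg_le H x
        omega
  · rintro (⟨hv, W, H, hS, rfl⟩ | ⟨hv, x, hx, hxv, h⟩)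
    · exact ⟨W, H, hS.skip hv, rfl⟩
    · have aux : ∀ c', StageCode G R v c' → 0 < dig R x c' → StageCode G R (v + 1)
          (c' + if dig R x c' < 3 then 4 ^ rk R x else 0) := by
        rintro c' ⟨W, H, hS, rfl⟩ h2
        obtain ⟨h3, h5, -, -⟩ := hS.inv
        rw [dig_code (cappedDeg_le H) hx] at h2 ⊢
        have hxW : x ∈ W := h3.mem_of_dg_ne_zero (by
          intro h0
          rw [cappedDeg, h0] at h2
          exact absurd h2 (lt_irrefl 0))
        have hvW : v ∉ W := fun h => absurd ((h5 v hv).1 h) (lt_irrefl _)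
        refine ⟨_, _, hS.leaf hv hx hxW hxv, ?_⟩
        rw [h3.code_insert hxW hx hvW, if_neg hv, add_zero]
      rcases h with ⟨c', rfl, h1, h2, h3⟩ | ⟨h1, h2⟩
      · have := aux c' h1 h2
        rwa [if_pos h3] at this
      · have := aux c h1 (by omega)
        rwa [h2, if_neg (lt_irrefl 3), add_zero] at this

/-- Capped degrees other than `0` and `2` are odd. -/
theorem accept_iff {G : SimpleGraph (Fin n)} {R : Finset (Fin n)} :
    Accept G R ↔ ∃ c, StageCode G R n c ∧ ∀ x ∈ R, dig R x c % 2 ≠ 0 := by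
  have key : ∀ H : SimpleGraph (Fin n), ∀ x ∈ R, (dg H x ≠ 0 ∧ dg H x ≠ 2) ↔
      dig R x (code R (cappedDeg H)) % 2 ≠ 0 := by
    intro H x hx
    rw [dig_code (cappedDeg_le H) hx, cappedDeg]
    omega
  constructor
  · rintro ⟨W, H, hS, h⟩
    exact ⟨_, ⟨W, H, hS, rfl⟩, fun x hx => (key H x hx).1 (h x hx)⟩
  · rintro ⟨c, ⟨W, H, hS, rfl⟩, h⟩
    exact ⟨W, H, hS, fun x hx => (key H x hx).2 (h x hx)⟩

end HIST

namespace HIST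

open SimpleGraph RAM

variable {n : ℕ}

/-! ### Similarity through transitive closures -/

/-- The Floyd–Warshall recurrence for the digraph with an arc from `v` to `w` if exactly one of
`u` and `v` is adjacent to `w`: there is a path from `v` to `w` with all intermediate vertices
below `r`. -/
def fw (G : SimpleGraph (Fin n)) (u : Fin n) : ℕ → Fin n → Fin n → Prop
  | 0, v, w => v = w ∨ ¬ (G.Adj w v ↔ G.Adj w u)
  | r + 1, v, w => fw G u r v w ∨ ∃ h : r < n, fw G u r v ⟨r, h⟩ ∧ fw G u r ⟨r, h⟩ w

theorem fw_mono {G : SimpleGraph (Fin n)} {u v w : Fin n} {r s : ℕ} (hrs : r ≤ s)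
    (h : fw G u r v w) : fw G u s v w := by
  induction hrs with
  | refl => exact h
  | step _ ih => exact Or.inl ih

theorem fw_trans {G : SimpleGraph (Fin n)} {u : Fin n} (r : ℕ) {v x w : Fin n} (hx : x.val < r)
    (h1 : fw G u r v x) (h2 : fw G u r x w) : fw G u r v w := by
  induction r generalizing v x w with
  | zero => exact absurd hx (Nat.not_lt_zero _)
  | succ r ih =>
    rcases Nat.lt_succ_iff_lt_or_eq.1 hx with hx | hx
    · rcases h1 with h1 | ⟨h, h1, h3⟩ <;> rcases h2 with h2 | ⟨h', h2, h4⟩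
      · exact Or.inl (ih hx h1 h2)
      · exact Or.inr ⟨h', ih hx h1 h2, h4⟩
      · exact Or.inr ⟨h, h1, ih hx h3 h2⟩
      · exact Or.inr ⟨h, h1, h4⟩
    · obtain ⟨hr, rfl⟩ : ∃ h : r < n, x = ⟨r, h⟩ := ⟨hx ▸ x.2, Fin.ext hx⟩
      have h3 : fw G u r v ⟨r, hr⟩ := h1.elim id fun ⟨_, h, _⟩ => h
      have h4 : fw G u r ⟨r, hr⟩ w := h2.elim id fun ⟨_, _, h⟩ => h
      exact Or.inr ⟨hr, h3, h4⟩

/-- The smallest module containing `u` and `v` consists of `u` and the vertices reachable from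
`v`. -/
theorem sim_iff_fw {G : SimpleGraph (Fin n)} {u v : Fin n} :
    Sim G u v ↔ ∃ w, w ≠ u ∧ ¬ fw G u n v w := by
  constructor
  · rintro ⟨M, hM, hMu, hu, hv⟩
    obtain ⟨w, hw⟩ := (Set.ne_univ_iff_exists_notMem _).1 hMu
    have key : ∀ r x y, x ∈ M → fw G u r x y → y ∈ M := by
      intro r
      induction r with
      | zero =>
        rintro x y hx (rfl | h)
        · exact hx
        · by_contra hy
          exact h ⟨hM.adj hx hu hy, hM.adj hu hx hy⟩
      | succ r ih =>
        rintro x y hx (h | ⟨hr, h1, h2⟩)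
        · exact ih x y hx h
        · exact ih _ y (ih x _ hx h1) h2
    exact ⟨w, fun h => hw (h ▸ hu), fun h => hw (key n v w hv h)⟩
  · rintro ⟨w, hwu, hw⟩
    refine ⟨{x | x = u ∨ fw G u n v x}, isGraphModule_of_adj fun x hx a ha b hb hxa => ?_,
      fun h => ?_, Or.inl rfl, Or.inr (fw_mono (Nat.zero_le n) (Or.inl rfl))⟩
    · simp only [Set.mem_ofPred_eq, not_or] at hx
      have key : ∀ a, (a = u ∨ fw G u n v a) → (G.Adj x a ↔ G.Adj x u) := by
        rintro a (rfl | ha)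
        · rfl
        · by_contra hn
          exact hx.2 (fw_trans n a.2 ha (fw_mono (Nat.zero_le n) (Or.inr hn)))
      exact (key b hb).2 ((key a ha).1 hxa)
    · rcases (h.symm ▸ Set.mem_univ w : w ∈ {x | x = u ∨ fw G u n v x}) with h | h
      · exact hwu h
      · exact hw h

/-! ### Notation for expressions -/

instance : Add Expr := ⟨.op .add⟩
instance : Sub Expr := ⟨.op .sub⟩
instance : Mul Expr := ⟨.op .mul⟩
instance : Div Expr := ⟨.op .div⟩
instance : Mod Expr := ⟨.op .mod⟩
instance (c : ℕ) : OfNat Expr c := ⟨.lit c⟩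

theorem val_add (m : Memory) (e f : Expr) : (e + f).val m = e.val m + f.val m := rfl
theorem val_sub (m : Memory) (e f : Expr) : (e - f).val m = e.val m - f.val m := rfl
theorem val_mul (m : Memory) (e f : Expr) : (e * f).val m = e.val m * f.val m := rfl
theorem val_div (m : Memory) (e f : Expr) : (e / f).val m = e.val m / f.val m := rfl
theorem val_mod (m : Memory) (e f : Expr) : (e % f).val m = e.val m % f.val m := rfl
theorem val_lit (m : Memory) (c : ℕ) :
    (no_index (OfNat.ofNat c : Expr)).val m = (OfNat.ofNat c : ℕ) := rfl
theorem val_read (m : Memory) (a : ℕ) (e : Expr) : (Expr.read a e).val m = m a (e.val m) := rfl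

open Classical in
/-- The truth value of a proposition. -/
noncomputable def ind (P : Prop) : ℕ := if P then 1 else 0

theorem ind_le (P : Prop) : ind P ≤ 1 := by unfold ind; split <;> simp

theorem ind_pos {P : Prop} : 0 < ind P ↔ P := by unfold ind; split <;> simp [*]

theorem ind_congr {P Q : Prop} (h : P ↔ Q) : ind P = ind Q := congrArg ind (propext h)

theorem ind_eq_ind {P Q : Prop} : ind P = ind Q ↔ (P ↔ Q) :=
  ⟨fun h => by rw [← ind_pos (P := P), h, ind_pos], ind_congr⟩

/-- Equality test. -/
def eqE (e f : Expr) : Expr := .op .eq e f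
/-- Comparison. -/
def ltE (e f : Expr) : Expr := .op .lt e f
/-- Conjunction of truth values. -/
def andE (e f : Expr) : Expr := e * f
/-- Disjunction of truth values. -/
def orE (e f : Expr) : Expr := ltE 0 (e + f)
/-- Negation of a truth value. -/
def notE (e : Expr) : Expr := eqE e 0

section

variable {m : Memory} {e f : Expr} {P Q : Prop}

theorem val_eqE {x y : ℕ} (he : e.val m = x) (hf : f.val m = y) :
    (eqE e f).val m = ind (x = y) := by
  subst he hf
  unfold ind eqE
  simp only [Expr.val, Op.apply]
  congr

theorem val_ltE {x y : ℕ} (he : e.val m = x) (hf : f.val m = y) :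
    (ltE e f).val m = ind (x < y) := by
  subst he hf
  unfold ind ltE
  simp only [Expr.val, Op.apply]
  congr

/-- The second factor of a conjunction only matters if the first one is true. -/
theorem val_andE (he : e.val m = ind P) (hf : P → f.val m = ind Q) :
    (andE e f).val m = ind (P ∧ Q) := by
  unfold andE
  rw [val_mul, he]
  by_cases hP : P
  · rw [hf hP, ind_congr (iff_true_intro hP), ind_congr (and_iff_right hP)]
    simp [ind]
  · simp [ind, hP]

theorem val_orE (he : e.val m = ind P) (hf : f.val m = ind Q) : (orE e f).val m = ind (P ∨ Q) := by
  unfold orE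
  rw [val_ltE rfl rfl, val_add, he, hf]
  refine ind_congr ?_
  rw [val_lit, Nat.add_pos_iff_pos_or_pos, ind_pos, ind_pos]

theorem val_notE (he : e.val m = ind P) : (notE e).val m = ind (¬ P) := by
  unfold notE
  rw [val_eqE he rfl]
  refine ind_congr ?_
  exact ⟨fun h hP => (ind_pos.2 hP).ne' h, fun h => by simp [ind, h, val_lit]⟩

theorem val_posE {x : ℕ} (he : e.val m = x) (h : 0 < x ↔ P) : (ltE 0 e).val m = ind P := by
  rw [val_ltE rfl he]
  exact ind_congr h

end

/-- The disjunction over a row of a table. -/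
theorem rowSum_pos_iff {L i j : ℕ} (hj : j < L) {P : ℕ → ℕ → Prop} :
    0 < rowSum L (fun i j => ind (P i j)) (i * L + j) ↔ ∃ k < j, P i k := by
  rw [rowSum_eq _ i hj, Finset.sum_pos_iff]
  simp only [Finset.mem_range, ind_pos]

theorem exists_mul_add {i a b : ℕ} (h : i < a * b) : ∃ q r, q < a ∧ r < b ∧ i = q * b + r := by
  have hb : 0 < b := Nat.pos_of_ne_zero fun h0 => by simp [h0] at h
  exact ⟨i / b, i % b, (Nat.div_lt_iff_lt_mul hb).2 h, Nat.mod_lt _ hb, (Nat.div_add_mod' i b).symm⟩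

theorem mul_add_lt {q r a b : ℕ} (hq : q < a) (hr : r < b) : q * b + r < a * b := by
  have : (q + 1) * b ≤ a * b := Nat.mul_le_mul_right b hq
  rw [add_mul] at this
  omega

/-! ### The tables computed by the algorithm -/

/-- The vertex with a given number. -/
def vtx (n : ℕ) [NeZero n] (x : ℕ) : Fin n := Fin.ofNat n x

theorem vtx_val [NeZero n] (v : Fin n) : vtx n v.val = v := Fin.ext (Nat.mod_eq_of_lt v.2)

theorem exists_vtx [NeZero n] {x : ℕ} (hx : x < n) : ∃ v : Fin n, v.val = x := ⟨⟨x, hx⟩, rfl⟩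

/-- The candidate sets of inner vertices: the pairs of vertices, numbered by `t < n * n`, and, for
`t = n * n`, the representatives of the classes of similar vertices. -/
noncomputable def cand [NeZero n] (G : SimpleGraph (Fin n)) (t : ℕ) : Finset (Fin n) :=
  if t < n * n then {vtx n (t / n), vtx n t} else reps G

/-- An upper bound for the codes to be considered. -/
noncomputable def codeBound (G : SimpleGraph (Fin n)) : ℕ := 16 * 4 ^ (reps G).card

/-- A common upper bound for the sizes of all tables. -/
noncomputable def tabSize (G : SimpleGraph (Fin n)) : ℕ := (n + 1) ^ 4 * codeBound G

theorem codeBound_pos (G : SimpleGraph (Fin n)) : 0 < codeBound G := by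
  unfold codeBound; positivity

theorem StageCode.lt_codeBound [NeZero n] {G : SimpleGraph (Fin n)} {t i c : ℕ}
    (h : StageCode G (cand G t) i c) : c < codeBound G := by
  refine h.lt.trans_le ?_
  unfold cand codeBound
  -- The factor `16` of the bound covers the candidate sets with two elements.
  split
  · calc 4 ^ ({vtx n (t / n), vtx n t} : Finset (Fin n)).card ≤ 4 ^ 2 :=
        Nat.pow_le_pow_right (by norm_num) Finset.card_le_two
      _ ≤ 16 * 4 ^ (reps G).card := Nat.le_mul_of_pos_right _ (by positivity)
  · exact Nat.le_mul_of_pos_left _ (by norm_num)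

/-- The specification of the content of bank `a`; the tables of partial sums are specified by
their last columns. -/
def Tab [NeZero n] (G : SimpleGraph (Fin n)) : ℕ → (ℕ → ℕ) → Prop
  | 0, f => f 0 = n
  | 1, f => ∀ u v : Fin n, f (u * n + v) = ind (G.Adj u v)
  | 3, f => ∀ u v w : Fin n, ∀ r ≤ n,
      f (((u * (n + 1) + r) * n + v) * n + w) = ind (fw G u r v w)
  | 4, f => ∀ u v : Fin n, 0 < f ((u * n + v) * (n + 1) + n) ↔ Sim G u v
  | 5, f => ∀ v : Fin n, f (v * (n + 1) + n) = simDeg G v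
  | 6, f => ∀ v : Fin n, 0 < f (v * (n + 1) + n) ↔ v ∉ reps G
  | 7, f => ∀ t ≤ n * n, ∀ v : Fin n, f (t * n + v) = ind (v ∈ cand G t)
  | 8, f => ∀ t ≤ n * n, ∀ j ≤ n, f (t * (n + 1) + j) = rk (cand G t) j
  | 9, f => ∀ j ≤ (reps G).card + 2, f j = 4 ^ j
  | 10, f => f 0 = codeBound G
  | 11, f => ∀ t ≤ n * n, ∀ c < codeBound G,
      0 < f ((t * codeBound G + c) * (n * n + 1) + n * n) ↔ StageCode G (cand G t) 0 c
  | 12, f => ∀ t ≤ n * n, ∀ i ≤ n, ∀ c < codeBound G,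
      0 < f (((t * (n + 1) + i) * codeBound G + c) * (n + 1) + n) ↔ StageCode G (cand G t) i c
  | 13, f => ∀ t ≤ n * n, ∀ c < codeBound G,
      0 < f ((t * codeBound G + c) * (n + 1) + n) ↔ ∃ x ∈ cand G t, dig (cand G t) x c % 2 = 0
  | 14, f => 0 < f ((n * n + 1) * codeBound G) ↔ ∃ t ≤ n * n, Accept G (cand G t)
  | _, _ => True

/-- The banks below `a` have been filled. -/
def Good [NeZero n] (G : SimpleGraph (Fin n)) (a : ℕ) (m : Memory) : Prop :=
  ∀ b < a, b ≠ ctr → Tab G b (m b)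

theorem Good.congr [NeZero n] {G : SimpleGraph (Fin n)} {a : ℕ} {m m' : Memory} (h : Good G a m)
    (hs : SameOff a m m') : Good G a m' := fun b hb hc => by
  rw [hs b hb.ne hc]
  exact h b hb hc

/-- The program `p` fills the banks from `a` to `c - 1`, provided that the banks below `a` have been
filled. -/
def Fills (a c : ℕ) (p : Prog) : Prop :=
  ∃ M, ∀ (n : ℕ) [NeZero n] (G : SimpleGraph (Fin n)) (b : ℕ) (m : Memory), 1 ≤ b →
    tabSize G < 2 ^ b → MemBdd b m → Good G a m →
    ∃ m', Run p m m' ((tabSize G + 1) * unitCost M b) ∧ MemBdd b m' ∧ Good G c m'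

theorem Fills.seq {a c d : ℕ} {p q : Prog} (hp : Fills a c p) (hq : Fills c d q) :
    Fills a d (.seq p q) := by
  obtain ⟨M₁, h₁⟩ := hp
  obtain ⟨M₂, h₂⟩ := hq
  refine ⟨M₁ + M₂, fun n _ G b m hb hsz hm hG => ?_⟩
  obtain ⟨m₁, hr₁, hm₁, hG₁⟩ := h₁ n G b m hb hsz hm hG
  obtain ⟨m₂, hr₂, hm₂, hG₂⟩ := h₂ n G b m₁ hb hsz hm₁ hG₁
  obtain ⟨t, ht, hex⟩ := hr₁.seq hr₂
  refine ⟨m₂, ⟨t, ht.trans ?_, hex⟩, hm₂, hG₂⟩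
  rw [← Nat.mul_add]
  exact Nat.mul_le_mul_left _ (unitCost_add M₁ M₂ b)

theorem Good.succ [NeZero n] {G : SimpleGraph (Fin n)} {a : ℕ} {m m' : Memory} (h : Good G a m)
    (hs : SameOff a m m') (ht : Tab G a (m' a)) : Good G (a + 1) m' := fun b hb hc => by
  rcases Nat.lt_succ_iff_lt_or_eq.1 hb with hb | rfl
  · exact h.congr hs b hb hc
  · exact ht

/-- The loop `fill a N e` fills the bank `a` if `e` satisfies a recurrence for a table `f` and `f`
satisfies the specification of the bank. -/
theorem fills_fill (a : ℕ) (ha : ctr < a) (N e : Expr)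
    (Nv : ∀ n : ℕ, SimpleGraph (Fin n) → ℕ)
    (f : ∀ (n : ℕ) [NeZero n], SimpleGraph (Fin n) → ℕ → ℕ)
    (hsize : ∀ (n : ℕ) [NeZero n] (G : SimpleGraph (Fin n)), Nv n G ≤ tabSize G ∧
      ∀ i < Nv n G, f n G i ≤ tabSize G)
    (hN : ∀ (n : ℕ) [NeZero n] (G : SimpleGraph (Fin n)) (m : Memory), Good G a m →
      N.val m = Nv n G)
    (he : ∀ (n : ℕ) [NeZero n] (G : SimpleGraph (Fin n)) (m : Memory), Good G a m →
      ∀ i < Nv n G, m ctr 0 = i → (∀ j < i, m a j = f n G j) → e.val m = f n G i)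
    (hT : ∀ (n : ℕ) [NeZero n] (G : SimpleGraph (Fin n)) (g : ℕ → ℕ),
      (∀ i < Nv n G, g i = f n G i) → Tab G a g) : Fills a (a + 1) (fill a N e) := by
  obtain ⟨M, hM⟩ := fill_run a ha.ne' N e
  refine ⟨M, fun n _ G b m hb hsz hm hG => ?_⟩
  obtain ⟨m', hr, hb', hj, hs⟩ := hM b m (Nv n G) (f n G) hb hm ((hsize n G).1.trans_lt hsz)
    (fun i hi => ((hsize n G).2 i hi).trans_lt hsz) (fun m' hs => hN n G m' (hG.congr hs))
    (fun i hi m' hc hj hs => he n G m' (hG.congr hs) i hi hc hj)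
  obtain ⟨t, ht, hex⟩ := hr
  exact ⟨m', ⟨t, ht.trans (Nat.mul_le_mul_right _ (Nat.succ_le_succ (hsize n G).1)), hex⟩, hb',
    hG.succ hs (hT n G _ hj)⟩

/-- The analogue of `fills_fill` for tables of partial sums: `g` has to compute the truth value of
`P` for the current row and column.  Column `j + 1` receives the term belonging to `j`. -/
theorem fills_fillSum (a : ℕ) (ha : ctr < a) (L N g : Expr)
    (Lv Nv : ∀ n : ℕ, SimpleGraph (Fin n) → ℕ)
    (P : ∀ (n : ℕ) [NeZero n], SimpleGraph (Fin n) → ℕ → ℕ → Prop)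
    (hsize : ∀ (n : ℕ) [NeZero n] (G : SimpleGraph (Fin n)), 0 < Lv n G ∧ Lv n G ≤ tabSize G ∧
      Nv n G ≤ tabSize G)
    (hLN : ∀ (n : ℕ) [NeZero n] (G : SimpleGraph (Fin n)) (m : Memory), Good G a m →
      L.val m = Lv n G ∧ N.val m = Nv n G)
    (hg : ∀ (n : ℕ) [NeZero n] (G : SimpleGraph (Fin n)) (m : Memory), Good G a m →
      ∀ i j, j + 1 < Lv n G → i * Lv n G + (j + 1) < Nv n G →
      (Expr.I / L).val m = i → (Expr.I % L - 1).val m = j →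
      (∀ k < i * Lv n G + (j + 1), m a k = rowSum (Lv n G) (fun i j => ind (P n G i j)) k) →
      g.val m = ind (P n G i j))
    (hT : ∀ (n : ℕ) [NeZero n] (G : SimpleGraph (Fin n)) (f : ℕ → ℕ),
      (∀ x < Nv n G, f x = rowSum (Lv n G) (fun i j => ind (P n G i j)) x) → Tab G a f) :
    Fills a (a + 1) (fillSum a L N g) := by
  obtain ⟨M, hM⟩ := fillSum_run a ha.ne' L N g
  refine ⟨M, fun n _ G b m hb hsz hm hG => ?_⟩
  obtain ⟨h1, h2, h3⟩ := hsize n G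
  obtain ⟨m', hr, hb', hj, hs⟩ := hM b m (Lv n G) (Nv n G) (fun i j => ind (P n G i j)) hb hm
    (h3.trans_lt hsz) (h2.trans_lt hsz) h1 (fun i j => ind_le _)
    (fun m' hs => (hLN n G m' (hG.congr hs)).2) (fun m' hs => (hLN n G m' (hG.congr hs)).1)
    (fun i j hj hi m' hc hk hs => by
      refine hg n G m' (hG.congr hs) i j hj hi ?_ ?_ hk
      · rw [val_div, (hLN n G m' (hG.congr hs)).1]
        change m' ctr 0 / _ = _
        rw [hc, mul_add_div_eq hj]
      · rw [val_sub, val_mod, (hLN n G m' (hG.congr hs)).1]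
        change m' ctr 0 % _ - 1 = _
        rw [hc, mul_add_mod_eq hj, Nat.add_sub_cancel])
  obtain ⟨t, ht, hex⟩ := hr
  exact ⟨m', ⟨t, ht.trans (Nat.mul_le_mul_right _ (Nat.succ_le_succ h3)), hex⟩, hb',
    hG.succ hs (hT n G _ hj)⟩

/-! ### The first tables: similarity, candidate sets, ranks -/

theorem vtx_mul_add [NeZero n] (a : ℕ) (v : Fin n) : vtx n (a * n + v) = v :=
  Fin.ext (mul_add_mod_eq v.2)

theorem le_tabSize {G : SimpleGraph (Fin n)} {x : ℕ} (h : x ≤ (n + 1) ^ 4) : x ≤ tabSize G :=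
  h.trans (Nat.le_mul_of_pos_right _ (codeBound_pos G))

theorem mul_le_tabSize {G : SimpleGraph (Fin n)} {x : ℕ} (h : x ≤ (n + 1) ^ 4) :
    x * codeBound G ≤ tabSize G :=
  Nat.mul_le_mul_right _ h

theorem row_lt {i j L A : ℕ} (h : i * L + (j + 1) < A * L) : i < A := by
  by_contra! hle
  have := Nat.mul_le_mul_right L hle
  omega

theorem rk_succ_of_notMem {R : Finset (Fin n)} {v : Fin n} (hv : v ∉ R) :
    rk R (v + 1) = rk R v := by
  unfold rk
  congr 1
  ext u
  simp only [Finset.mem_filter, Nat.lt_succ_iff_lt_or_eq]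
  have : u ∈ R → u.val ≠ v.val := fun hu he => hv (Fin.ext he ▸ hu)
  grind

theorem sum_ind_eq_rk [NeZero n] (R : Finset (Fin n)) {j : ℕ} (hj : j ≤ n) :
    ∑ k ∈ Finset.range j, ind (vtx n k ∈ R) = rk R j := by
  induction j with
  | zero => simp [rk]
  | succ j ih =>
    rw [Finset.sum_range_succ, ih (by omega)]
    obtain ⟨v, rfl⟩ := exists_vtx hj
    rw [vtx_val]
    by_cases hv : v ∈ R
    · rw [(rk_succ_of_mem hv).2]
      simp [ind, hv]
    · rw [rk_succ_of_notMem hv]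
      simp [ind, hv]

theorem exists_lt_iff_exists_vtx [NeZero n] {P : Fin n → Prop} :
    (∃ k < n, P (vtx n k)) ↔ ∃ v, P v :=
  ⟨fun ⟨k, _, h⟩ => ⟨_, h⟩, fun ⟨v, h⟩ => ⟨v, v.2, by rwa [vtx_val]⟩⟩

/-- The number of vertices. -/
def nE : Expr := .read 0 0

/-- Adjacency of two vertices. -/
def adjE (u v : Expr) : Expr := .read 1 (u * nE + v)

theorem val_nE [NeZero n] {G : SimpleGraph (Fin n)} {a : ℕ} {m : Memory} (h : Good G a m)
    (ha : 0 < a) : nE.val m = n :=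
  h 0 ha (by decide)

theorem val_adjE [NeZero n] {G : SimpleGraph (Fin n)} {a : ℕ} {m : Memory} (h : Good G a m)
    (ha : 1 < a) {e f : Expr} {u v : Fin n} (he : e.val m = u) (hf : f.val m = v) :
    (adjE e f).val m = ind (G.Adj u v) := by
  have h1 : Tab G 1 (m 1) := h 1 ha (by decide)
  rw [adjE, val_read, val_add, val_mul, he, hf, val_nE h (by omega)]
  exact h1 u v

/-- The address of an entry of the table of transitive closures. -/
def fwAdr (u r v w : Expr) : Expr := ((u * (nE + 1) + r) * nE + v) * nE + w

/-- The recurrence for the transitive closures. -/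
def fwStep (u r v w : Expr) : Expr :=
  orE (andE (eqE r 0) (orE (eqE v w) (notE (eqE (adjE w v) (adjE w u)))))
    (andE (ltE 0 r) (orE (.read 3 (fwAdr u (r - 1) v w))
      (andE (.read 3 (fwAdr u (r - 1) v (r - 1))) (.read 3 (fwAdr u (r - 1) (r - 1) w)))))

theorem val_fwAdr {m : Memory} (h0 : nE.val m = n) {eu er ev ew : Expr} {u r v w : ℕ}
    (hu : eu.val m = u) (hr : er.val m = r) (hv : ev.val m = v) (hw : ew.val m = w) :
    (fwAdr eu er ev ew).val m = ((u * (n + 1) + r) * n + v) * n + w := by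
  simp only [fwAdr, val_add, val_mul, val_lit, h0, hu, hr, hv, hw]

/-- The table of transitive closures. -/
noncomputable def fwTab [NeZero n] (G : SimpleGraph (Fin n)) (x : ℕ) : ℕ :=
  ind (fw G (vtx n (x / n / n / (n + 1))) (x / n / n % (n + 1)) (vtx n (x / n)) (vtx n x))

theorem fwTab_eq [NeZero n] (G : SimpleGraph (Fin n)) (u v w : Fin n) {r : ℕ} (hr : r ≤ n) :
    fwTab G (((u * (n + 1) + r) * n + v) * n + w) = ind (fw G u r v w) := by
  have hr' : r < n + 1 := by omega
  unfold fwTab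
  rw [vtx_mul_add, mul_add_div_eq w.2, vtx_mul_add, mul_add_div_eq v.2, mul_add_div_eq hr',
    mul_add_mod_eq hr', vtx_val]

/-- The table of the transitive closures `fw`. -/
theorem fills_closure : Fills 3 4 (fill 3 (nE * (nE + 1) * nE * nE)
    (fwStep (.I / nE / nE / (nE + 1)) (.I / nE / nE % (nE + 1)) (.I / nE % nE) (.I % nE))) := by
  refine fills_fill 3 (by decide) _ _ (fun n _ => n * (n + 1) * n * n) (fun n _ G => fwTab G)
    (fun n _ G => ⟨le_tabSize ?_, fun i _ => (ind_le _).trans (le_tabSize ?_)⟩)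
    (fun n _ G m h => ?_) (fun n _ G m h i hi hc hj => ?_) (fun n _ G g hg => ?_)
  · calc n * (n + 1) * n * n ≤ (n + 1) * (n + 1) * (n + 1) * (n + 1) := by gcongr <;> omega
      _ = (n + 1) ^ 4 := by ring
  · exact Nat.one_le_pow _ _ (by omega)
  · simp only [val_mul, val_add, val_lit, val_nE h (by decide)]
  · obtain ⟨i₁, w, hi₁, hw, rfl⟩ := exists_mul_add hi
    obtain ⟨i₂, v, hi₂, hv, rfl⟩ := exists_mul_add hi₁
    obtain ⟨u, r, hu, hr, rfl⟩ := exists_mul_add hi₂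
    obtain ⟨u, rfl⟩ := exists_vtx hu
    obtain ⟨v, rfl⟩ := exists_vtx hv
    obtain ⟨w, rfl⟩ := exists_vtx hw
    have h0 := val_nE h (by decide)
    have hI : Expr.I.val m = ((u * (n + 1) + r) * n + v) * n + w := hc
    have hw : (Expr.I % nE).val m = w := by
      simp only [val_mod, hI, h0, mul_add_mod_eq w.2]
    have hv : (Expr.I / nE % nE).val m = v := by
      simp only [val_mod, val_div, hI, h0, mul_add_div_eq w.2, mul_add_mod_eq v.2]
    have hr' : (Expr.I / nE / nE % (nE + 1)).val m = r := by
      simp only [val_mod, val_div, val_add, val_lit, hI, h0, mul_add_div_eq w.2,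
        mul_add_div_eq v.2, mul_add_mod_eq hr]
    have hu : (Expr.I / nE / nE / (nE + 1)).val m = u := by
      simp only [val_div, val_add, val_lit, hI, h0, mul_add_div_eq w.2,
        mul_add_div_eq v.2, mul_add_div_eq hr]
    have hr1 : (Expr.I / nE / nE % (nE + 1) - 1).val m = r - 1 := by
      rw [val_sub, hr', val_lit]
    have hprev : 0 < r → ∀ v' w' : Fin n,
        m 3 (((u * (n + 1) + (r - 1)) * n + v') * n + w') = ind (fw G u (r - 1) v' w') := by
      intro hr0 v' w'
      rw [hj _ ?_, fwTab_eq G u v' w' (by omega)]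
      have h1 : u.val * (n + 1) + (r - 1) < u * (n + 1) + r := by omega
      have h2 := mul_add_lt (mul_add_lt h1 v'.2) w'.2
      refine h2.trans_le ?_
      rw [add_mul (_ * n)]
      omega
    rw [fwTab_eq G u v w (by omega)]
    have hx : 0 < r → (vtx n (r - 1)).val = r - 1 := fun _ => Nat.mod_eq_of_lt (by omega)
    refine (val_orE (val_andE (val_eqE hr' rfl) fun _ => val_orE (val_eqE hv hw)
      (val_notE (val_eqE (val_adjE h (by decide) hw hv) (val_adjE h (by decide) hw hu))))
      (val_andE (Q := fw G u (r - 1) v w ∨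
          (fw G u (r - 1) v (vtx n (r - 1)) ∧ fw G u (r - 1) (vtx n (r - 1)) w))
        (val_ltE rfl hr') fun hr0 => val_orE ?_ (val_andE ?_ fun _ => ?_))).trans (ind_congr ?_)
    · rw [val_read, val_fwAdr h0 hu hr1 hv hw, hprev hr0]
    · rw [val_read, val_fwAdr h0 hu hr1 hv hr1, ← hprev hr0, hx hr0]
    · rw [val_read, val_fwAdr h0 hu hr1 hr1 hw, ← hprev hr0, hx hr0]
    · rw [val_lit, ind_eq_ind, Fin.val_inj]
      cases r with
      | zero => simp [fw]
      | succ r =>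
        have hrn : r < n := by omega
        have : vtx n r = ⟨r, hrn⟩ := vtx_val ⟨r, hrn⟩
        simp [fw, this, hrn]
  · intro u v w r hr
    rw [hg, fwTab_eq G u v w hr]
    exact mul_add_lt (mul_add_lt (mul_add_lt u.2 (by omega)) v.2) w.2

/-- The row and the column of the current cell of a table with `nE + 1` columns; the first column
does not count. -/
def rowE : Expr := .I / (nE + 1)

/-- See `rowE`. -/
def colE : Expr := .I % (nE + 1) - 1

/-- The table for similarity: it counts the witnesses in `sim_iff_fw`. -/
theorem fills_sim : Fills 4 5 (fillSum 4 (nE + 1) (nE * nE * (nE + 1))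
    (andE (notE (eqE colE (rowE / nE)))
      (notE (.read 3 (fwAdr (rowE / nE) nE (rowE % nE) colE))))) := by
  refine fills_fillSum 4 (by decide) _ _ _ (fun n _ => n + 1) (fun n _ => n * n * (n + 1))
    (fun n _ G i j => vtx n j ≠ vtx n (i / n) ∧
      ¬ fw G (vtx n (i / n)) n (vtx n i) (vtx n j))
    (fun n _ G => ⟨by omega, le_tabSize ?_, le_tabSize ?_⟩) (fun n _ G m h => ?_)
    (fun n _ G m h i j hj hi hrow hcol _ => ?_) (fun n _ G f hf => ?_)
  · exact Nat.le_self_pow (by norm_num) _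
  · calc n * n * (n + 1) = n * n * (n + 1) * 1 := by ring
      _ ≤ (n + 1) * (n + 1) * (n + 1) * (n + 1) := by gcongr <;> omega
      _ = (n + 1) ^ 4 := by ring
  · simp only [val_mul, val_add, val_lit, val_nE h (by decide), and_self]
  · have h0 := val_nE h (by decide)
    obtain ⟨u, v, hu, hv, rfl⟩ := exists_mul_add (row_lt hi)
    obtain ⟨u, rfl⟩ := exists_vtx hu
    obtain ⟨v, rfl⟩ := exists_vtx hv
    obtain ⟨w, rfl⟩ := exists_vtx (Nat.lt_of_succ_lt_succ hj)
    change rowE.val m = _ at hrow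
    change colE.val m = _ at hcol
    have hu : (rowE / nE).val m = u := by rw [val_div, hrow, h0, mul_add_div_eq v.2]
    have hv : (rowE % nE).val m = v := by rw [val_mod, hrow, h0, mul_add_mod_eq v.2]
    have h3 : Tab G 3 (m 3) := h 3 (by decide) (by decide)
    rw [vtx_mul_add, mul_add_div_eq v.2, vtx_val, vtx_val]
    refine (val_andE (val_notE (val_eqE hcol hu)) fun _ => val_notE ?_).trans
      (ind_congr (and_congr_left' (not_congr Fin.val_inj)))
    rw [val_read, val_fwAdr h0 hu h0 hv hcol]
    exact h3 u v w n le_rfl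
  · intro u v
    rw [hf _ (mul_add_lt (mul_add_lt u.2 v.2) (by omega)), rowSum_pos_iff (by omega), sim_iff_fw]
    rw [vtx_mul_add, mul_add_div_eq v.2, vtx_val, exists_lt_iff_exists_vtx
      (P := fun w => w ≠ u ∧ ¬ fw G u n v w)]

/-- Similarity of two vertices. -/
def simE (u v : Expr) : Expr := ltE 0 (.read 4 ((u * nE + v) * (nE + 1) + nE))

theorem val_simE [NeZero n] {G : SimpleGraph (Fin n)} {a : ℕ} {m : Memory} (h : Good G a m)
    (ha : 4 < a) {e f : Expr} {u v : Fin n} (he : e.val m = u) (hf : f.val m = v) :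
    (simE e f).val m = ind (Sim G u v) := by
  have h4 : Tab G 4 (m 4) := h 4 ha (by decide)
  refine val_posE ?_ (h4 u v)
  simp only [val_read, val_add, val_mul, val_lit, he, hf, val_nE h (by omega : 0 < a)]

theorem table_le (n : ℕ) : n + 1 ≤ (n + 1) ^ 4 ∧ n * (n + 1) ≤ (n + 1) ^ 4 := by
  refine ⟨Nat.le_self_pow (by norm_num) _, ?_⟩
  calc n * (n + 1) ≤ (n + 1) * (n + 1) := by gcongr; omega
    _ = (n + 1) ^ 2 := by ring
    _ ≤ (n + 1) ^ 4 := Nat.pow_le_pow_right (by omega) (by norm_num)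

/-- The table for `simDeg`. -/
theorem fills_simDeg : Fills 5 6 (fillSum 5 (nE + 1) (nE * (nE + 1))
    (andE (simE rowE colE) (adjE rowE colE))) := by
  refine fills_fillSum 5 (by decide) _ _ _ (fun n _ => n + 1) (fun n _ => n * (n + 1))
    (fun n _ G i j => Sim G (vtx n i) (vtx n j) ∧ G.Adj (vtx n i) (vtx n j))
    (fun n _ G => ⟨by omega, le_tabSize (table_le n).1, le_tabSize (table_le n).2⟩)
    (fun n _ G m h => ?_) (fun n _ G m h i j hj hi hrow hcol _ => ?_) (fun n _ G f hf => ?_)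
  · simp only [val_mul, val_add, val_lit, val_nE h (by decide), and_self]
  · obtain ⟨v, rfl⟩ := exists_vtx (row_lt hi)
    obtain ⟨w, rfl⟩ := exists_vtx (Nat.lt_of_succ_lt_succ hj)
    rw [vtx_val, vtx_val]
    exact val_andE (val_simE h (by decide) hrow hcol) fun _ => val_adjE h (by decide) hrow hcol
  · classical
    intro v
    rw [hf _ (mul_add_lt v.2 (by omega)), rowSum_eq _ _ (by omega), vtx_val]
    have := sum_ind_eq_rk (Finset.univ.filter fun w => Sim G v w ∧ G.Adj v w) le_rfl
    rw [rk_self] at this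
    simp only [Finset.mem_filter, Finset.mem_univ, true_and] at this
    rw [this, simDeg, Set.ncard_eq_toFinset_card']
    congr 1
    ext w
    simp

/-- The key of a vertex. -/
def keyE (v : Expr) : Expr := .read 5 (v * (nE + 1) + nE) * nE + v

theorem val_keyE [NeZero n] {G : SimpleGraph (Fin n)} {a : ℕ} {m : Memory} (h : Good G a m)
    (ha : 5 < a) {e : Expr} {v : Fin n} (he : e.val m = v) : (keyE e).val m = key G v := by
  have h5 : Tab G 5 (m 5) := h 5 ha (by decide)
  simp only [keyE, val_read, val_add, val_mul, val_lit, he, val_nE h (by omega : 0 < a)]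
  rw [h5 v, key]

/-- The table for the representatives: it counts the similar vertices with a larger key. -/
theorem fills_reps : Fills 6 7 (fillSum 6 (nE + 1) (nE * (nE + 1))
    (andE (simE rowE colE) (ltE (keyE rowE) (keyE colE)))) := by
  refine fills_fillSum 6 (by decide) _ _ _ (fun n _ => n + 1) (fun n _ => n * (n + 1))
    (fun n _ G i j => Sim G (vtx n i) (vtx n j) ∧ key G (vtx n i) < key G (vtx n j))
    (fun n _ G => ⟨by omega, le_tabSize (table_le n).1, le_tabSize (table_le n).2⟩)
    (fun n _ G m h => ?_) (fun n _ G m h i j hj hi hrow hcol _ => ?_) (fun n _ G f hf => ?_)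
  · simp only [val_mul, val_add, val_lit, val_nE h (by decide), and_self]
  · obtain ⟨v, rfl⟩ := exists_vtx (row_lt hi)
    obtain ⟨w, rfl⟩ := exists_vtx (Nat.lt_of_succ_lt_succ hj)
    rw [vtx_val, vtx_val]
    exact val_andE (val_simE h (by decide) hrow hcol) fun _ =>
      val_ltE (val_keyE h (by decide) hrow) (val_keyE h (by decide) hcol)
  · intro v
    rw [hf _ (mul_add_lt v.2 (by omega)), rowSum_pos_iff (by omega), vtx_val,
      exists_lt_iff_exists_vtx (P := fun w => Sim G v w ∧ key G v < key G w), mem_reps]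
    push Not
    rfl

theorem pairs_le (n : ℕ) : n * n + 1 ≤ (n + 1) ^ 2 := by nlinarith

/-- The characteristic functions of the candidate sets. -/
theorem fills_cand : Fills 7 8 (fill 7 ((nE * nE + 1) * nE)
    (orE (andE (ltE (.I / nE) (nE * nE))
        (orE (eqE (.I % nE) (.I / nE / nE)) (eqE (.I % nE) (.I / nE % nE))))
      (andE (notE (ltE (.I / nE) (nE * nE)))
        (notE (ltE 0 (.read 6 (.I % nE * (nE + 1) + nE))))))) := by
  refine fills_fill 7 (by decide) _ _ (fun n _ => (n * n + 1) * n)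
    (fun n _ G x => ind (vtx n x ∈ cand G (x / n)))
    (fun n _ G => ⟨le_tabSize ?_, fun i _ => (ind_le _).trans (le_tabSize ?_)⟩)
    (fun n _ G m h => ?_) (fun n _ G m h i hi hc hj => ?_) (fun n _ G g hg => ?_)
  · calc (n * n + 1) * n ≤ (n + 1) ^ 2 * (n + 1) ^ 2 :=
        Nat.mul_le_mul (pairs_le n) (by nlinarith)
      _ = (n + 1) ^ 4 := by ring
  · exact Nat.one_le_pow _ _ (by omega)
  · simp only [val_mul, val_add, val_lit, val_nE h (by decide)]
  · obtain ⟨t, v, ht, hv, rfl⟩ := exists_mul_add hi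
    obtain ⟨v, rfl⟩ := exists_vtx hv
    have h0 := val_nE h (by decide)
    have hI : Expr.I.val m = t * n + v := hc
    have ht' : (Expr.I / nE).val m = t := by rw [val_div, hI, h0, mul_add_div_eq v.2]
    have hv' : (Expr.I % nE).val m = v := by rw [val_mod, hI, h0, mul_add_mod_eq v.2]
    have h6 : Tab G 6 (m 6) := h 6 (by decide) (by decide)
    have hnn : (nE * nE).val m = n * n := by rw [val_mul, h0]
    rw [vtx_mul_add, mul_add_div_eq v.2]
    refine (val_orE (val_andE (val_ltE ht' hnn) fun _ => val_orE
        (val_eqE hv' (y := t / n) (by rw [val_div, ht', h0]))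
        (val_eqE hv' (y := t % n) (by rw [val_mod, ht', h0])))
      (val_andE (val_notE (val_ltE ht' hnn)) fun _ => val_notE (val_posE rfl
        (P := v ∉ reps G) ?_))).trans (ind_congr ?_)
    · simp only [val_read, val_add, val_mul, val_lit, hv', h0]
      exact h6 v
    · unfold cand
      by_cases hlt : t < n * n
      · have hdiv : t / n < n := Nat.div_lt_of_lt_mul hlt
        simp only [hlt, if_true, true_and, not_true, false_and, or_false, Finset.mem_insert,
          Finset.mem_singleton, Fin.ext_iff]
        change _ ↔ v.val = t / n % n ∨ v.val = t % n
        rw [Nat.mod_eq_of_lt hdiv]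
      · simp only [hlt, if_false, false_and, false_or, not_false_eq_true, true_and, not_not]
  · intro t ht v
    rw [hg _ (mul_add_lt (by omega) v.2), vtx_mul_add, mul_add_div_eq v.2]

/-- Membership of a vertex in a candidate set. -/
def candE (t v : Expr) : Expr := .read 7 (t * nE + v)

theorem val_candE [NeZero n] {G : SimpleGraph (Fin n)} {a : ℕ} {m : Memory} (h : Good G a m)
    (ha : 7 < a) {e f : Expr} {t : ℕ} {v : Fin n} (ht : t ≤ n * n) (he : e.val m = t)
    (hf : f.val m = v) : (candE e f).val m = ind (v ∈ cand G t) := by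
  have h7 : Tab G 7 (m 7) := h 7 ha (by decide)
  rw [candE, val_read, val_add, val_mul, he, hf, val_nE h (by omega)]
  exact h7 t ht v

/-- The positions of the vertices in the candidate sets. -/
theorem fills_rank : Fills 8 9 (fillSum 8 (nE + 1) ((nE * nE + 1) * (nE + 1))
    (candE rowE colE)) := by
  refine fills_fillSum 8 (by decide) _ _ _ (fun n _ => n + 1) (fun n _ => (n * n + 1) * (n + 1))
    (fun n _ G i j => vtx n j ∈ cand G i)
    (fun n _ G => ⟨by omega, le_tabSize (table_le n).1, le_tabSize ?_⟩)
    (fun n _ G m h => ?_) (fun n _ G m h i j hj hi hrow hcol _ => ?_) (fun n _ G f hf => ?_)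
  · calc (n * n + 1) * (n + 1) ≤ (n + 1) ^ 2 * (n + 1) ^ 2 :=
        Nat.mul_le_mul (pairs_le n) (by nlinarith)
      _ = (n + 1) ^ 4 := by ring
  · simp only [val_mul, val_add, val_lit, val_nE h (by decide), and_self]
  · have hi' := row_lt hi
    obtain ⟨v, rfl⟩ := exists_vtx (Nat.lt_of_succ_lt_succ hj)
    rw [vtx_val]
    exact val_candE h (by decide) (by omega) hrow hcol
  · intro t ht j hj
    rw [hf _ (mul_add_lt (by omega) (by omega)), rowSum_eq _ _ (by omega)]
    exact sum_ind_eq_rk _ hj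

theorem cand_card_le [NeZero n] (G : SimpleGraph (Fin n)) (t : ℕ) :
    (cand G t).card ≤ (reps G).card + 2 := by
  unfold cand
  split
  · exact Finset.card_le_two.trans (Nat.le_add_left _ _)
  · exact Nat.le_add_right _ _

/-- The number of representatives. -/
def cardE : Expr := .read 8 (nE * nE * (nE + 1) + nE)

theorem val_cardE [NeZero n] {G : SimpleGraph (Fin n)} {a : ℕ} {m : Memory} (h : Good G a m)
    (ha : 8 < a) : cardE.val m = (reps G).card := by
  have h8 : Tab G 8 (m 8) := h 8 ha (by decide)
  simp only [cardE, val_read, val_add, val_mul, val_lit, val_nE h (by omega : 0 < a)]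
  rw [h8 (n * n) le_rfl n le_rfl, rk_self, cand, if_neg (lt_irrefl _)]

theorem pow_card_le_codeBound (G : SimpleGraph (Fin n)) {j : ℕ} (hj : j ≤ (reps G).card + 2) :
    4 ^ j ≤ codeBound G := by
  calc 4 ^ j ≤ 4 ^ ((reps G).card + 2) := Nat.pow_le_pow_right (by norm_num) hj
    _ = codeBound G := by rw [codeBound, pow_add]; ring

theorem codeBound_le_tabSize (G : SimpleGraph (Fin n)) : codeBound G ≤ tabSize G :=
  Nat.le_mul_of_pos_left _ (by positivity)

/-- The powers of four. -/
theorem fills_pow : Fills 9 10 (fill 9 (cardE + 3)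
    (eqE .I 0 + ltE 0 .I * (4 * .read 9 (.I - 1)))) := by
  refine fills_fill 9 (by decide) _ _ (fun n G => (reps G).card + 3) (fun n _ G i => 4 ^ i)
    (fun n _ G => ⟨?_, fun i hi => (pow_card_le_codeBound G (by omega)).trans
      (codeBound_le_tabSize G)⟩)
    (fun n _ G m h => ?_) (fun n _ G m h i hi hc hj => ?_) (fun n _ G g hg j hj => ?_)
  · exact (Nat.lt_pow_self (by norm_num : 1 < 4)).trans_le
      ((pow_card_le_codeBound G le_rfl).trans (codeBound_le_tabSize G))
  · rw [val_add, val_cardE h (by decide), val_lit]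
  · have hI : Expr.I.val m = i := hc
    rw [val_add, val_mul, val_eqE hI rfl, val_ltE rfl hI, val_mul, val_read, val_sub, hI]
    simp only [val_lit]
    cases i with
    | zero => simp [ind]
    | succ i =>
      rw [Nat.add_sub_cancel, hj i (by omega)]
      simp [ind, pow_succ, mul_comm]
  · exact hg j (by omega)

theorem fills_codeBound : Fills 10 11 (fill 10 1 (.read 9 (cardE + 2))) := by
  refine fills_fill 10 (by decide) _ _ (fun n _ => 1) (fun n _ G _ => codeBound G)
    (fun n _ G => ⟨le_tabSize (Nat.one_le_pow _ _ (by omega)), fun i hi => codeBound_le_tabSize G⟩)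
    (fun n _ G m h => rfl) (fun n _ G m h i hi hc hj => ?_) (fun n _ G g hg => hg 0 (by norm_num))
  have h9 : Tab G 9 (m 9) := h 9 (by decide) (by decide)
  rw [val_read, val_add, val_cardE h (by decide), val_lit, h9 _ le_rfl, codeBound, pow_add]
  ring

/-! ### The tables of the dynamic program -/

/-- The bound for the codes. -/
def codeE : Expr := .read 10 0

/-- The power of four belonging to the position of the vertex `x` in the candidate set `t`. -/
def powE (t x : Expr) : Expr := .read 9 (.read 8 (t * (nE + 1) + x))

/-- The digit of the vertex `x`. -/
def digE (t x c : Expr) : Expr := c / powE t x % 4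

/-- Entries of the table for the trees inside the candidate set. -/
def growE (t c : Expr) : Expr :=
  ltE 0 (.read 11 ((t * codeE + c) * (nE * nE + 1) + nE * nE))

/-- Entries of the table for the later stages. -/
def stageE (t i c : Expr) : Expr :=
  ltE 0 (.read 12 (((t * (nE + 1) + i) * codeE + c) * (nE + 1) + nE))

section

variable [NeZero n] {G : SimpleGraph (Fin n)} {a : ℕ} {m : Memory} {et ei ec ex : Expr} {t i c : ℕ}
  {x : Fin n}

theorem val_codeE (h : Good G a m) (ha : 10 < a) : codeE.val m = codeBound G :=
  h 10 ha (by decide)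

theorem val_powE (h : Good G a m) (ha : 9 < a) (htn : t ≤ n * n) (ht : et.val m = t)
    (hx : ex.val m = x) : (powE et ex).val m = 4 ^ rk (cand G t) x := by
  have h8 : Tab G 8 (m 8) := h 8 (by omega) (by decide)
  have h9 : Tab G 9 (m 9) := h 9 ha (by decide)
  simp only [powE, val_read, val_add, val_mul, val_lit, ht, hx, val_nE h (by omega : 0 < a)]
  rw [h8 t htn x x.2.le, h9]
  refine le_trans ?_ (cand_card_le G t)
  exact Finset.card_le_card (Finset.filter_subset _ _)

theorem val_digE (h : Good G a m) (ha : 9 < a) (htn : t ≤ n * n) (ht : et.val m = t)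
    (hx : ex.val m = x) (hc : ec.val m = c) : (digE et ex ec).val m = dig (cand G t) x c := by
  rw [digE, val_mod, val_div, val_powE h ha htn ht hx, hc]
  rfl

theorem val_growE (h : Good G a m) (ha : 11 < a) (htn : t ≤ n * n) (hcb : c < codeBound G)
    (ht : et.val m = t) (hc : ec.val m = c) :
    (growE et ec).val m = ind (StageCode G (cand G t) 0 c) := by
  have h11 : Tab G 11 (m 11) := h 11 ha (by decide)
  refine val_posE rfl ?_
  simp only [val_read, val_add, val_mul, val_lit, ht, hc, val_nE h (by omega : 0 < a),
    val_codeE h (by omega)]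
  exact h11 t htn c hcb

theorem val_stageE (h : Good G a m) (ha : 12 < a) (htn : t ≤ n * n) (hin : i ≤ n)
    (hcb : c < codeBound G) (ht : et.val m = t) (hi : ei.val m = i) (hc : ec.val m = c) :
    (stageE et ei ec).val m = ind (StageCode G (cand G t) i c) := by
  have h12 : Tab G 12 (m 12) := h 12 ha (by decide)
  refine val_posE rfl ?_
  simp only [val_read, val_add, val_mul, val_lit, ht, hi, hc, val_nE h (by omega : 0 < a),
    val_codeE h (by omega)]
  exact h12 t htn i hin c hcb

end

/-- The condition `c = c - s + s` says that `s ≤ c`, and can be tested by an expression. -/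
theorem exists_eq_add_iff {c s : ℕ} {P : ℕ → Prop} :
    (∃ c', c = c' + s ∧ P c') ↔ c = c - s + s ∧ P (c - s) := by
  constructor
  · rintro ⟨c', rfl, h⟩
    rw [Nat.add_sub_cancel]
    exact ⟨rfl, h⟩
  · rintro ⟨h1, h2⟩
    exact ⟨_, h1, h2⟩

/-- The condition in `stageCode_zero_iff`. -/
def GrowStep (G : SimpleGraph (Fin n)) (R : Finset (Fin n)) (c : ℕ) (x y : Fin n) : Prop :=
  x ∈ R ∧ y ∈ R ∧ G.Adj x y ∧ (c = 4 ^ rk R x + 4 ^ rk R y ∨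
    (c = c - (4 ^ rk R x + 4 ^ rk R y) + (4 ^ rk R x + 4 ^ rk R y) ∧
      StageCode G R 0 (c - (4 ^ rk R x + 4 ^ rk R y)) ∧
      dig R y (c - (4 ^ rk R x + 4 ^ rk R y)) = 0 ∧
      0 < dig R x (c - (4 ^ rk R x + 4 ^ rk R y)) ∧
      dig R x (c - (4 ^ rk R x + 4 ^ rk R y)) < 3) ∨
    (c = c - 4 ^ rk R y + 4 ^ rk R y ∧ StageCode G R 0 (c - 4 ^ rk R y) ∧
      dig R y (c - 4 ^ rk R y) = 0 ∧ dig R x (c - 4 ^ rk R y) = 3))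

theorem exists_growStep_iff {G : SimpleGraph (Fin n)} {R : Finset (Fin n)} {c : ℕ} :
    (∃ x y, GrowStep G R c x y) ↔ StageCode G R 0 c := by
  rw [stageCode_zero_iff]
  simp only [exists_eq_add_iff, GrowStep]
  constructor
  · rintro ⟨x, y, hx, hy, h⟩
    exact ⟨x, hx, y, hy, h⟩
  · rintro ⟨x, hx, y, hy, h⟩
    exact ⟨x, y, hx, hy, h⟩

/-- The expression for `GrowStep`. -/
def growStepE (t c x y : Expr) : Expr :=
  let s := powE t x + powE t y
  andE (candE t x) (andE (candE t y) (andE (adjE x y) (orE (eqE c s) (orE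
    (andE (eqE c (c - s + s)) (andE (growE t (c - s)) (andE (eqE (digE t y (c - s)) 0)
      (andE (ltE 0 (digE t x (c - s))) (ltE (digE t x (c - s)) 3)))))
    (andE (eqE c (c - powE t y + powE t y)) (andE (growE t (c - powE t y))
      (andE (eqE (digE t y (c - powE t y)) 0) (eqE (digE t x (c - powE t y)) 3))))))))

theorem exists_pair_lt_iff [NeZero n] {P : Fin n → Fin n → Prop} :
    (∃ k < n * n, P (vtx n (k / n)) (vtx n k)) ↔ ∃ x y, P x y := by
  constructor
  · rintro ⟨k, _, h⟩
    exact ⟨_, _, h⟩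
  · rintro ⟨x, y, h⟩
    refine ⟨x * n + y, mul_add_lt x.2 y.2, ?_⟩
    rwa [vtx_mul_add, mul_add_div_eq y.2, vtx_val]

theorem sq_le (n : ℕ) : n * n + 1 ≤ (n + 1) ^ 4 :=
  (pairs_le n).trans (Nat.pow_le_pow_right (by omega) (by norm_num))

theorem growTab_eq [NeZero n] {G : SimpleGraph (Fin n)} {t c : ℕ} (hc : c < codeBound G) :
    0 < rowSum (n * n + 1) (fun i j => ind (GrowStep G (cand G (i / codeBound G))
      (i % codeBound G) (vtx n (j / n)) (vtx n j))) ((t * codeBound G + c) * (n * n + 1) + n * n) ↔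
      StageCode G (cand G t) 0 c := by
  rw [rowSum_pos_iff (by omega), mul_add_div_eq hc, mul_add_mod_eq hc, exists_pair_lt_iff
    (P := fun x y => GrowStep G (cand G t) c x y), exists_growStep_iff]

/-- The codes of the trees inside the candidate sets. -/
theorem fills_grow : Fills 11 12 (fillSum 11 (nE * nE + 1) ((nE * nE + 1) * codeE * (nE * nE + 1))
    (growStepE (.I / (nE * nE + 1) / codeE) (.I / (nE * nE + 1) % codeE)
      ((.I % (nE * nE + 1) - 1) / nE) ((.I % (nE * nE + 1) - 1) % nE))) := by
  refine fills_fillSum 11 (by decide) _ _ _ (fun n _ => n * n + 1)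
    (fun n G => (n * n + 1) * codeBound G * (n * n + 1))
    (fun n _ G i j => GrowStep G (cand G (i / codeBound G)) (i % codeBound G)
      (vtx n (j / n)) (vtx n j))
    (fun n _ G => ⟨by omega, le_tabSize (sq_le n), ?_⟩)
    (fun n _ G m h => ?_) (fun n _ G m h i j hj hi hrow hcol hprev => ?_) (fun n _ G f hf => ?_)
  · rw [mul_right_comm]
    refine mul_le_tabSize ?_
    calc (n * n + 1) * (n * n + 1) ≤ (n + 1) ^ 2 * (n + 1) ^ 2 :=
        Nat.mul_le_mul (pairs_le n) (pairs_le n)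
      _ = (n + 1) ^ 4 := by ring
  · simp only [val_mul, val_add, val_lit, val_nE h (by decide), val_codeE h (by decide), and_self]
  · have h0 := val_nE h (by decide)
    have hC := val_codeE h (by decide)
    obtain ⟨t, c, ht, hcb, rfl⟩ := exists_mul_add (row_lt hi)
    obtain ⟨x, y, hx, hy, rfl⟩ := exists_mul_add (Nat.lt_of_succ_lt_succ hj)
    obtain ⟨x, rfl⟩ := exists_vtx hx
    obtain ⟨y, rfl⟩ := exists_vtx hy
    rw [mul_add_div_eq hcb, mul_add_mod_eq hcb, vtx_mul_add, mul_add_div_eq y.2, vtx_val]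
    have ht' : t ≤ n * n := by omega
    have vt : (Expr.I / (nE * nE + 1) / codeE).val m = t := by
      rw [val_div, hrow, hC, mul_add_div_eq hcb]
    have vc : (Expr.I / (nE * nE + 1) % codeE).val m = c := by
      rw [val_mod, hrow, hC, mul_add_mod_eq hcb]
    have vx : ((Expr.I % (nE * nE + 1) - 1) / nE).val m = x := by
      rw [val_div, hcol, h0, mul_add_div_eq y.2]
    have vy : ((Expr.I % (nE * nE + 1) - 1) % nE).val m = y := by
      rw [val_mod, hcol, h0, mul_add_mod_eq y.2]
    generalize Expr.I / (nE * nE + 1) / codeE = et at *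
    generalize Expr.I / (nE * nE + 1) % codeE = ec at *
    generalize (Expr.I % (nE * nE + 1) - 1) / nE = ex at *
    generalize (Expr.I % (nE * nE + 1) - 1) % nE = ey at *
    have vpx := val_powE h (by decide) ht' vt vx
    have vpy := val_powE h (by decide) ht' vt vy
    have vs : (powE et ex + powE et ey).val m =
        4 ^ rk (cand G t) x + 4 ^ rk (cand G t) y := by rw [val_add, vpx, vpy]
    have vcs : (ec - (powE et ex + powE et ey)).val m =
        c - (4 ^ rk (cand G t) x + 4 ^ rk (cand G t) y) := by rw [val_sub, vc, vs]
    have vcp : (ec - powE et ey).val m = c - 4 ^ rk (cand G t) y := by rw [val_sub, vc, vpy]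
    have vread : ∀ e s, e.val m = c - s → 0 < s → c = c - s + s →
        (growE et e).val m = ind (StageCode G (cand G t) 0 (c - s)) := by
      intro e s he hs hcs
      refine val_posE rfl ?_
      simp only [val_read, val_add, val_mul, val_lit, vt, he, h0, hC]
      rw [hprev, growTab_eq (by omega)]
      have h1 : t * codeBound G + (c - s) < t * codeBound G + c := by omega
      have := mul_add_lt h1 (by omega : n * n < n * n + 1)
      omega
    have p1 : 0 < 4 ^ rk (cand G t) x := by positivity
    have p2 : 0 < 4 ^ rk (cand G t) y := by positivity
    exact val_andE (val_candE h (by decide) ht' vt vx) fun _ =>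
      val_andE (val_candE h (by decide) ht' vt vy) fun _ =>
      val_andE (val_adjE h (by decide) vx vy) fun _ =>
      val_orE (val_eqE vc vs) (val_orE
        (val_andE (val_eqE vc (by rw [val_add, vcs, vs])) fun hcs =>
          val_andE (vread _ _ vcs (by omega) hcs) fun _ =>
          val_andE (val_eqE (val_digE h (by decide) ht' vt vy vcs) rfl) fun _ =>
          val_andE (val_ltE rfl (val_digE h (by decide) ht' vt vx vcs)) fun _ =>
          val_ltE (val_digE h (by decide) ht' vt vx vcs) rfl)
        (val_andE (val_eqE vc (by rw [val_add, vcp, vpy])) fun hcs =>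
          val_andE (vread _ _ vcp p2 hcs) fun _ =>
          val_andE (val_eqE (val_digE h (by decide) ht' vt vy vcp) rfl) fun _ =>
          val_eqE (val_digE h (by decide) ht' vt vx vcp) rfl))
  · intro t ht c hc
    rw [hf, growTab_eq hc]
    exact mul_add_lt (mul_add_lt (by omega) hc) (by omega)

/-- The condition in `stageCode_succ_iff`. -/
def StageStep [NeZero n] (G : SimpleGraph (Fin n)) (R : Finset (Fin n)) (i c : ℕ) (x : Fin n) :
    Prop :=
  (i = 0 ∧ StageCode G R 0 c) ∨ (0 < i ∧ ((vtx n (i - 1) ∈ R ∧ StageCode G R (i - 1) c) ∨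
    (vtx n (i - 1) ∉ R ∧ x ∈ R ∧ G.Adj x (vtx n (i - 1)) ∧
      ((c = c - 4 ^ rk R x + 4 ^ rk R x ∧ StageCode G R (i - 1) (c - 4 ^ rk R x) ∧
        0 < dig R x (c - 4 ^ rk R x) ∧ dig R x (c - 4 ^ rk R x) < 3) ∨
      (StageCode G R (i - 1) c ∧ dig R x c = 3)))))

theorem exists_stageStep_iff [NeZero n] {G : SimpleGraph (Fin n)} {R : Finset (Fin n)} {i c : ℕ}
    (hi : i ≤ n) : (∃ x, StageStep G R i c x) ↔ StageCode G R i c := by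
  have : Nonempty (Fin n) := ⟨vtx n 0⟩
  cases i with
  | zero => simp [StageStep]
  | succ i =>
    obtain ⟨v, rfl⟩ := exists_vtx hi
    rw [stageCode_succ_iff]
    simp only [exists_eq_add_iff, StageStep, Nat.add_sub_cancel, vtx_val]
    constructor
    · rintro ⟨x, ⟨h, -⟩ | ⟨-, h | ⟨h1, h2, h3⟩⟩⟩
      · omega
      · exact Or.inl h
      · exact Or.inr ⟨h1, x, h2, h3⟩
    · rintro (h | ⟨h1, x, h2, h3⟩)
      · exact ⟨Classical.arbitrary _, Or.inr ⟨by omega, Or.inl h⟩⟩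
      · exact ⟨x, Or.inr ⟨by omega, Or.inr ⟨h1, h2, h3⟩⟩⟩

/-- The expression for `StageStep`. -/
def stageStepE (t i c x : Expr) : Expr :=
  let v := i - 1
  let p := powE t x
  orE (andE (eqE i 0) (growE t c)) (andE (ltE 0 i) (orE (andE (candE t v) (stageE t v c))
    (andE (notE (candE t v)) (andE (candE t x) (andE (adjE x v) (orE
      (andE (eqE c (c - p + p)) (andE (stageE t v (c - p))
        (andE (ltE 0 (digE t x (c - p))) (ltE (digE t x (c - p)) 3))))
      (andE (stageE t v c) (eqE (digE t x c) 3))))))))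

theorem stageTab_eq [NeZero n] {G : SimpleGraph (Fin n)} {t i c : ℕ} (hi : i ≤ n)
    (hc : c < codeBound G) :
    0 < rowSum (n + 1) (fun k j => ind (StageStep G (cand G (k / codeBound G / (n + 1)))
      (k / codeBound G % (n + 1)) (k % codeBound G) (vtx n j)))
      (((t * (n + 1) + i) * codeBound G + c) * (n + 1) + n) ↔ StageCode G (cand G t) i c := by
  rw [rowSum_pos_iff (by omega), mul_add_div_eq hc, mul_add_mod_eq hc,
    mul_add_div_eq (by omega : i < n + 1), mul_add_mod_eq (by omega : i < n + 1),
    exists_lt_iff_exists_vtx (P := fun x => StageStep G (cand G t) i c x), exists_stageStep_iff hi]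

/-- The codes of the trees of all stages. -/
theorem fills_stage : Fills 12 13 (fillSum 12 (nE + 1)
    ((nE * nE + 1) * (nE + 1) * codeE * (nE + 1))
    (stageStepE (rowE / codeE / (nE + 1)) (rowE / codeE % (nE + 1)) (rowE % codeE) colE)) := by
  refine fills_fillSum 12 (by decide) _ _ _ (fun n _ => n + 1)
    (fun n G => (n * n + 1) * (n + 1) * codeBound G * (n + 1))
    (fun n _ G k j => StageStep G (cand G (k / codeBound G / (n + 1)))
      (k / codeBound G % (n + 1)) (k % codeBound G) (vtx n j))
    (fun n _ G => ⟨by omega, le_tabSize (table_le n).1, ?_⟩)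
    (fun n _ G m h => ?_) (fun n _ G m h k j hj hk hrow hcol hprev => ?_) (fun n _ G f hf => ?_)
  · rw [mul_right_comm]
    refine mul_le_tabSize ?_
    calc (n * n + 1) * (n + 1) * (n + 1) ≤ (n + 1) ^ 2 * (n + 1) * (n + 1) :=
        Nat.mul_le_mul_right _ (Nat.mul_le_mul_right _ (pairs_le n))
      _ = (n + 1) ^ 4 := by ring
  · simp only [val_mul, val_add, val_lit, val_nE h (by decide), val_codeE h (by decide), and_self]
  · have h0 := val_nE h (by decide)
    have hC := val_codeE h (by decide)
    obtain ⟨k₁, c, hk₁, hcb, rfl⟩ := exists_mul_add (row_lt hk)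
    obtain ⟨t, i, ht, hi, rfl⟩ := exists_mul_add hk₁
    obtain ⟨x, rfl⟩ := exists_vtx (Nat.lt_of_succ_lt_succ hj)
    rw [mul_add_div_eq hcb, mul_add_mod_eq hcb, mul_add_div_eq hi, mul_add_mod_eq hi, vtx_val]
    have ht' : t ≤ n * n := by omega
    change rowE.val m = _ at hrow
    change colE.val m = _ at hcol
    have vt : (rowE / codeE / (nE + 1)).val m = t := by
      rw [val_div, val_div, val_add, hrow, hC, h0, mul_add_div_eq hcb]
      exact mul_add_div_eq hi
    have vi : (rowE / codeE % (nE + 1)).val m = i := by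
      rw [val_mod, val_div, val_add, hrow, hC, h0, mul_add_div_eq hcb]
      exact mul_add_mod_eq hi
    have vc : (rowE % codeE).val m = c := by rw [val_mod, hrow, hC, mul_add_mod_eq hcb]
    generalize rowE / codeE / (nE + 1) = et at *
    generalize rowE / codeE % (nE + 1) = ei at *
    generalize rowE % codeE = ec at *
    have vi1 : (ei - 1).val m = i - 1 := by rw [val_sub, vi, val_lit]
    have vv : 0 < i → (ei - 1).val m = (vtx n (i - 1)).val := fun _ =>
      vi1.trans (Nat.mod_eq_of_lt (by omega)).symm
    have vp := val_powE h (by decide) ht' vt hcol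
    have vcp : (ec - powE et colE).val m = c - 4 ^ rk (cand G t) x := by rw [val_sub, vc, vp]
    have vread : 0 < i → ∀ e c', e.val m = c' → c' ≤ c →
        (stageE et (ei - 1) e).val m = ind (StageCode G (cand G t) (i - 1) c') := by
      intro hi0 e c' he hc'
      refine val_posE rfl ?_
      simp only [val_read, val_add, val_mul, val_lit, vt, vi1, he, h0, hC]
      rw [hprev, stageTab_eq (by omega) (by omega)]
      have h1 : t * (n + 1) + (i - 1) < t * (n + 1) + i := by omega
      have h2 := mul_add_lt (mul_add_lt h1 (by omega : c' < codeBound G))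
        (by omega : n < n + 1)
      refine h2.trans_le ?_
      rw [add_mul (_ * codeBound G)]
      omega
    exact val_orE (val_andE (val_eqE vi rfl) fun _ => val_growE h (by decide) ht' hcb vt vc)
      (val_andE (val_ltE rfl vi) fun hi0 =>
        have vcand := val_candE h (by decide) ht' vt (vv hi0)
        val_orE (val_andE vcand fun _ => vread hi0 _ _ vc le_rfl)
          (val_andE (val_notE vcand) fun _ =>
            val_andE (val_candE h (by decide) ht' vt hcol) fun _ =>
            val_andE (val_adjE h (by decide) hcol (vv hi0)) fun _ =>
            val_orE
              (val_andE (val_eqE vc (by rw [val_add, vcp, vp])) fun _ =>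
                val_andE (vread hi0 _ _ vcp (Nat.sub_le _ _)) fun _ =>
                val_andE (val_ltE rfl (val_digE h (by decide) ht' vt hcol vcp)) fun _ =>
                val_ltE (val_digE h (by decide) ht' vt hcol vcp) rfl)
              (val_andE (vread hi0 _ _ vc le_rfl) fun _ =>
                val_eqE (val_digE h (by decide) ht' vt hcol vc) rfl)))
  · intro t ht i hi c hc
    rw [hf, stageTab_eq hi hc]
    exact mul_add_lt (mul_add_lt (mul_add_lt (by omega) (by omega)) hc) (by omega)

/-- The even digits of the codes, which rule out a code as the end result. -/
theorem fills_even : Fills 13 14 (fillSum 13 (nE + 1) ((nE * nE + 1) * codeE * (nE + 1))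
    (andE (candE (rowE / codeE) colE) (eqE (digE (rowE / codeE) colE (rowE % codeE) % 2) 0))) := by
  refine fills_fillSum 13 (by decide) _ _ _ (fun n _ => n + 1)
    (fun n G => (n * n + 1) * codeBound G * (n + 1))
    (fun n _ G i j => vtx n j ∈ cand G (i / codeBound G) ∧
      dig (cand G (i / codeBound G)) (vtx n j) (i % codeBound G) % 2 = 0)
    (fun n _ G => ⟨by omega, le_tabSize (table_le n).1, ?_⟩)
    (fun n _ G m h => ?_) (fun n _ G m h i j hj hi hrow hcol _ => ?_) (fun n _ G f hf => ?_)
  · rw [mul_right_comm]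
    refine mul_le_tabSize ?_
    calc (n * n + 1) * (n + 1) ≤ (n + 1) ^ 2 * (n + 1) ^ 2 :=
        Nat.mul_le_mul (pairs_le n) (by nlinarith)
      _ = (n + 1) ^ 4 := by ring
  · simp only [val_mul, val_add, val_lit, val_nE h (by decide), val_codeE h (by decide), and_self]
  · have hC := val_codeE h (by decide)
    obtain ⟨t, c, ht, hcb, rfl⟩ := exists_mul_add (row_lt hi)
    obtain ⟨x, rfl⟩ := exists_vtx (Nat.lt_of_succ_lt_succ hj)
    rw [mul_add_div_eq hcb, mul_add_mod_eq hcb, vtx_val]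
    have ht' : t ≤ n * n := by omega
    change rowE.val m = _ at hrow
    change colE.val m = _ at hcol
    have vt : (rowE / codeE).val m = t := by rw [val_div, hrow, hC, mul_add_div_eq hcb]
    have vc : (rowE % codeE).val m = c := by rw [val_mod, hrow, hC, mul_add_mod_eq hcb]
    exact val_andE (val_candE h (by decide) ht' vt hcol) fun _ =>
      val_eqE (by rw [val_mod, val_digE h (by decide) ht' vt hcol vc, val_lit]) rfl
  · intro t ht c hc
    rw [hf _ (mul_add_lt (mul_add_lt (by omega) hc) (by omega)), rowSum_pos_iff (by omega),
      mul_add_div_eq hc, mul_add_mod_eq hc, exists_lt_iff_exists_vtx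
      (P := fun x => x ∈ cand G t ∧ dig (cand G t) x c % 2 = 0)]

/-- The number of the pairs of a candidate set and a code, plus one. -/
def pairsE : Expr := (nE * nE + 1) * codeE + 1

/-- The number of the candidate sets and codes that give a HIST, as a table of partial sums with a
single row. -/
theorem fills_answer : Fills 14 15 (fillSum 14 pairsE pairsE
    (andE (stageE ((.I % pairsE - 1) / codeE) nE ((.I % pairsE - 1) % codeE))
      (notE (ltE 0 (.read 13 (((.I % pairsE - 1) / codeE * codeE + (.I % pairsE - 1) % codeE) *
        (nE + 1) + nE)))))) := by
  refine fills_fillSum 14 (by decide) _ _ _ (fun n G => (n * n + 1) * codeBound G + 1)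
    (fun n G => (n * n + 1) * codeBound G + 1)
    (fun n _ G _ j => StageCode G (cand G (j / codeBound G)) n (j % codeBound G) ∧
      ¬ ∃ x ∈ cand G (j / codeBound G),
        dig (cand G (j / codeBound G)) x (j % codeBound G) % 2 = 0)
    (fun n _ G => ?_)
    (fun n _ G m h => ?_) (fun n _ G m h i j hj hi _ hcol _ => ?_) (fun n _ G f hf => ?_)
  · have h1 : (n * n + 1) * codeBound G + 1 ≤ (n * n + 1 + 1) * codeBound G := by
      rw [add_mul (n * n + 1)]
      have := codeBound_pos G
      omega
    have h2 : n * n + 1 + 1 ≤ (n + 1) ^ 4 := by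
      have h3 := pairs_le n
      have h4 : 2 ≤ (n + 1) ^ 2 := by
        have := NeZero.pos n
        nlinarith
      have h5 : (n + 1) ^ 4 = (n + 1) ^ 2 * (n + 1) ^ 2 := by ring
      nlinarith
    have := h1.trans (mul_le_tabSize h2)
    exact ⟨by omega, this, this⟩
  · simp only [pairsE, val_mul, val_add, val_lit, val_nE h (by decide), val_codeE h (by decide),
      and_self]
  · have h0 := val_nE h (by decide)
    have hC := val_codeE h (by decide)
    obtain ⟨t, c, ht, hcb, rfl⟩ := exists_mul_add (Nat.lt_of_succ_lt_succ hj)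
    rw [mul_add_div_eq hcb, mul_add_mod_eq hcb]
    have ht' : t ≤ n * n := by omega
    have vt : ((Expr.I % pairsE - 1) / codeE).val m = t := by
      rw [val_div, hcol, hC, mul_add_div_eq hcb]
    have vc : ((Expr.I % pairsE - 1) % codeE).val m = c := by
      rw [val_mod, hcol, hC, mul_add_mod_eq hcb]
    have h13 : Tab G 13 (m 13) := h 13 (by decide) (by decide)
    refine val_andE (val_stageE h (by decide) ht' le_rfl hcb vt h0 vc) fun _ =>
      val_notE (val_posE rfl ?_)
    rw [val_read, val_add, val_mul, val_add, val_mul, val_add, vt, vc, h0, hC]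
    exact h13 t ht' c hcb
  · change 0 < f ((n * n + 1) * codeBound G) ↔ ∃ t ≤ n * n, Accept G (cand G t)
    have key := rowSum_pos_iff (L := (n * n + 1) * codeBound G + 1) (i := 0)
      (Nat.lt_succ_self ((n * n + 1) * codeBound G))
      (P := fun _ j => StageCode G (cand G (j / codeBound G)) n (j % codeBound G) ∧
        ¬ ∃ x ∈ cand G (j / codeBound G),
          dig (cand G (j / codeBound G)) x (j % codeBound G) % 2 = 0)
    rw [zero_mul, zero_add] at key
    rw [hf _ (Nat.lt_succ_self _), key]
    simp only [accept_iff]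
    constructor
    · rintro ⟨k, hk, h2, h3⟩
      obtain ⟨t, c, ht, hc, rfl⟩ := exists_mul_add hk
      rw [mul_add_div_eq hc, mul_add_mod_eq hc] at h2 h3
      exact ⟨t, by omega, c, h2, fun x hx h4 => h3 ⟨x, hx, h4⟩⟩
    · rintro ⟨t, ht, c, h2, h3⟩
      have hc := h2.lt_codeBound
      refine ⟨t * codeBound G + c, mul_add_lt (by omega) hc, ?_⟩
      rw [mul_add_div_eq hc, mul_add_mod_eq hc]
      exact ⟨h2, fun ⟨x, hx, h4⟩ => h3 x hx h4⟩

/-! ### The program -/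

theorem exists_accept_cand_iff [NeZero n] {G : SimpleGraph (Fin n)} (hn : 2 ≤ n) :
    (∃ t ≤ n * n, Accept G (cand G t)) ↔ HasHIST G := by
  rw [hasHIST_iff_accept hn]
  constructor
  · rintro ⟨t, -, h⟩
    unfold cand at h
    split at h
    · exact Or.inl ⟨_, _, h⟩
    · exact Or.inr h
  · rintro (⟨x, y, h⟩ | h)
    · have hlt := mul_add_lt x.2 y.2
      refine ⟨x * n + y, hlt.le, ?_⟩
      rw [cand, if_pos hlt, vtx_mul_add, mul_add_div_eq y.2, vtx_val]
      exact h
    · refine ⟨n * n, le_rfl, ?_⟩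
      rw [cand, if_neg (lt_irrefl _)]
      exact h

theorem exists_fills : ∃ p, Fills 3 15 p :=
  ⟨_, .seq fills_closure <| .seq fills_sim <| .seq fills_simDeg <| .seq fills_reps <|
    .seq fills_cand <| .seq fills_rank <| .seq fills_pow <| .seq fills_codeBound <|
    .seq fills_grow <| .seq fills_stage <| .seq fills_even fills_answer⟩

theorem good_graphInput [NeZero n] (G : SimpleGraph (Fin n)) : Good G 3 (graphInput G) := by
  intro b hb hc
  have hc' : b ≠ 2 := hc
  obtain rfl | rfl : b = 0 ∨ b = 1 := by omega
  · change graphInput G 0 0 = n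
    simp [graphInput]
  · intro u v
    simp only [graphInput, one_ne_zero, false_and, if_false, true_and, ind]
    congr 1
    refine propext ⟨?_, fun h => ⟨rfl, u, v, rfl, h⟩⟩
    rintro ⟨-, u', v', h, hadj⟩
    have h1 := congrArg (· % n) h
    have h2 := congrArg (· / n) h
    simp only [mul_add_mod_eq v.2, mul_add_mod_eq v'.2, mul_add_div_eq v.2,
      mul_add_div_eq v'.2] at h1 h2
    rwa [Fin.ext h1, Fin.ext h2]

theorem memBdd_graphInput (G : SimpleGraph (Fin n)) {b : ℕ} (hb : n < 2 ^ b) (hb1 : 1 ≤ b) :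
    MemBdd b (graphInput G) := by
  intro a i
  have : 2 ≤ 2 ^ b := Nat.le_self_pow (by omega) 2
  unfold graphInput
  split
  · exact hb
  · split <;> omega

theorem tabSize_lt (G : SimpleGraph (Fin n)) : tabSize G < 2 ^ (6 * n + 5) := by
  have h1 : n + 1 ≤ 2 ^ n := Nat.lt_two_pow_self
  have h2 : (reps G).card ≤ n := (Finset.card_le_univ _).trans (by rw [Fintype.card_fin])
  calc tabSize G ≤ (2 ^ n) ^ 4 * (16 * 4 ^ n) := by
        unfold tabSize codeBound
        gcongr
        norm_num
    _ = 2 ^ (6 * n + 4) := by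
        rw [show (16 : ℕ) = 2 ^ 4 by norm_num, show (4 : ℕ) ^ n = 2 ^ (2 * n) by
          rw [pow_mul]; norm_num, ← pow_mul, ← pow_add, ← pow_add]
        congr 1
        ring
    _ < 2 ^ (6 * n + 5) := Nat.pow_lt_pow_right (by norm_num) (by omega)

theorem hasHIST_of_unique {G : SimpleGraph (Fin 1)} : HasHIST G :=
  ⟨⊥, bot_le, IsTree.of_subsingleton, fun v => by simp [neighborSet]⟩

theorem not_hasHIST_of_isEmpty {G : SimpleGraph (Fin 0)} : ¬ HasHIST G := by
  rintro ⟨T, -, hT, -⟩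
  obtain ⟨v⟩ := hT.connected.nonempty
  exact v.elim0

/-- The answer is written to cell `0` of bank `0`; for less than two vertices, the number of
vertices stands there already and is the answer. -/
theorem exists_decidesWithin : ∃ (p : Prog) (M : ℕ), ∀ (n : ℕ) (G : SimpleGraph (Fin n)),
    DecidesWithin p G (HasHIST G)
      (4 ^ modularWidth G * (((n + 1) ^ 4 * 256 + 1) * unitCost M (6 * n + 5))) := by
  obtain ⟨p, M₁, hp⟩ := exists_fills
  obtain ⟨out, hout⟩ : ∃ e : Expr, e = ltE 0 (.read 14 ((nE * nE + 1) * codeE)) := ⟨_, rfl⟩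
  obtain ⟨M₂, hM₂⟩ : ∃ M, M = 2 * (0 : Expr).weight + 2 * out.weight := ⟨_, rfl⟩
  obtain ⟨M₀, hM₀⟩ : ∃ M, M = (ltE 1 nE).weight := ⟨_, rfl⟩
  refine ⟨.ite (ltE 1 nE) (.seq p (.write 0 0 out)) .skip, M₀ + 2 + (M₁ + M₂), fun n G => ?_⟩
  obtain ⟨b, hb⟩ : ∃ b, b = 6 * n + 5 := ⟨_, rfl⟩
  rw [← hb]
  have hb1 : 1 ≤ b := by omega
  have hnb : n < 2 ^ b := lt_of_le_of_lt (by omega : n ≤ b) Nat.lt_two_pow_self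
  have hmem := memBdd_graphInput G hnb hb1
  have htest := (ltE 1 nE).cost_le hb1 hmem
  rw [← hM₀] at htest
  change _ ≤ unitCost M₀ b at htest
  have h0 : nE.val (graphInput G) = n := by
    change graphInput G 0 0 = n
    simp [graphInput]
  have hval : (ltE 1 nE).val (graphInput G) = ind (1 < n) := val_ltE rfl h0
  have hunit : 2 ≤ unitCost 2 b := by unfold unitCost; nlinarith [Nat.zero_le b]
  have hcost := unitCost_add M₀ 2 b
  have hcost' := unitCost_add (M₀ + 2) (M₁ + M₂) b
  have h4 : 1 ≤ 4 ^ modularWidth G := Nat.one_le_pow _ _ (by norm_num)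
  by_cases hn : 1 < n
  · have : NeZero n := ⟨by omega⟩
    have hsz : tabSize G < 2 ^ b := hb ▸ tabSize_lt G
    obtain ⟨m₁, hr₁, hm₁, hG₁⟩ := hp n G b (graphInput G) hb1 hsz hmem (good_graphInput G)
    have hr₂ := Run.write hb1 hm₁ 0 0 out
    rw [← hM₂] at hr₂
    obtain ⟨t, ht, hex⟩ := hr₁.seq hr₂
    refine ⟨_, _, Exec.ite_true ?_ hex, ?_, ?_⟩
    · rw [hval]
      exact (ind_pos.2 hn).ne'
    · have h1 : tabSize G + 1 ≤ 4 ^ modularWidth G * ((n + 1) ^ 4 * 256 + 1) := by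
        have h2 : codeBound G ≤ 256 * 4 ^ modularWidth G := by
          calc codeBound G ≤ 16 * 4 ^ (modularWidth G + 2) := by
                unfold codeBound
                gcongr
                · norm_num
                · exact card_reps_le hn
            _ = 256 * 4 ^ modularWidth G := by rw [pow_add]; ring
        have h3 : tabSize G ≤ (n + 1) ^ 4 * (256 * 4 ^ modularWidth G) :=
          Nat.mul_le_mul_left _ h2
        have h5 : (n + 1) ^ 4 * (256 * 4 ^ modularWidth G) =
            4 ^ modularWidth G * ((n + 1) ^ 4 * 256) := by ring
        rw [Nat.mul_add]
        omega
      rw [← mul_assoc]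
      refine le_trans ?_ (Nat.mul_le_mul_right _ h1)
      have h6 : unitCost M₀ b + unitCost 2 b + (unitCost M₁ b + unitCost M₂ b) ≤
          unitCost (M₀ + 2 + (M₁ + M₂)) b :=
        (Nat.add_le_add hcost (unitCost_add M₁ M₂ b)).trans hcost'
      have h7 := Nat.mul_le_mul_left (tabSize G + 1) h6
      have h8 : unitCost M₀ b + unitCost 2 b + unitCost M₂ b ≤
          (tabSize G + 1) * (unitCost M₀ b + unitCost 2 b + unitCost M₂ b) :=
        Nat.le_mul_of_pos_left _ (by omega)
      have h9 : (tabSize G + 1) * (unitCost M₀ b + unitCost 2 b + (unitCost M₁ b + unitCost M₂ b)) =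
          (tabSize G + 1) * (unitCost M₀ b + unitCost 2 b + unitCost M₂ b) +
            (tabSize G + 1) * unitCost M₁ b := by ring
      omega
    · have h14 : Tab G 14 (m₁ 14) := hG₁ 14 (by decide) (by decide)
      have hv : out.val m₁ = ind (HasHIST G) := by
        rw [hout]
        refine val_posE rfl ?_
        simp only [val_read, val_add, val_mul, val_lit, val_nE hG₁ (by decide),
          val_codeE hG₁ (by decide)]
        exact Iff.trans h14 (exists_accept_cand_iff hn)
      rw [hv]
      rfl
  · refine ⟨_, _, Exec.ite_false ?_ (Exec.skip _), ?_, ?_⟩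
    · rw [hval]
      simp [ind, hn]
    · calc (ltE 1 nE).cost (graphInput G) + 1 + 1 ≤ unitCost (M₀ + 2 + (M₁ + M₂)) b := by omega
        _ ≤ ((n + 1) ^ 4 * 256 + 1) * unitCost (M₀ + 2 + (M₁ + M₂)) b :=
          Nat.le_mul_of_pos_left _ (by omega)
        _ ≤ _ := Nat.le_mul_of_pos_left _ h4
    · change graphInput G 0 0 = n at h0
      rw [h0]
      obtain rfl | rfl : n = 0 ∨ n = 1 := by omega
      · rw [if_neg not_hasHIST_of_isEmpty]
      · rw [if_pos hasHIST_of_unique]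

end HIST

/-- There are one program and one polynomial `q` such that, for every graph `G` with `n` vertices,
the program (given only the adjacency matrix of `G`) decides whether `G` has a HIST in time at most
`4 ^ k * q(n)`, where `k` is the modular-width of `G`. -/
theorem mainTheorem7 :
    ∃ (p : RAM.Prog) (q : Polynomial ℕ), ∀ (n : ℕ) (G : SimpleGraph (Fin n)),
      RAM.DecidesWithin p G (HasHIST G) (4 ^ modularWidth G * q.eval n) := by
  obtain ⟨p, M, h⟩ := HIST.exists_decidesWithin
  refine ⟨p, ((Polynomial.X + 1) ^ 4 * 256 + 1) * (Polynomial.C M *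
    (1 + Polynomial.C M * (6 * Polynomial.X + 5)) ^ 2), fun n G => ?_⟩
  simpa [RAM.unitCost] using h n G
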